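/- Consider in $\mathbb R^2$ the nonlinear Schrödinger equation $$ i u_t = -\Delta u + V u + \beta(|u|^2)u , \qquad (t,x)\in\mathbb R\times\mathbb R^2, \tag{NLS}$$ with energy $E(u)=\frac12\int_{\mathbb R^2}\big(|\nabla u|^2+V|u|^2+B(|u|^2)\big)dx$, where $B(0)=0$, $B'=\beta$, and mass $Q(u)=\frac12\int_{\mathbb R^2}|u|^2dx$. Solutions $u\in C^0([0,\infty),H^1(\mathbb R^2,\mathbb C))$ are understood in the sense of distributions. Assume: * (H1) $\beta\in C^\infty(\mathbb R,\mathbb R)$ and $\beta(0)=0$. * (H2) There is $p\in\mathbb R$ such that for every $k\ge 0$ there is $C_k$ with $\big|\frac{d^k}{dv^k}\beta(v^2)\big|\le C_k|v|^{p-k-1}$ for $|v|\ge1$. * (H3) $V:\mathbb R^2\to\mathbb R$ is smooth, not identically zero, and for every multi-index $\alpha$ there are $C_\alpha,a_\alpha>0$ with $|\partial^\alpha V(x)|\le C_\alpha e^{-a_\alpha|x|}$. * (H4) There are an open interval $\mathcal O\subseteq(0,\infty)$ and a map $\omega\mapsto\phi_\omega$ which is in $C^2(\mathcal O,\Sigma_k(\mathbb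 R^2,\mathbb C))$ for every $k$, where $\|f\|_{\Sigma_k}^2=\sum_{|\alpha|\le k}(\|x^\alpha f\|_{L^2}^2+\|\partial^\alpha f\|_{L^2}^2)$, such that for all $\omega\in\mathcal O$ $$\Delta\phi_\omega-V\phi_\omega-\omega\phi_\omega-\beta(|\phi_\omega|^2)\phi_\omega=0 ,$$ that is, $e^{i\omega t}\phi_\omega$ solves (NLS); moreover $\phi_\omega(x)=e^{im\arg(x)}\psi_\omega(|x|)$ with an integer $m\ge1$ and $\psi_\omega$ real valued. * (H5) $q(\omega):=Q(\phi_\omega)$ satisfies $q'(\omega)\ne0$ for all $\omega\in\mathcal O$. For $\omega\in\mathcal O$, the bound state $e^{i\omega t}\phi_\omega$ is called * *orbitally stable* if for every $\epsilon>0$ there is $\delta>0$ such that, for every $u_0\in H^1$ with $\|\phi_\omega-u_0\|_{H^1}<\delta$, the solution $u$ of (NLS) with $u(0)=u_0$ exists for all $t\ge0$ and $\sup_{t>0}\inf_{s\in\mathbb R}\|e^{is}\phi_\omega-u(t)\|_{H^1}<\epsilon$; and *orbitally unstable* if it is not orbitally stable; * *not trapped by the energy* if for every $\varepsilon>0$ there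 is $u_\varepsilon\in H^1$ with $\|\phi_\omega-u_\varepsilon\|_{H^1}<\varepsilon$, $\|u_\varepsilon\|_{L^2}=\|\phi_\omega\|_{L^2}$ and $E(u_\varepsilon)<E(\phi_\omega)$; * *conditionally asymptotically stable* if there are $\epsilon_0>0$ and $C_0>0$ such that, whenever $u\in C^0([0,\infty),H^1)$ is a solution of (NLS) with $\sup_{t\ge0}\inf_{\vartheta\in\mathbb R}\|u(t)-e^{i\vartheta}\phi_\omega\|_{H^1}<\epsilon<\epsilon_0$, there exist $\omega_+\in\mathcal O$, $\theta\in C^1(\mathbb R;\mathbb R)$ and $h_+\in H^1$ with $\|h_+\|_{H^1}+|\omega_+-\omega|\le C_0\epsilon$ and $$\lim_{t\to\infty}\|u(t)-e^{i\theta(t)}\phi_{\omega_+}-e^{it\Delta}h_+\|_{H^1}=0 .$$ **Theorem.** Let (H1)–(H5) hold and let $\omega\in\mathcal O$. If the bound state $e^{i\omega t}\phi_\omega$ is not trapped by the energy and is conditionally asymptotically stable, then it is orbitally unstable. -/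

import Mathlib

open MeasureTheory Filter Topology Set
open scoped SchwartzMap LineDeriv Laplacian FourierTransform ENNReal

noncomputable section

namespace NLS

/-- The Euclidean plane `ℝ²`. -/
abbrev Plane : Type := EuclideanSpace ℝ (Fin 2)

/-- The complex Lebesgue space `L²(ℝ², ℂ)`. -/
abbrev L2 : Type := Lp ℂ 2 (volume : Measure Plane)

/-- The `j`-th coordinate direction. -/
def e (j : Fin 2) : Plane := EuclideanSpace.single j (1 : ℝ)

/-! ### The Sobolev space `H¹(ℝ², ℂ)` -/

/-- `g ∈ L²` is the distributional partial derivative `∂_j f` of `f ∈ L²`. -/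
def IsWeakPartial (j : Fin 2) (f g : L2) : Prop :=
  ∂_{e j} (f : 𝓢'(Plane, ℂ)) = (g : 𝓢'(Plane, ℂ))

theorem isWeakPartial_iff (j : Fin 2) (f g : L2) :
    IsWeakPartial j f g ↔ ∂_{e j} (Lp.toTemperedDistributionCLM ℂ volume 2 f) =
      Lp.toTemperedDistributionCLM ℂ volume 2 g := Iff.rfl

theorem IsWeakPartial.zero (j : Fin 2) : IsWeakPartial j 0 0 := by
  rw [isWeakPartial_iff, map_zero, LineDeriv.lineDerivOp_zero]

theorem IsWeakPartial.add {j : Fin 2} {f g f' g' : L2} (h : IsWeakPartial j f g)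
    (h' : IsWeakPartial j f' g') : IsWeakPartial j (f + f') (g + g') := by
  rw [isWeakPartial_iff] at h h' ⊢
  rw [map_add, map_add, LineDeriv.lineDerivOp_add, h, h']

theorem IsWeakPartial.smul {j : Fin 2} {f g : L2} (c : ℂ) (h : IsWeakPartial j f g) :
    IsWeakPartial j (c • f) (c • g) := by
  rw [isWeakPartial_iff] at h ⊢
  rw [map_smul, map_smul, LineDeriv.lineDerivOp_smul, h]

theorem IsWeakPartial.schwartz (j : Fin 2) (f : 𝓢(Plane, ℂ)) :
    IsWeakPartial j (SchwartzMap.toLp f 2 volume) (SchwartzMap.toLp (∂_{e j} f) 2 volume) := by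
  unfold IsWeakPartial
  rw [Lp.toTemperedDistribution_toLp_eq, Lp.toTemperedDistribution_toLp_eq]
  exact TemperedDistribution.lineDerivOp_toTemperedDistributionCLM_eq f (e j)

/-- The pairs `(u, (∂₁u, ∂₂u))` of an `L²` function and its distributional partial derivatives, all
of them in `L²`, as a subspace of the Hilbert sum of three copies of `L²`. -/
def sobolevGraph : Submodule ℂ (WithLp 2 (L2 × PiLp 2 (fun _ : Fin 2 => L2))) where
  carrier := {p | ∀ j, IsWeakPartial j p.fst (p.snd j)}
  add_mem' ha hb j := (ha j).add (hb j)
  zero_mem' j := IsWeakPartial.zero j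
  smul_mem' c _ ha j := (ha j).smul c

/-- `H¹(ℝ², ℂ)`: a function together with its weak gradient, with the norm
`‖u‖² = ‖u‖²_{L²} + ‖∂₁u‖²_{L²} + ‖∂₂u‖²_{L²}`. -/
abbrev H1 : Type := sobolevGraph

namespace H1

/-- The underlying `L²` function of an element of `H¹`. -/
def fn (u : H1) : L2 := u.1.fst

/-- The weak partial derivative `∂_j u` of an element of `H¹`. -/
def partialDeriv (u : H1) (j : Fin 2) : L2 := u.1.snd j

theorem isWeakPartial (u : H1) (j : Fin 2) : IsWeakPartial j u.fn (u.partialDeriv j) := u.2 j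

theorem norm_sq_eq (u : H1) :
    ‖u‖ ^ 2 = ‖u.fn‖ ^ 2 + ∑ j, ‖u.partialDeriv j‖ ^ 2 := by
  rw [Submodule.coe_norm, WithLp.prod_norm_sq_eq_of_L2, PiLp.norm_sq_eq_of_L2]
  rfl

/-- A function and its weak partial derivatives, as an element of `H¹`. -/
def mk (f : L2) (g : Fin 2 → L2) (h : ∀ j, IsWeakPartial j f (g j)) : H1 :=
  ⟨WithLp.toLp 2 (f, WithLp.toLp 2 g), h⟩

/-- A Schwartz function as an element of `H¹`. -/
def ofSchwartz (f : 𝓢(Plane, ℂ)) : H1 :=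
  mk (SchwartzMap.toLp f 2 volume) (fun j => SchwartzMap.toLp (∂_{e j} f) 2 volume)
    fun j => IsWeakPartial.schwartz j f

end H1

/-! ### The free Schrödinger group -/

/-- The Fourier symbol of `e^{itΔ}`, for the Fourier transform with kernel `e^{-2πi⟨x,ξ⟩}`. -/
def freeSymbol (t : ℝ) (ξ : Plane) : ℂ :=
  Complex.exp (-(Complex.I * ((t * (2 * Real.pi) ^ 2 * ‖ξ‖ ^ 2 : ℝ) : ℂ)))

theorem norm_freeSymbol (t : ℝ) (ξ : Plane) : ‖freeSymbol t ξ‖ = 1 := by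
  rw [freeSymbol, Complex.norm_exp, Complex.neg_re, Complex.re_mul_ofReal]
  simp

theorem continuous_freeSymbol (t : ℝ) : Continuous (freeSymbol t) := by
  unfold freeSymbol
  fun_prop

theorem memLp_freeSymbol (t : ℝ) : MemLp (freeSymbol t) ∞ (volume : Measure Plane) :=
  memLp_top_of_bound (continuous_freeSymbol t).aestronglyMeasurable 1
    (Eventually.of_forall fun ξ => (norm_freeSymbol t ξ).le)

/-- `e^{itΔ}` on `L²(ℝ²)`: multiplication by `e^{-it|2πξ|²}` on the Fourier side. -/
def freeEvolutionL2 (t : ℝ) (f : L2) : L2 :=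
  𝓕⁻ ((memLp_freeSymbol t).toLp (freeSymbol t) • (𝓕 f : L2) : L2)

theorem iteratedDeriv_phase (n : ℕ) :
    iteratedDeriv n (fun r : ℝ => Complex.exp (-(Complex.I * (r : ℂ)))) =
      fun r : ℝ => (-Complex.I) ^ n * Complex.exp (-(Complex.I * (r : ℂ))) := by
  induction n with
  | zero => simp
  | succ n ih =>
    rw [iteratedDeriv_succ, ih]
    funext r
    have h1 : HasDerivAt (fun r : ℝ => -(Complex.I * (r : ℂ))) (-(Complex.I * 1)) r :=
      ((Complex.ofRealCLM.hasDerivAt (x := r)).const_mul Complex.I).neg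
    have h2 := (h1.cexp.const_mul ((-Complex.I) ^ n)).deriv
    rw [h2, pow_succ]
    ring

theorem hasTemperateGrowth_phase :
    (fun r : ℝ => Complex.exp (-(Complex.I * (r : ℂ)))).HasTemperateGrowth := by
  refine ⟨?_, fun n => ⟨0, 1, fun r => ?_⟩⟩
  · have h : ContDiff ℝ (⊤ : ℕ∞) (fun r : ℝ => (r : ℂ)) := Complex.ofRealCLM.contDiff
    exact ((contDiff_const.mul h).neg).cexp
  · rw [norm_iteratedFDeriv_eq_norm_iteratedDeriv, iteratedDeriv_phase]
    simp [Complex.norm_exp]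

theorem hasTemperateGrowth_freeSymbol (t : ℝ) : (freeSymbol t).HasTemperateGrowth := by
  have h : (fun ξ : Plane => t * (2 * Real.pi) ^ 2 * ‖ξ‖ ^ 2).HasTemperateGrowth := by fun_prop
  exact hasTemperateGrowth_phase.comp h

theorem freeEvolutionL2_toTemperedDistribution (t : ℝ) (f : L2) :
    (freeEvolutionL2 t f : 𝓢'(Plane, ℂ)) =
      TemperedDistribution.fourierMultiplierCLM ℂ (freeSymbol t) (f : 𝓢'(Plane, ℂ)) := by
  rw [freeEvolutionL2, ← Lp.fourierInv_toTemperedDistribution_eq,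
    Lp.toTemperedDistribution_smul_eq (hasTemperateGrowth_freeSymbol t),
    ← Lp.fourier_toTemperedDistribution_eq, TemperedDistribution.fourierMultiplierCLM_apply]

theorem IsWeakPartial.freeEvolutionL2 (t : ℝ) {j : Fin 2} {f g : L2} (h : IsWeakPartial j f g) :
    IsWeakPartial j (freeEvolutionL2 t f) (freeEvolutionL2 t g) := by
  have hs := hasTemperateGrowth_freeSymbol t
  have hi : (fun x : Plane => ((inner ℝ x (e j) : ℝ) : ℂ)).HasTemperateGrowth := by fun_prop
  rw [IsWeakPartial] at h ⊢
  rw [freeEvolutionL2_toTemperedDistribution, freeEvolutionL2_toTemperedDistribution, ← h,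
    TemperedDistribution.lineDeriv_eq_fourierMultiplierCLM,
    TemperedDistribution.lineDeriv_eq_fourierMultiplierCLM, map_smul,
    TemperedDistribution.fourierMultiplierCLM_fourierMultiplierCLM_apply hi hs,
    TemperedDistribution.fourierMultiplierCLM_fourierMultiplierCLM_apply hs hi,
    mul_comm (freeSymbol t)]

/-- `e^{itΔ}` on `H¹(ℝ²)`; it commutes with the partial derivatives. -/
def freeEvolution (t : ℝ) (h : H1) : H1 :=
  H1.mk (freeEvolutionL2 t h.fn) (fun j => freeEvolutionL2 t (h.partialDeriv j))
    fun j => (h.isWeakPartial j).freeEvolutionL2 t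

/-! ### Mass, energy and solutions of `i u_t = -Δu + V u + β(|u|²) u` -/

/-- The mass `Q(u) = ½ ∫ |u|²`. -/
def mass (u : H1) : ℝ := 2⁻¹ * ∫ x, ‖u.fn x‖ ^ 2

/-- The primitive `B` of `β` with `B(0) = 0`. -/
def primitive (β : ℝ → ℝ) (s : ℝ) : ℝ := ∫ r in (0 : ℝ)..s, β r

/-- The energy `E(u) = ½ ∫ |∇u|² + V |u|² + B(|u|²)`. -/
def energy (V : Plane → ℝ) (β : ℝ → ℝ) (u : H1) : ℝ :=
  2⁻¹ * ∫ x, ((∑ j, ‖u.partialDeriv j x‖ ^ 2) + V x * ‖u.fn x‖ ^ 2 + primitive β (‖u.fn x‖ ^ 2))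

/-- `u ∈ C⁰([0,∞), H¹)` is a solution of `i u_t = -Δu + V u + β(|u|²) u`: it is continuous with
values in `H¹`, and the equation holds in the sense of (tempered) distributions on `ℝ²` for every
time `t ≥ 0`. Only the values `u t` with `t ≥ 0` matter. -/
structure IsSolution (V : Plane → ℝ) (β : ℝ → ℝ) (u : ℝ → H1) : Prop where
  continuousOn : ContinuousOn u (Ici 0)
  equation : ∀ (η : 𝓢(Plane, ℂ)) (t : ℝ), 0 ≤ t →
    HasDerivWithinAt (fun s => Complex.I * ∫ x, (u s).fn x * η x)
      (∫ x, ((∑ j, (u t).partialDeriv j x * (∂_{e j} η) x) +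
        ((V x + β (‖(u t).fn x‖ ^ 2) : ℝ) : ℂ) * (u t).fn x * η x))
      (Ici 0) t

/-! ### Hypotheses on the nonlinearity, the potential and the family of bound states -/

/-- `β : ℝ → ℝ` is smooth, `β(0) = 0`, and for some exponent `p` all derivatives satisfy
`|d^k/dv^k β(v²)| ≤ C_k |v|^{p-k-1}` for `|v| ≥ 1`. -/
structure IsAdmissibleNonlinearity (β : ℝ → ℝ) : Prop where
  zero : β 0 = 0
  smooth : ContDiff ℝ (⊤ : ℕ∞) β
  growth : ∃ p : ℝ, ∀ k : ℕ, ∃ C : ℝ, ∀ v : ℝ, 1 ≤ |v| →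
    |iteratedDeriv k (fun w => β (w ^ 2)) v| ≤ C * |v| ^ (p - k - 1)

/-- `V : ℝ² → ℝ` is smooth, not identically zero, and each of its derivatives decays
exponentially. -/
structure IsAdmissiblePotential (V : Plane → ℝ) : Prop where
  smooth : ContDiff ℝ (⊤ : ℕ∞) V
  ne_zero : V ≠ 0
  decay : ∀ n : ℕ, ∃ C > 0, ∃ a > 0, ∀ x, ‖iteratedFDeriv ℝ n V x‖ ≤ C * Real.exp (-a * ‖x‖)

/-- The product `x^α f` of a monomial and a Schwartz function. -/
def monomialMul (α : Fin 2 → ℕ) (f : 𝓢(Plane, ℂ)) : 𝓢(Plane, ℂ) :=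
  SchwartzMap.smulLeftCLM ℂ (fun x : Plane => x 0 ^ α 0 * x 1 ^ α 1) f

theorem monomialMul_apply (α : Fin 2 → ℕ) (f : 𝓢(Plane, ℂ)) (x : Plane) :
    monomialMul α f x = ((x 0 ^ α 0 * x 1 ^ α 1 : ℝ) : ℂ) * f x := by
  have h : ∀ j, (fun x : Plane => x j).HasTemperateGrowth := fun j =>
    (EuclideanSpace.proj j : Plane →L[ℝ] ℝ).hasTemperateGrowth
  have h' : (fun x : Plane => x 0 ^ α 0 * x 1 ^ α 1).HasTemperateGrowth :=
    ((h 0).pow (α 0)).mul ((h 1).pow (α 1))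
  rw [monomialMul, SchwartzMap.smulLeftCLM_apply_apply h', Complex.real_smul]

/-- The partial derivative `∂^α f` of a Schwartz function. -/
def multiDeriv (α : Fin 2 → ℕ) (f : 𝓢(Plane, ℂ)) : 𝓢(Plane, ℂ) :=
  (fun g : 𝓢(Plane, ℂ) => ∂_{e 0} g)^[α 0] ((fun g : 𝓢(Plane, ℂ) => ∂_{e 1} g)^[α 1] f)

/-- The polar angle `arg x` of a point of the plane. -/
def angle (x : Plane) : ℝ := Complex.arg ⟨x 0, x 1⟩

/-- `ω ↦ φ_ω`, `ω ∈ O`, is a family of vortices of the equation, where `O ⊆ (0,∞)` is an open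
interval: the function `e^{iωt} φ_ω` solves the equation, `φ_ω(x) = e^{i m arg x} ψ_ω(|x|)` with
`ψ_ω` real and `m ≥ 1`, and `ω ↦ φ_ω` is `C²` on `O` with values in `Σ_k` for all `k`, where
`‖f‖²_{Σ_k} = ∑_{|α| ≤ k} ‖x^α f‖²_{L²} + ‖∂^α f‖²_{L²}`. Belonging to all `Σ_k` means being a
Schwartz function; since `f ↦ (x^α f, ∂^α f)_{|α| ≤ k}` is an isometry from the Banach space `Σ_k`
onto a closed subspace of a finite power of `L²`, being `C²` into all `Σ_k` means that every
`ω ↦ x^α φ_ω` and `ω ↦ ∂^α φ_ω` is `C²` into `L²`. -/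
structure IsVortexFamily (V : Plane → ℝ) (β : ℝ → ℝ) (O : Set ℝ) (φ : ℝ → 𝓢(Plane, ℂ)) : Prop where
  isOpen : IsOpen O
  ordConnected : O.OrdConnected
  pos : ∀ ω ∈ O, 0 < ω
  equation : ∀ ω ∈ O, ∀ x, (Δ (φ ω)) x - (V x : ℂ) * φ ω x - (ω : ℂ) * φ ω x -
    ((β (‖φ ω x‖ ^ 2) : ℝ) : ℂ) * φ ω x = 0
  contDiffOn_monomialMul : ∀ α : Fin 2 → ℕ,
    ContDiffOn ℝ 2 (fun ω => ((monomialMul α (φ ω)).toLp 2 : L2)) O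
  contDiffOn_multiDeriv : ∀ α : Fin 2 → ℕ,
    ContDiffOn ℝ 2 (fun ω => ((multiDeriv α (φ ω)).toLp 2 : L2)) O
  vortex : ∃ m : ℕ, 1 ≤ m ∧ ∀ ω ∈ O, ∃ ψ : ℝ → ℝ, ∀ x,
    φ ω x = Complex.exp (Complex.I * m * angle x) * (ψ ‖x‖ : ℂ)

/-! ### Stability notions -/

/-- The `H¹` distance `inf_θ ‖u - e^{iθ} φ‖` from `u` to the phase orbit of `φ`. -/
def orbitDist (φ u : H1) : ℝ≥0∞ := ⨅ θ : ℝ, ‖u - Complex.exp (Complex.I * θ) • φ‖ₑ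

/-- Orbital stability of the bound state with profile `φ`: for data close to `φ` the solution
exists for all positive times and stays close to the phase orbit of `φ`. -/
def OrbitallyStable (V : Plane → ℝ) (β : ℝ → ℝ) (φ : H1) : Prop :=
  ∀ ε : ℝ, 0 < ε → ∃ δ : ℝ, 0 < δ ∧ ∀ u₀ : H1, ‖φ - u₀‖ < δ →
    ∃ u : ℝ → H1, IsSolution V β u ∧ u 0 = u₀ ∧
      (⨆ t : ℝ, ⨆ _ : 0 < t, orbitDist φ (u t)) < ENNReal.ofReal ε

/-- The bound state with profile `φ` is orbitally unstable. -/
def OrbitallyUnstable (V : Plane → ℝ) (β : ℝ → ℝ) (φ : H1) : Prop :=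
  ¬ OrbitallyStable V β φ

/-- The bound state with profile `φ` is not trapped by the energy. -/
def NotTrappedByEnergy (V : Plane → ℝ) (β : ℝ → ℝ) (φ : H1) : Prop :=
  ∀ ε : ℝ, 0 < ε → ∃ u : H1, ‖φ - u‖ < ε ∧ ‖u.fn‖ = ‖φ.fn‖ ∧ energy V β u < energy V β φ

/-- Conditional asymptotic stability of the member `e^{iωt} φ_ω` of a family of bound states:
solutions that stay close to its phase orbit scatter to a nearby member of the family. -/
def ConditionallyAsymptoticallyStable (V : Plane → ℝ) (β : ℝ → ℝ) (O : Set ℝ) (φ : ℝ → H1)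
    (ω : ℝ) : Prop :=
  ∃ ε₀ > (0 : ℝ), ∃ C₀ > (0 : ℝ), ∀ (ε : ℝ) (u : ℝ → H1), ε < ε₀ → IsSolution V β u →
    (⨆ t : ℝ, ⨆ _ : 0 ≤ t, orbitDist (φ ω) (u t)) < ENNReal.ofReal ε →
    ∃ ωp ∈ O, ∃ θ : ℝ → ℝ, ContDiff ℝ 1 θ ∧ ∃ hp : H1, ‖hp‖ + |ωp - ω| ≤ C₀ * ε ∧
      Tendsto (fun t : ℝ =>
        ‖u t - Complex.exp (Complex.I * θ t) • φ ωp - freeEvolution t hp‖) atTop (𝓝 0)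

end NLS

end

/-!
The argument by contradiction compares energies at time zero and at time infinity. If the bound
state is orbitally stable, then a datum `η` close to `φ_ω`, of the same mass and of smaller energy,
has a global solution `u` near the orbit of `φ_ω`, and conditional asymptotic stability says that
`u(t) = e^{iθ(t)} φ_{ω₊} + e^{itΔ} h₊ + o(1)` in `H¹`. A free wave tends to zero weakly and in
`L⁴`, so it decouples from the bound state (`ForceBounds.tendsto_mass_energy`):
`Q(u) = Q(φ_{ω₊}) + Q(h₊)` and `E(η) ≥ lim E(u(t)) = E(φ_{ω₊}) + ½ ‖∇h₊‖²`. Hence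
`Q(φ_{ω₊}) ≤ Q(φ_ω)`. Since `φ_ω` is a critical point of `E + ω Q`, the family satisfies
`dE = -ω dQ`; with `ω > 0` and `q'(ω) ≠ 0` the remainder of order `|ω₊ - ω|²` is absorbed by
`ω (Q(φ_ω) - Q(φ_{ω₊}))`, and `E(φ_{ω₊}) ≥ E(φ_ω)`
(`IsVortexFamily.eventually_energy_le`). So `E(η) ≥ E(φ_ω)`, against the choice of `η`.

No well-posedness theory is at hand, so conservation of mass (`IsSolution.norm_fn_eq`) and the
inequality `E(u(t)) ≤ E(u(0))` (`IsSolution.energy_le`) have to be derived for an arbitrary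
continuous `H¹` solution. This is where it helps that `η` can be taken to be a Schwartz function:

* The solution is bounded, locally uniformly in time (`IsSolution.exists_ae_norm_le`). In Duhamel's
  formula tested against `ψ ∈ L¹` the force is paired with `e^{i(s-T)Δ} ψ`; by the dispersive
  estimate `L^{4/3} → L⁴`, applied to the gradient of the force, and Morrey's inequality the pairing
  is at most `C (1 + |s - T|^{-1/2}) ‖ψ‖₁`, which is integrable in `s`.
* Between bounded functions the force is Lipschitz in `L²`, so Gronwall's inequality for time
  translates makes `u` Lipschitz in time with values in `L²` (`IsSolution.exists_norm_sub_le`).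
* Then `g = -Δ u + f(u)` lies in `L²` and `u` is weakly differentiable in `L²` with derivative
  `-i g` (`IsSolution.exists_generator`). Mass is conserved since `⟨u, g⟩` is real. For the energy,
  expansion at time `t` gives `E(u(s)) - E(u(t)) ≥ Re ⟨g, u(s) - u(t)⟩ - C ‖u(s) - u(t)‖²_{L²}`,
  where the right-hand side is `o(|s - t|)` because `Re ⟨g, -i g⟩ = 0`. With `s < t` this is
  an upper bound for the left difference quotients of the energy.

The dispersive estimate and Morrey's inequality are proved in the cases needed, and all growth
conditions on `β` and `V` enter through `ForceBounds`.
-/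

noncomputable section

namespace NLS

section

/-! ### Schwartz functions, weak derivatives and the Hilbert space `H¹` -/

/-- A Schwartz function as an element of `L²`. -/
abbrev toL2 (ψ : 𝓢(Plane, ℂ)) : L2 := ψ.toLp 2 volume

/-- The complex conjugate of a Schwartz function. -/
def conjS (ψ : 𝓢(Plane, ℂ)) : 𝓢(Plane, ℂ) :=
  ψ.postcompCLM (𝕜 := ℝ) (Complex.conjCLE : ℂ →L[ℝ] ℂ)

theorem conjS_apply (ψ : 𝓢(Plane, ℂ)) (x : Plane) : conjS ψ x = (starRingEnd ℂ) (ψ x) := rfl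

theorem conjS_conjS (ψ : 𝓢(Plane, ℂ)) : conjS (conjS ψ) = ψ := by
  ext x
  simp [conjS_apply]

theorem lineDeriv_conjS (ψ : 𝓢(Plane, ℂ)) (m : Plane) : ∂_{m} (conjS ψ) = conjS (∂_{m} ψ) := by
  ext x
  rw [conjS_apply, SchwartzMap.lineDerivOp_apply_eq_fderiv,
    SchwartzMap.lineDerivOp_apply_eq_fderiv]
  have h : HasFDerivAt (conjS ψ) ((Complex.conjCLE : ℂ →L[ℝ] ℂ).comp (fderiv ℝ ψ x)) x :=
    (Complex.conjCLE : ℂ →L[ℝ] ℂ).hasFDerivAt.comp x (ψ.hasFDerivAt x)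
  rw [h.fderiv]
  rfl

theorem laplacian_eq (ψ : 𝓢(Plane, ℂ)) : Δ ψ = ∑ j, ∂_{e j} (∂_{e j} ψ) := by
  rw [SchwartzMap.laplacian_eq_sum (EuclideanSpace.basisFun (Fin 2) ℝ)]
  simp [e]

theorem toL2_add (ψ η : 𝓢(Plane, ℂ)) : toL2 (ψ + η) = toL2 ψ + toL2 η := rfl

theorem toL2_sub (ψ η : 𝓢(Plane, ℂ)) : toL2 (ψ - η) = toL2 ψ - toL2 η := rfl


theorem toL2_smul (c : ℂ) (ψ : 𝓢(Plane, ℂ)) : toL2 (c • ψ) = c • toL2 ψ := rfl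

theorem toL2_sum {ι : Type*} (s : Finset ι) (f : ι → 𝓢(Plane, ℂ)) :
    toL2 (∑ i ∈ s, f i) = ∑ i ∈ s, toL2 (f i) :=
  map_sum (SchwartzMap.toLpCLM ℂ ℂ 2 (volume : Measure Plane)) f s

theorem inner_toL2 (ψ : 𝓢(Plane, ℂ)) (f : L2) :
    inner ℂ (toL2 ψ) f = ∫ x, (starRingEnd ℂ) (ψ x) * f x := by
  rw [MeasureTheory.L2.inner_def]
  refine integral_congr_ae ?_
  filter_upwards [ψ.coeFn_toLp 2 (volume : Measure Plane)] with x hx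
  rw [hx, RCLike.inner_apply, mul_comm]

/-- The pairing in the definition of a solution is bilinear, whence the conjugate. -/
theorem integral_mul_schwartz (f : L2) (η : 𝓢(Plane, ℂ)) :
    ∫ x, f x * η x = inner ℂ (toL2 (conjS η)) f := by
  rw [inner_toL2]
  simp [conjS_apply, mul_comm]

theorem denseRange_toL2 : DenseRange toL2 :=
  SchwartzMap.denseRange_toLpCLM (p := 2) ENNReal.ofNat_ne_top

theorem isWeakPartial_iff_inner (j : Fin 2) (f g : L2) :
    IsWeakPartial j f g ↔
      ∀ ψ : 𝓢(Plane, ℂ), inner ℂ (toL2 (∂_{e j} ψ)) f = -inner ℂ (toL2 ψ) g := by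
  have key : ∀ η : 𝓢(Plane, ℂ), ((∂_{e j} (f : 𝓢'(Plane, ℂ))) η = (g : 𝓢'(Plane, ℂ)) η ↔
      inner ℂ (toL2 (∂_{e j} (conjS η))) f = -inner ℂ (toL2 (conjS η)) g) := by
    intro η
    rw [TemperedDistribution.lineDerivOp_apply_apply, Lp.toTemperedDistribution_apply,
      Lp.toTemperedDistribution_apply, lineDeriv_conjS, ← integral_mul_schwartz,
      ← integral_mul_schwartz]
    simp only [smul_eq_mul, mul_comm (f _), mul_comm (g _), neg_apply,
      neg_mul, integral_neg]
    exact neg_eq_iff_eq_neg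
  constructor
  · intro h ψ
    have := (key (conjS ψ)).1 (by rw [show _ = _ from h])
    rwa [conjS_conjS] at this
  · intro h
    refine ContinuousLinearMap.ext fun η => ?_
    exact (key η).2 (h _)

theorem isClosed_sobolevGraph :
    IsClosed (sobolevGraph : Set (WithLp 2 (L2 × PiLp 2 (fun _ : Fin 2 => L2)))) := by
  have : (sobolevGraph : Set (WithLp 2 (L2 × PiLp 2 (fun _ : Fin 2 => L2)))) =
      ⋂ j, ⋂ ψ : 𝓢(Plane, ℂ), {p | inner ℂ (toL2 (∂_{e j} ψ)) p.fst =
        -inner ℂ (toL2 ψ) (p.snd j)} := by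
    ext p
    simp only [mem_iInter, mem_ofPred_eq]
    exact forall_congr' fun j => isWeakPartial_iff_inner j _ _
  rw [this]
  refine isClosed_iInter fun j => isClosed_iInter fun ψ => isClosed_eq ?_ ?_
  · exact continuous_const.inner (by fun_prop)
  · exact (continuous_const.inner (by fun_prop)).neg

instance : CompleteSpace H1 := isClosed_sobolevGraph.completeSpace_coe

namespace H1

@[simp] theorem fn_add (u v : H1) : (u + v).fn = u.fn + v.fn := rfl
@[simp] theorem fn_sub (u v : H1) : (u - v).fn = u.fn - v.fn := rfl
@[simp] theorem fn_smul (c : ℂ) (u : H1) : (c • u).fn = c • u.fn := rfl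
@[simp] theorem partialDeriv_add (u v : H1) (j : Fin 2) :
    (u + v).partialDeriv j = u.partialDeriv j + v.partialDeriv j := rfl
@[simp] theorem partialDeriv_sub (u v : H1) (j : Fin 2) :
    (u - v).partialDeriv j = u.partialDeriv j - v.partialDeriv j := rfl
@[simp] theorem partialDeriv_smul (c : ℂ) (u : H1) (j : Fin 2) :
    (c • u).partialDeriv j = c • u.partialDeriv j := rfl

theorem fn_ofSchwartz (ψ : 𝓢(Plane, ℂ)) : (ofSchwartz ψ).fn = toL2 ψ := rfl

theorem partialDeriv_ofSchwartz (ψ : 𝓢(Plane, ℂ)) (j : Fin 2) :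
    (ofSchwartz ψ).partialDeriv j = toL2 (∂_{e j} ψ) := rfl

theorem ext' {u v : H1} (h : u.fn = v.fn) (h' : ∀ j, u.partialDeriv j = v.partialDeriv j) :
    u = v := by
  apply Subtype.ext
  apply (WithLp.equiv 2 _).injective
  refine Prod.ext h ?_
  apply (WithLp.equiv 2 _).injective
  funext j
  exact h' j

theorem inner_eq (u v : H1) :
    inner ℂ u v = inner ℂ u.fn v.fn + ∑ j, inner ℂ (u.partialDeriv j) (v.partialDeriv j) := by
  rw [Submodule.coe_inner, WithLp.prod_inner_apply, PiLp.inner_apply]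
  rfl

theorem norm_fn_le (u : H1) : ‖u.fn‖ ≤ ‖u‖ := by
  have h := norm_sq_eq u
  have : 0 ≤ ∑ j, ‖u.partialDeriv j‖ ^ 2 := by positivity
  exact le_of_sq_le_sq (by linarith) (norm_nonneg _)

theorem norm_partialDeriv_le (u : H1) (j : Fin 2) : ‖u.partialDeriv j‖ ≤ ‖u‖ := by
  have h := norm_sq_eq u
  have h2 : ‖u.partialDeriv j‖ ^ 2 ≤ ∑ j, ‖u.partialDeriv j‖ ^ 2 :=
    Finset.single_le_sum (f := fun j => ‖u.partialDeriv j‖ ^ 2) (fun _ _ => by positivity)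
      (Finset.mem_univ j)
  have := sq_nonneg ‖u.fn‖
  exact le_of_sq_le_sq (by linarith) (norm_nonneg _)

theorem ofSchwartz_smul (c : ℂ) (ψ : 𝓢(Plane, ℂ)) :
    ofSchwartz (c • ψ) = c • ofSchwartz ψ :=
  ext' rfl fun j => by
    rw [partialDeriv_ofSchwartz, LineDeriv.lineDerivOp_smul]; rfl

/-- Green's formula. -/
theorem sum_inner_partialDeriv (ψ : 𝓢(Plane, ℂ)) (u : H1) :
    ∑ j, inner ℂ (toL2 (∂_{e j} ψ)) (u.partialDeriv j) = -inner ℂ (toL2 (Δ ψ)) u.fn := by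
  rw [laplacian_eq, toL2_sum, sum_inner, ← Finset.sum_neg_distrib]
  refine Finset.sum_congr rfl fun j _ => ?_
  rw [(isWeakPartial_iff_inner j _ _).1 (u.isWeakPartial j), neg_neg]

end H1

/-- `1 - Δ` maps the Schwartz space onto itself. -/
theorem exists_sub_laplacian_eq (η : 𝓢(Plane, ℂ)) : ∃ ψ : 𝓢(Plane, ℂ), ψ - Δ ψ = η := by
  set g : Plane → ℝ := fun x => (1 + ‖(2 * Real.pi) • x‖ ^ 2) ^ (-1 : ℝ) with hg
  have hgt : g.HasTemperateGrowth :=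
    (Function.hasTemperateGrowth_one_add_norm_sq_rpow Plane (-1)).comp
      (((2 * Real.pi) • ContinuousLinearMap.id ℝ Plane).hasTemperateGrowth)
  have hn : (fun x : Plane => ‖x‖ ^ 2).HasTemperateGrowth := by fun_prop
  refine ⟨SchwartzMap.fourierMultiplierCLM ℂ g η, ?_⟩
  rw [SchwartzMap.laplacian_eq_fourierMultiplierCLM]
  rw [show (fun x : Plane => ‖x‖ ^ 2) = (fun x : Plane => ‖x‖) ^ 2 from rfl] at hn
  rw [show (fun x : Plane => ‖x‖ ^ 2) = (fun x : Plane => ‖x‖) ^ 2 from rfl,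
    SchwartzMap.fourierMultiplierCLM_fourierMultiplierCLM_apply hn hgt]
  have h2 : g + (2 * Real.pi) ^ 2 • ((fun x : Plane => ‖x‖) ^ 2 * g) = fun _ => 1 := by
    funext x
    have : (0 : ℝ) < 1 + ‖(2 * Real.pi) • x‖ ^ 2 := by positivity
    simp only [hg, Pi.add_apply, Pi.smul_apply, Pi.mul_apply, Pi.pow_apply, smul_eq_mul,
      Real.rpow_neg_one]
    rw [norm_smul, Real.norm_of_nonneg (by positivity)] at *
    field_simp
  have h3 := SchwartzMap.fourierMultiplierCLM_const (E := Plane) (F := ℂ) (1 : ℝ)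
  have h4 : ∀ {a b : Plane → ℝ} (_ : a.HasTemperateGrowth) (_ : b.HasTemperateGrowth),
      SchwartzMap.fourierMultiplierCLM ℂ (a + b) η = SchwartzMap.fourierMultiplierCLM ℂ a η +
        SchwartzMap.fourierMultiplierCLM ℂ b η := by
    intro a b ha hb
    simp [SchwartzMap.fourierMultiplierCLM_apply, SchwartzMap.smulLeftCLM_add ha hb,
      FourierTransform.fourierInv_add]
  have h5 : ((2 * Real.pi) ^ 2 • ((fun x : Plane => ‖x‖) ^ 2 * g)).HasTemperateGrowth :=
    (Function.HasTemperateGrowth.const ((2 * Real.pi) ^ 2)).mul (hn.mul hgt)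
  have h6 := h4 hgt h5
  rw [h2, h3, SchwartzMap.fourierMultiplierCLM_smul (hn.mul hgt)] at h6
  simp only [one_smul, ContinuousLinearMap.id_apply] at h6
  rw [neg_smul, sub_neg_eq_add]
  exact h6.symm

/-- A linear map into a Hilbert space whose range has trivial orthogonal complement has dense
range. -/
theorem exists_norm_sub_lt_of_orthogonal {W E : Type*} [AddCommGroup W] [Module ℂ W]
    [NormedAddCommGroup E] [InnerProductSpace ℂ E] [CompleteSpace E] (l : W → E)
    (hadd : ∀ v w, l (v + w) = l v + l w) (hsmul : ∀ (c : ℂ) w, l (c • w) = c • l w)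
    (h : ∀ u, (∀ w, inner ℂ (l w) u = 0) → u = 0) (u : E) {ε : ℝ} (hε : 0 < ε) :
    ∃ w, ‖u - l w‖ < ε := by
  let L : W →ₗ[ℂ] E := { toFun := l, map_add' := hadd, map_smul' := hsmul }
  have h1 : L.range.topologicalClosure = ⊤ := by
    rw [Submodule.topologicalClosure_eq_top_iff, Submodule.eq_bot_iff]
    exact fun v hv => h v fun w => hv _ ⟨w, rfl⟩
  have h2 : u ∈ closure (L.range : Set E) := by
    rw [← Submodule.topologicalClosure_coe, h1]
    trivial
  obtain ⟨_, ⟨w, rfl⟩, hw⟩ := Metric.mem_closure_iff.1 h2 ε hε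
  exact ⟨w, by rwa [← dist_eq_norm]⟩

/-- Schwartz functions are dense in `H¹`: the orthogonal complement is trivial, since `1 - Δ` maps
the Schwartz space onto itself. -/
theorem H1.exists_schwartz_norm_sub_lt (u : H1) {ε : ℝ} (hε : 0 < ε) :
    ∃ ψ, ‖u - H1.ofSchwartz ψ‖ < ε := by
  refine exists_norm_sub_lt_of_orthogonal H1.ofSchwartz
    (fun v w => H1.ext' rfl fun j => ?_) (fun c w => H1.ext' rfl fun j => ?_)
    (fun u hu => ?_) u hε
  · rw [H1.partialDeriv_ofSchwartz, LineDeriv.lineDerivOp_add]; rfl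
  · rw [H1.partialDeriv_ofSchwartz, LineDeriv.lineDerivOp_smul]; rfl
  have h0 : ∀ η, inner ℂ (toL2 η) u.fn = 0 := by
    intro η
    obtain ⟨ψ, rfl⟩ := exists_sub_laplacian_eq η
    have h3 : inner ℂ (H1.ofSchwartz ψ) u = 0 := hu ψ
    rw [H1.inner_eq] at h3
    simp only [H1.partialDeriv_ofSchwartz, H1.fn_ofSchwartz] at h3
    rw [H1.sum_inner_partialDeriv] at h3
    rw [toL2_sub, inner_sub_left, sub_eq_add_neg]
    exact h3
  have h1 : ∀ f : L2, (∀ η, inner ℂ (toL2 η) f = 0) → f = 0 := fun f hf =>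
    denseRange_toL2.eq_zero_of_inner_right (𝕜 := ℂ) hf
  have h2 : u.fn = 0 := h1 _ h0
  refine H1.ext' h2 fun j => h1 _ fun η => ?_
  have := (isWeakPartial_iff_inner j _ _).1 (u.isWeakPartial j) η
  rw [h2, inner_zero_right] at this
  exact neg_eq_zero.1 this.symm

theorem H1.exists_schwartz_seq (u : H1) : ∃ ψ : ℕ → 𝓢(Plane, ℂ),
    Tendsto (fun n => ‖u - H1.ofSchwartz (ψ n)‖) atTop (𝓝 0) := by
  choose ψ hψ using fun n : ℕ => u.exists_schwartz_norm_sub_lt (Nat.one_div_pos_of_nat (n := n))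
  exact ⟨ψ, squeeze_zero (fun _ => norm_nonneg _) (fun n => (hψ n).le)
    tendsto_one_div_add_atTop_nhds_zero_nat⟩

theorem L2.ext_inner {f g : L2} (h : ∀ ψ, inner ℂ (toL2 ψ) f = inner ℂ (toL2 ψ) g) : f = g := by
  rw [← sub_eq_zero]
  refine denseRange_toL2.eq_zero_of_inner_right (𝕜 := ℂ) fun η => ?_
  rw [inner_sub_right, h, sub_self]

end

section

/-! ### Hölder and Sobolev inequalities -/

section Holder

variable {α E : Type*} [MeasurableSpace α] {μ : Measure α} [NormedAddCommGroup E]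

theorem eLpNorm_natCast_pow (f : α → E) {n : ℕ} (hn : n ≠ 0) :
    eLpNorm f n μ ^ n = ∫⁻ x, ‖f x‖ₑ ^ n ∂μ := by
  rw [eLpNorm_eq_lintegral_rpow_enorm_toReal (by exact_mod_cast hn) (ENNReal.natCast_ne_top n)]
  rw [ENNReal.toReal_natCast, ← ENNReal.rpow_natCast, ← ENNReal.rpow_mul, one_div,
    inv_mul_cancel₀ (by exact_mod_cast hn), ENNReal.rpow_one]
  simp_rw [ENNReal.rpow_natCast]

theorem eLpNorm_two_sq (f : α → E) : eLpNorm f 2 μ ^ 2 = ∫⁻ x, ‖f x‖ₑ ^ 2 ∂μ := by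
  rw [← eLpNorm_natCast_pow f two_ne_zero, Nat.cast_ofNat]

theorem eLpNorm_four_pow (f : α → E) : eLpNorm f 4 μ ^ 4 = ∫⁻ x, (‖f x‖ₑ ^ 2) ^ 2 ∂μ := by
  simp_rw [← pow_mul]
  rw [← eLpNorm_natCast_pow f four_ne_zero, Nat.cast_ofNat]

theorem eLpNorm_norm_pow_natCast (f : α → E) {m n : ℕ} (hn : n ≠ 0) (hm : m ≠ 0) :
    eLpNorm (fun x => ‖f x‖ ^ n) m μ = eLpNorm f (m * n : ℕ) μ ^ n := by
  refine (ENNReal.pow_right_strictMono hm).injective (?_ : _ ^ m = _ ^ m)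
  rw [eLpNorm_natCast_pow _ hm, ← pow_mul, mul_comm n m, eLpNorm_natCast_pow _ (by positivity)]
  refine lintegral_congr fun x => ?_
  rw [enorm_pow, enorm_norm, ← pow_mul, mul_comm]

/-- Cauchy–Schwarz for lower integrals, with the square roots removed. -/
theorem lintegral_mul_sq_le {f g : α → ℝ≥0∞} (hf : AEMeasurable f μ) (hg : AEMeasurable g μ) :
    (∫⁻ x, f x * g x ∂μ) ^ 2 ≤ (∫⁻ x, f x ^ 2 ∂μ) * ∫⁻ x, g x ^ 2 ∂μ := by
  have h := ENNReal.lintegral_mul_le_Lp_mul_Lq μ Real.HolderConjugate.two_two hf hg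
  calc (∫⁻ x, f x * g x ∂μ) ^ 2 ≤ ((∫⁻ a, f a ^ (2 : ℝ) ∂μ) ^ (1 / 2 : ℝ) *
        (∫⁻ a, g a ^ (2 : ℝ) ∂μ) ^ (1 / 2 : ℝ)) ^ 2 := by gcongr; exact h
    _ = _ := by
      rw [mul_pow, ← ENNReal.rpow_natCast, ← ENNReal.rpow_natCast, ← ENNReal.rpow_mul,
        ← ENNReal.rpow_mul]
      norm_num

/-- Hölder's inequality for three factors in `L⁴`, `L⁴` and `L²`. -/
theorem lintegral_enorm_mul_mul_le {F G : Type*} [NormedAddCommGroup F] [NormedAddCommGroup G]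
    {a : α → E} {b : α → F} {c : α → G}
    (ha : AEStronglyMeasurable a μ) (hb : AEStronglyMeasurable b μ)
    (hc : AEStronglyMeasurable c μ) :
    ∫⁻ x, ‖a x‖ₑ * ‖b x‖ₑ * ‖c x‖ₑ ∂μ ≤ eLpNorm a 4 μ * eLpNorm b 4 μ * eLpNorm c 2 μ := by
  refine (ENNReal.pow_le_pow_left_iff four_ne_zero).1 ?_
  have h1 := lintegral_mul_sq_le (μ := μ) (ha.enorm.mul hb.enorm) hc.enorm
  have h2 := lintegral_mul_sq_le (μ := μ) (ha.enorm.pow_const 2) (hb.enorm.pow_const 2)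
  simp only [Pi.mul_apply, mul_pow] at h1 h2
  calc (∫⁻ x, ‖a x‖ₑ * ‖b x‖ₑ * ‖c x‖ₑ ∂μ) ^ 4
      = ((∫⁻ x, ‖a x‖ₑ * ‖b x‖ₑ * ‖c x‖ₑ ∂μ) ^ 2) ^ 2 := by rw [← pow_mul]
    _ ≤ ((∫⁻ x, ‖a x‖ₑ ^ 2 * ‖b x‖ₑ ^ 2 ∂μ) * ∫⁻ x, ‖c x‖ₑ ^ 2 ∂μ) ^ 2 := by gcongr
    _ = (∫⁻ x, ‖a x‖ₑ ^ 2 * ‖b x‖ₑ ^ 2 ∂μ) ^ 2 * (∫⁻ x, ‖c x‖ₑ ^ 2 ∂μ) ^ 2 := by rw [mul_pow]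
    _ ≤ ((∫⁻ x, (‖a x‖ₑ ^ 2) ^ 2 ∂μ) * ∫⁻ x, (‖b x‖ₑ ^ 2) ^ 2 ∂μ) *
        (∫⁻ x, ‖c x‖ₑ ^ 2 ∂μ) ^ 2 := by gcongr
    _ = _ := by rw [← eLpNorm_four_pow, ← eLpNorm_four_pow, ← eLpNorm_two_sq]; ring

theorem eLpNorm_two_mul_le {F : Type*} [NormedAddCommGroup F] {a : α → E} {b : α → F}
    (ha : AEStronglyMeasurable a μ) (hb : AEStronglyMeasurable b μ) :
    eLpNorm (fun x => ‖a x‖ * ‖b x‖) 2 μ ≤ eLpNorm a 4 μ * eLpNorm b 4 μ := by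
  refine (ENNReal.pow_le_pow_left_iff four_ne_zero).1 ?_
  have h2 := lintegral_mul_sq_le (μ := μ) (ha.enorm.pow_const 2) (hb.enorm.pow_const 2)
  rw [mul_pow, eLpNorm_four_pow, eLpNorm_four_pow, show (4 : ℕ) = 2 * 2 by norm_num, pow_mul,
    eLpNorm_two_sq]
  simpa only [enorm_mul, enorm_norm, mul_pow] using h2

end Holder

section Cutoff

variable {E : Type*} [NormedAddCommGroup E] [InnerProductSpace ℝ E] [FiniteDimensional ℝ E]
  [MeasurableSpace E] [BorelSpace E]

/-- The Gagliardo–Nirenberg–Sobolev inequality `‖u‖₂ ≤ C ‖∇u‖₁` in a plane for integrable `C¹`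
functions, by cutting off. -/
theorem exists_eLpNorm_two_le_fderiv (hE : Module.finrank ℝ E = 2) :
    ∃ C : NNReal, ∀ u : E → ℂ, ContDiff ℝ 1 u →
    eLpNorm u 1 volume < ⊤ → eLpNorm u 2 volume ≤ C * eLpNorm (fderiv ℝ u) 1 volume := by
  refine ⟨eLpNormLESNormFDerivOneConst (volume : Measure E) 2, fun u hu hu1 => ?_⟩
  set C := eLpNormLESNormFDerivOneConst (volume : Measure E) 2
  let χ : ContDiffBump (0 : E) := ⟨1, 2, one_pos, one_lt_two⟩
  have hχ : ContDiff ℝ 1 χ := χ.contDiff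
  obtain ⟨K, hK⟩ : ∃ K, ∀ x, ‖fderiv ℝ χ x‖ ≤ K :=
    (hχ.continuous_fderiv one_ne_zero).bounded_above_of_compact_support (χ.hasCompactSupport.fderiv ℝ)
  have hK0 : 0 ≤ K := (norm_nonneg _).trans (hK 0)
  -- the gradients of the cut-off functions `χ (x / (n + 1))` tend to zero uniformly
  let c : ℕ → ℝ := fun n => ((n : ℝ) + 1)⁻¹
  have hc : ∀ n, 0 < c n := fun n => by positivity
  have hc1 : Tendsto c atTop (𝓝 0) := by
    simpa [c, one_div] using tendsto_one_div_add_atTop_nhds_zero_nat (𝕜 := ℝ)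
  let f : ℕ → E → ℂ := fun n x => χ (c n • x) • u x
  have hfn : ∀ n x, HasFDerivAt (f n) (χ (c n • x) • fderiv ℝ u x +
      (c n • fderiv ℝ χ (c n • x)).smulRight (u x)) x := by
    intro n x
    have h1 : HasFDerivAt (fun x : E => χ (c n • x)) (c n • fderiv ℝ χ (c n • x)) x := by
      have h2 : HasFDerivAt (fun x : E => c n • x) (c n • ContinuousLinearMap.id ℝ E) x :=
        (c n • ContinuousLinearMap.id ℝ E).hasFDerivAt
      have h3 := ((hχ.differentiable one_ne_zero) (c n • x)).hasFDerivAt.comp x h2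
      simpa [Function.comp_def] using h3
    exact h1.smul ((hu.differentiable one_ne_zero) x).hasFDerivAt
  have hcs : ∀ n, HasCompactSupport (f n) := by
    intro n
    have h : HasCompactSupport (fun x : E => χ (c n • x)) :=
      χ.hasCompactSupport.comp_homeomorph (Homeomorph.smulOfNeZero (c n) (hc n).ne')
    exact h.mono' fun x hx => subset_tsupport _ fun h0 => hx (by simp only [f, h0, zero_smul])
  have hfc : ∀ n, ContDiff ℝ 1 (f n) := fun n =>
    (hχ.comp (contDiff_const_smul (c n))).smul hu
  have hbound : ∀ n, eLpNorm (f n) 2 volume ≤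
      C * (eLpNorm (fderiv ℝ u) 1 volume + ENNReal.ofReal (c n * K) * eLpNorm u 1 volume) := by
    intro n
    have h1 := eLpNorm_le_eLpNorm_fderiv_one (volume : Measure E) (hfc n) (hcs n) (p := 2)
      (by
        rw [hE]
        exact ⟨by norm_num, by norm_num, by norm_num⟩)
    refine h1.trans (mul_le_mul_right (α := ℝ≥0∞) ?_ _)
    rw [eLpNorm_one_eq_lintegral_enorm, eLpNorm_one_eq_lintegral_enorm,
      eLpNorm_one_eq_lintegral_enorm, ← lintegral_const_mul' _ _ ENNReal.ofReal_ne_top,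
      ← lintegral_add_left (hu.continuous_fderiv one_ne_zero).enorm.measurable]
    refine lintegral_mono fun x => ?_
    rw [(hfn n x).fderiv]
    refine (enorm_add_le (χ (c n • x) • fderiv ℝ u x)
      ((c n • fderiv ℝ χ (c n • x)).smulRight (u x))).trans ?_
    gcongr
    · rw [enorm_smul]
      refine mul_le_of_le_one_left zero_le ?_
      rw [← ofReal_norm, ← ENNReal.ofReal_one, Real.norm_of_nonneg χ.nonneg]
      exact ENNReal.ofReal_le_ofReal χ.le_one
    · rw [← ofReal_norm, ContinuousLinearMap.norm_smulRight_apply, ENNReal.ofReal_mul (norm_nonneg _),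
        ofReal_norm (u x)]
      gcongr
      rw [norm_smul, Real.norm_of_nonneg (hc n).le]
      exact mul_le_mul_of_nonneg_left (hK _) (hc n).le
  have hlim : ∀ x, Tendsto (fun n => f n x) atTop (𝓝 (u x)) := by
    intro x
    have h1 : Tendsto (fun n => c n • x) atTop (𝓝 ((0 : ℝ) • x)) := hc1.smul_const x
    rw [zero_smul] at h1
    have h2 := (χ.continuous.tendsto 0).comp h1
    have h3 : χ (0 : E) = 1 := χ.one_of_mem_closedBall (by simp [χ])
    rw [h3] at h2
    have h4 := h2.smul_const (u x)
    rw [one_smul] at h4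
    exact h4
  have h4 : Tendsto (fun n => C * (eLpNorm (fderiv ℝ u) 1 volume +
      ENNReal.ofReal (c n * K) * eLpNorm u 1 volume)) atTop
      (𝓝 (C * (eLpNorm (fderiv ℝ u) 1 volume + 0))) := by
    refine ENNReal.Tendsto.const_mul (tendsto_const_nhds.add ?_) (Or.inr ENNReal.coe_ne_top)
    have h5 : Tendsto (fun n => ENNReal.ofReal (c n * K)) atTop (𝓝 0) := by
      have := ENNReal.tendsto_ofReal (hc1.mul_const K)
      simpa using this
    simpa using ENNReal.Tendsto.mul_const h5 (Or.inr hu1.ne)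
  rw [add_zero] at h4
  refine (Lp.eLpNorm_lim_le_liminf_eLpNorm
    (fun n => (hfc n).continuous.aestronglyMeasurable) u (ae_of_all _ hlim)).trans ?_
  rw [← h4.liminf_eq]
  exact liminf_le_liminf (Eventually.of_forall hbound)

/-- The inductive step of Sobolev's inequality, by applying the `L¹` inequality to `ψ ^ (k + 2)`. -/
theorem exists_lintegral_pow_step (hE : Module.finrank ℝ E = 2) (k : ℕ) :
    ∃ C : NNReal, ∀ ψ : 𝓢(E, ℂ), ∫⁻ x, ‖ψ x‖ₑ ^ (2 * (k + 2)) ≤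
      C * ((∫⁻ x, ‖ψ x‖ₑ ^ (2 * (k + 1))) * ∫⁻ x, ‖fderiv ℝ ψ x‖ₑ ^ 2) := by
  obtain ⟨C₀, hC₀⟩ := exists_eLpNorm_two_le_fderiv hE
  refine ⟨C₀ ^ 2 * (k + 2) ^ 2, fun ψ => ?_⟩
  have hcd : ContDiff ℝ 1 (fun x => ψ x ^ (k + 2)) := (ψ.smooth 1).pow _
  have hfd : ∀ x, fderiv ℝ (fun x => ψ x ^ (k + 2)) x =
      (((k + 2 : ℕ) : ℂ) * ψ x ^ (k + 1)) • fderiv ℝ ψ x := by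
    intro x
    have := (ψ.hasFDerivAt x).pow (k + 2)
    rw [this.fderiv]
    simp
  have hint : eLpNorm (fun x => ψ x ^ (k + 2)) 1 volume < ⊤ := by
    rw [eLpNorm_one_eq_lintegral_enorm]
    simp_rw [enorm_pow]
    rw [← eLpNorm_natCast_pow _ (by omega)]
    exact ENNReal.pow_lt_top (ψ.memLp _ volume).2
  have h1 := hC₀ _ hcd hint
  have h2 : ∫⁻ x, ‖ψ x‖ₑ ^ (2 * (k + 2)) = eLpNorm (fun x => ψ x ^ (k + 2)) 2 volume ^ 2 := by
    rw [eLpNorm_two_sq]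
    refine lintegral_congr fun x => ?_
    rw [enorm_pow, ← pow_mul, mul_comm]
  have h3 : eLpNorm (fderiv ℝ (fun x => ψ x ^ (k + 2))) 1 volume =
      (k + 2 : ℕ) * ∫⁻ x, ‖ψ x‖ₑ ^ (k + 1) * ‖fderiv ℝ ψ x‖ₑ := by
    rw [eLpNorm_one_eq_lintegral_enorm, ← lintegral_const_mul' _ _ (ENNReal.natCast_ne_top _)]
    refine lintegral_congr fun x => ?_
    rw [hfd, enorm_smul, enorm_mul, enorm_pow, mul_assoc]
    congr 1
    rw [← ofReal_norm, Complex.norm_natCast, ENNReal.ofReal_natCast]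
  have h4 := lintegral_mul_sq_le (μ := (volume : Measure E))
    (f := fun x => ‖ψ x‖ₑ ^ (k + 1)) (g := fun x => ‖fderiv ℝ ψ x‖ₑ)
    (ψ.continuous.enorm.measurable.pow_const _).aemeasurable
    (((ψ.smooth 1).continuous_fderiv one_ne_zero).enorm.measurable.aemeasurable)
  simp_rw [← pow_mul, mul_comm (k + 1) 2] at h4
  rw [h2]
  calc eLpNorm (fun x => ψ x ^ (k + 2)) 2 volume ^ 2
      ≤ (C₀ * ((k + 2 : ℕ) * ∫⁻ x, ‖ψ x‖ₑ ^ (k + 1) * ‖fderiv ℝ ψ x‖ₑ)) ^ 2 := by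
        rw [← h3]; gcongr
    _ = C₀ ^ 2 * (k + 2 : ℕ) ^ 2 * (∫⁻ x, ‖ψ x‖ₑ ^ (k + 1) * ‖fderiv ℝ ψ x‖ₑ) ^ 2 := by ring
    _ ≤ C₀ ^ 2 * (k + 2 : ℕ) ^ 2 *
        ((∫⁻ x, ‖ψ x‖ₑ ^ (2 * (k + 1))) * ∫⁻ x, ‖fderiv ℝ ψ x‖ₑ ^ 2) := by gcongr
    _ = _ := by push_cast; ring

end Cutoff

theorem norm_clm_le_sum {ι E F : Type*} [Fintype ι] [NormedAddCommGroup E]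
    [InnerProductSpace ℝ E] [NormedAddCommGroup F] [NormedSpace ℝ F]
    (b : OrthonormalBasis ι ℝ E) (L : E →L[ℝ] F) : ‖L‖ ≤ ∑ j, ‖L (b j)‖ := by
  refine L.opNorm_le_bound (by positivity) fun x => ?_
  conv_lhs => rw [← b.sum_repr x]
  rw [map_sum, Finset.sum_mul]
  refine (norm_sum_le _ _).trans (Finset.sum_le_sum fun j _ => ?_)
  rw [map_smul, norm_smul, mul_comm]
  refine mul_le_mul_of_nonneg_left ?_ (norm_nonneg _)
  rw [← b.repr.norm_map x]
  exact PiLp.norm_apply_le (b.repr x) j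

theorem norm_fderiv_le (ψ : 𝓢(Plane, ℂ)) (x : Plane) :
    ‖fderiv ℝ ψ x‖ ≤ ‖(∂_{e 0} ψ) x‖ + ‖(∂_{e 1} ψ) x‖ := by
  have := norm_clm_le_sum (EuclideanSpace.basisFun (Fin 2) ℝ) (fderiv ℝ ψ x)
  rw [Fin.sum_univ_two, EuclideanSpace.basisFun_apply, EuclideanSpace.basisFun_apply] at this
  exact this

theorem lintegral_enorm_sq_toL2 (ψ : 𝓢(Plane, ℂ)) :
    ∫⁻ x, ‖ψ x‖ₑ ^ 2 = ENNReal.ofReal (‖toL2 ψ‖ ^ 2) := by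
  have h : eLpNorm ψ 2 volume = ENNReal.ofReal ‖toL2 ψ‖ := by
    rw [SchwartzMap.norm_toLp, ENNReal.ofReal_toReal (ψ.memLp 2 volume).2.ne]
  rw [← eLpNorm_two_sq, ENNReal.ofReal_pow (norm_nonneg _), ← h]

theorem ofReal_two_mul (a : ℝ) : ENNReal.ofReal (2 * a) = 2 * ENNReal.ofReal a := by
  rw [ENNReal.ofReal_mul zero_le_two, ENNReal.ofReal_ofNat]

theorem lintegral_enorm_fderiv_sq_le (ψ : 𝓢(Plane, ℂ)) :
    ∫⁻ x, ‖fderiv ℝ ψ x‖ₑ ^ 2 ≤ ENNReal.ofReal (2 * ‖H1.ofSchwartz ψ‖ ^ 2) := by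
  have h1 : ∀ x, ‖fderiv ℝ ψ x‖ₑ ^ 2 ≤ 2 * (‖(∂_{e 0} ψ) x‖ₑ ^ 2 + ‖(∂_{e 1} ψ) x‖ₑ ^ 2) := by
    intro x
    rw [← ofReal_norm, ← ofReal_norm, ← ofReal_norm, ← ENNReal.ofReal_pow (norm_nonneg _),
      ← ENNReal.ofReal_pow (norm_nonneg _), ← ENNReal.ofReal_pow (norm_nonneg _),
      ← ENNReal.ofReal_add (by positivity) (by positivity), ← ofReal_two_mul]
    refine ENNReal.ofReal_le_ofReal ?_
    have := norm_fderiv_le ψ x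
    nlinarith [norm_nonneg (fderiv ℝ ψ x), norm_nonneg ((∂_{e 0} ψ) x),
      norm_nonneg ((∂_{e 1} ψ) x), sq_nonneg (‖(∂_{e 0} ψ) x‖ - ‖(∂_{e 1} ψ) x‖)]
  refine (lintegral_mono h1).trans ?_
  rw [lintegral_const_mul' _ _ (by norm_num),
    lintegral_add_left ((∂_{e 0} ψ).continuous.enorm.measurable.pow_const 2),
    lintegral_enorm_sq_toL2, lintegral_enorm_sq_toL2,
    ← ENNReal.ofReal_add (by positivity) (by positivity), ← ofReal_two_mul]
  refine ENNReal.ofReal_le_ofReal ?_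
  rw [H1.norm_sq_eq, Fin.sum_univ_two]
  simp only [H1.partialDeriv_ofSchwartz]
  have := sq_nonneg ‖(H1.ofSchwartz ψ).fn‖
  linarith

theorem exists_lintegral_pow_le (k : ℕ) : ∃ C : NNReal, ∀ ψ : 𝓢(Plane, ℂ),
    ∫⁻ x, ‖ψ x‖ₑ ^ (2 * (k + 1)) ≤ C * ENNReal.ofReal ‖H1.ofSchwartz ψ‖ ^ (2 * (k + 1)) := by
  induction k with
  | zero =>
    refine ⟨1, fun ψ => ?_⟩
    rw [zero_add, mul_one, lintegral_enorm_sq_toL2, ENNReal.coe_one, one_mul,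
      ← ENNReal.ofReal_pow (norm_nonneg _)]
    refine ENNReal.ofReal_le_ofReal ?_
    exact pow_le_pow_left₀ (norm_nonneg _) (H1.norm_fn_le (H1.ofSchwartz ψ)) 2
  | succ k ih =>
    obtain ⟨C, hC⟩ := ih
    obtain ⟨C₁, hC₁⟩ := exists_lintegral_pow_step (E := Plane) finrank_euclideanSpace_fin k
    refine ⟨C₁ * C * 2, fun ψ => (hC₁ ψ).trans ?_⟩
    refine (mul_le_mul_right (mul_le_mul' (hC ψ) (lintegral_enorm_fderiv_sq_le ψ)) _).trans_eq ?_
    rw [ofReal_two_mul, ENNReal.ofReal_pow (norm_nonneg _)]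
    push_cast
    ring

/-- Sobolev's inequality `‖u‖_{2(k+1)} ≤ C ‖u‖_{H¹}`. -/
theorem H1.exists_eLpNorm_le (k : ℕ) : ∃ C : ℝ, 0 ≤ C ∧ ∀ u : H1,
    eLpNorm u.fn (2 * (k + 1) : ℕ) volume ≤ ENNReal.ofReal (C * ‖u‖) := by
  obtain ⟨C, hC⟩ := exists_lintegral_pow_le k
  have hS : ∀ ψ : 𝓢(Plane, ℂ), eLpNorm ψ (2 * (k + 1) : ℕ) volume ≤
      ENNReal.ofReal (max (C : ℝ) 1 * ‖H1.ofSchwartz ψ‖) := by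
    intro ψ
    refine (ENNReal.pow_le_pow_left_iff (n := 2 * (k + 1)) (by omega)).1 ?_
    rw [eLpNorm_natCast_pow _ (by omega), ENNReal.ofReal_mul (by positivity), mul_pow]
    refine (hC ψ).trans ?_
    gcongr
    have h1 : (C : ℝ≥0∞) ≤ ENNReal.ofReal (max (C : ℝ) 1) := by
      rw [ENNReal.le_ofReal_iff_toReal_le ENNReal.coe_ne_top (by positivity)]
      simp
    refine h1.trans (le_self_pow₀ ?_ (by omega))
    rw [← ENNReal.ofReal_one]
    exact ENNReal.ofReal_le_ofReal (le_max_right _ _)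
  refine ⟨max (C : ℝ) 1, by positivity, fun u => ?_⟩
  -- Fatou's lemma along an almost everywhere convergent sequence of Schwartz functions
  obtain ⟨ψ, hψ⟩ := u.exists_schwartz_seq
  have h1 : Tendsto (fun n => toL2 (ψ n)) atTop (𝓝 u.fn) := by
    rw [tendsto_iff_norm_sub_tendsto_zero]
    refine squeeze_zero (fun _ => norm_nonneg _) (fun n => ?_) hψ
    rw [norm_sub_rev]
    exact H1.norm_fn_le (u - H1.ofSchwartz (ψ n))
  obtain ⟨ns, hns, hae⟩ := (tendstoInMeasure_of_tendsto_Lp h1).exists_seq_tendsto_ae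
  have h2 : Tendsto (fun n => ENNReal.ofReal (max (C : ℝ) 1 * ‖H1.ofSchwartz (ψ (ns n))‖)) atTop
      (𝓝 (ENNReal.ofReal (max (C : ℝ) 1 * ‖u‖))) := by
    refine ENNReal.tendsto_ofReal (Tendsto.const_mul _ ?_)
    have h3 : Tendsto (fun n => ‖H1.ofSchwartz (ψ n)‖) atTop (𝓝 ‖u‖) := by
      rw [tendsto_iff_norm_sub_tendsto_zero]
      refine squeeze_zero (fun _ => norm_nonneg _) (fun n => ?_) hψ
      rw [norm_sub_rev, Real.norm_eq_abs]
      exact abs_norm_sub_norm_le _ _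
    exact h3.comp hns.tendsto_atTop
  refine (Lp.eLpNorm_lim_le_liminf_eLpNorm
    (fun n => (Lp.aestronglyMeasurable (toL2 (ψ (ns n))))) u.fn hae).trans ?_
  rw [← h2.liminf_eq]
  refine liminf_le_liminf (Eventually.of_forall fun n => ?_)
  rw [eLpNorm_congr_ae ((ψ (ns n)).coeFn_toLp 2 volume)]
  exact hS _

end

section

/-! ### Pointwise estimates for the nonlinearity -/

/-- The nonlinearity `z ↦ β(|z|²) z`. -/
def nonlin (β : ℝ → ℝ) (z : ℂ) : ℂ := (β (‖z‖ ^ 2) : ℂ) * z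

/-- The weight `|z| + |w| + |z|ⁿ + |w|ⁿ` that controls all increments of the nonlinearity. -/
def growthWeight (n : ℕ) (z w : ℂ) : ℝ := ‖z‖ + ‖w‖ + ‖z‖ ^ n + ‖w‖ ^ n

theorem growthWeight_nonneg (n : ℕ) (z w : ℂ) : 0 ≤ growthWeight n z w := by
  unfold growthWeight; positivity

/-- The bounds on the nonlinearity `β(|z|²) z` and its primitive that the proof uses. -/
structure GrowthBounds (β : ℝ → ℝ) (C : ℝ) (n : ℕ) : Prop where
  nonneg : 0 ≤ C
  one_le : 1 ≤ n
  lipschitz : ∀ z w, ‖nonlin β z - nonlin β w‖ ≤ C * (‖z - w‖ * growthWeight n z w)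
  primitive_sub : ∀ z w, |primitive β (‖z‖ ^ 2) - primitive β (‖w‖ ^ 2)| ≤
    C * (‖z - w‖ * (growthWeight n z w * (‖z‖ + ‖w‖)))
  taylor : ∀ z w, |primitive β (‖z + w‖ ^ 2) - primitive β (‖z‖ ^ 2) -
    2 * ((starRingEnd ℂ) w * nonlin β z).re| ≤ C * (‖w‖ ^ 2 * growthWeight n (z + w) z)

/-- A bound `|g(v²)| ≤ K |v|^q` for `|v| ≥ 1` and a bound for small arguments give a bound by
`r + rⁿ`. -/
theorem abs_le_of_growth {g : ℝ → ℝ} {K₀ K₁ q : ℝ} {n : ℕ} (hn : q ≤ n)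
    (h0 : ∀ r, 0 ≤ r → r ≤ 1 → |g r| ≤ K₀ * r) (h1 : ∀ r, 1 ≤ r → |g r| ≤ K₁ * r ^ q)
    {r : ℝ} (hr : 0 ≤ r) : |g r| ≤ (|K₀| + |K₁|) * (r + r ^ n) := by
  rcases le_total r 1 with h | h
  · calc |g r| ≤ K₀ * r := h0 r hr h
      _ ≤ (|K₀| + |K₁|) * (r + r ^ n) := by
        refine mul_le_mul ((le_abs_self _).trans (le_add_of_nonneg_right (abs_nonneg _))) ?_ hr
          (by positivity)
        exact le_add_of_nonneg_right (by positivity)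
  · have hq : r ^ q ≤ r ^ n := by
      rw [← Real.rpow_natCast]
      exact Real.rpow_le_rpow_of_exponent_le h hn
    calc |g r| ≤ K₁ * r ^ q := h1 r h
      _ ≤ (|K₀| + |K₁|) * (r + r ^ n) := by
        refine mul_le_mul ((le_abs_self _).trans (le_add_of_nonneg_left (abs_nonneg _))) ?_
          (Real.rpow_nonneg hr _) (by positivity)
        linarith

/-- The growth condition is used for `k = 0` and `k = 1` only; for `k = 1` it bounds
`d/dv β(v²) = 2 v β'(v²)`. -/
theorem exists_beta_bounds {β : ℝ → ℝ} (hβ : IsAdmissibleNonlinearity β) :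
    ∃ (K : ℝ) (n : ℕ), 0 ≤ K ∧ 1 ≤ n ∧ (∀ r, 0 ≤ r → |β (r ^ 2)| ≤ K * (r + r ^ n)) ∧
      ∀ r, 0 ≤ r → |r ^ 2 * deriv β (r ^ 2)| ≤ K * (r + r ^ n) := by
  obtain ⟨p, hp⟩ := hβ.growth
  obtain ⟨C₀, hC₀⟩ := hp 0
  obtain ⟨C₁, hC₁⟩ := hp 1
  have hd : Differentiable ℝ β := hβ.smooth.differentiable (by simp)
  obtain ⟨D, hD⟩ : ∃ D, ∀ s ∈ Icc (0 : ℝ) 1, ‖deriv β s‖ ≤ D :=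
    isCompact_Icc.exists_bound_of_continuousOn
      (hβ.smooth.continuous_deriv (by simp)).continuousOn
  have hD0 : 0 ≤ D := (norm_nonneg _).trans (hD 0 (by simp))
  obtain ⟨n, hn⟩ := exists_nat_ge (max (p - 1) 1)
  have hn1 : p - 1 ≤ n := (le_max_left _ _).trans hn
  have hn2 : 1 ≤ n := by exact_mod_cast (le_max_right _ _).trans hn
  have e1 : ∀ r, 0 ≤ r → |β (r ^ 2)| ≤ (|D| + |C₀|) * (r + r ^ n) := fun r hr => by
    refine abs_le_of_growth (g := fun r => β (r ^ 2)) hn1 (fun r hr hr1 => ?_) (fun r hr => ?_) hr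
    · have h1 : ‖β (r ^ 2) - β 0‖ ≤ D * ‖r ^ 2 - 0‖ :=
        (convex_Icc (0 : ℝ) 1).norm_image_sub_le_of_norm_deriv_le
          (fun x _ => hd x) hD (by simp) ⟨by positivity, pow_le_one₀ hr hr1⟩
      rw [hβ.zero, sub_zero, sub_zero, Real.norm_of_nonneg (sq_nonneg r)] at h1
      exact h1.trans (mul_le_mul_of_nonneg_left (by nlinarith) hD0)
    · have h1 := hC₀ r (hr.trans (le_abs_self r))
      rw [abs_of_nonneg (zero_le_one.trans hr)] at h1
      simpa using h1
  have e2 : ∀ r, 0 ≤ r → |r ^ 2 * deriv β (r ^ 2)| ≤ (|D| + |C₁|) * (r + r ^ n) := fun r hr => by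
    refine abs_le_of_growth (g := fun r => r ^ 2 * deriv β (r ^ 2)) hn1 (fun r hr hr1 => ?_)
      (fun r hr => ?_) hr
    · have h1 := hD (r ^ 2) ⟨by positivity, pow_le_one₀ hr hr1⟩
      rw [Real.norm_eq_abs] at h1
      rw [abs_mul, abs_of_nonneg (sq_nonneg r), mul_comm]
      exact mul_le_mul h1 (by nlinarith) (sq_nonneg r) hD0
    · have hr0 : 0 < r := zero_lt_one.trans_le hr
      have h1 := hC₁ r (hr.trans (le_abs_self r))
      have h2 : HasDerivAt (fun w : ℝ => β (w ^ 2)) (deriv β (r ^ 2) * (2 * r)) r := by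
        have := (hd (r ^ 2)).hasDerivAt.comp r (hasDerivAt_pow 2 r)
        simpa [Function.comp_def] using this
      rw [iteratedDeriv_one, h2.deriv, abs_of_pos hr0] at h1
      have h3 : r ^ (p - 1) = r * r ^ (p - (1 : ℕ) - 1) := by
        conv_rhs => rw [← Real.rpow_one r, ← Real.rpow_mul hr0.le, one_mul]
        rw [← Real.rpow_add hr0]
        congr 1
        push_cast
        ring
      have h4 : |r ^ 2 * deriv β (r ^ 2)| = r / 2 * |deriv β (r ^ 2) * (2 * r)| := by
        rw [abs_mul, abs_mul, abs_of_pos (by positivity : 0 < 2 * r), abs_of_nonneg (sq_nonneg r)]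
        ring
      rw [h3, h4]
      rw [mul_left_comm C₁]
      exact mul_le_mul (by linarith) h1 (abs_nonneg _) hr0.le
  refine ⟨max (|D| + |C₀|) (|D| + |C₁|), n, by positivity, hn2, fun r hr => (e1 r hr).trans ?_,
    fun r hr => (e2 r hr).trans ?_⟩
  · exact mul_le_mul_of_nonneg_right (le_max_left _ _) (by positivity)
  · exact mul_le_mul_of_nonneg_right (le_max_right _ _) (by positivity)

theorem hasDerivAt_norm_sq_line (z w : ℂ) (t : ℝ) :
    HasDerivAt (fun t : ℝ => ‖z + t * w‖ ^ 2)
      (2 * ((starRingEnd ℂ) w * (z + t * w)).re) t := by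
  have h1 : HasDerivAt (fun t : ℝ => z + t * w) w t := by
    simpa using ((Complex.ofRealCLM.hasDerivAt (x := t)).mul_const w).const_add z
  have h2 := h1.norm_sq
  convert h2 using 1
  rw [real_inner_eq_re_inner ℂ, RCLike.inner_apply]
  simp only [RCLike.re_to_complex, Complex.mul_re, Complex.conj_re, Complex.conj_im]
  ring

theorem norm_line_le (z w : ℂ) {t : ℝ} (ht : t ∈ Icc (0 : ℝ) 1) :
    ‖z + t * w‖ ≤ max ‖z‖ ‖z + w‖ := by
  have h : z + t * w = (1 - t : ℝ) • z + t • (z + w) := by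
    simp only [Complex.real_smul]; push_cast; ring
  rw [h]
  exact (convexOn_univ_norm (E := ℂ)).le_max_of_mem_segment (mem_univ _) (mem_univ _)
    ⟨1 - t, t, by linarith [ht.2], ht.1, by ring, rfl⟩

theorem norm_add_pow_line_le (n : ℕ) (z w : ℂ) {t : ℝ} (ht : t ∈ Icc (0 : ℝ) 1) :
    ‖z + t * w‖ + ‖z + t * w‖ ^ n ≤ growthWeight n (z + w) z := by
  have h := norm_line_le z w ht
  unfold growthWeight
  rcases le_max_iff.1 h with h | h
  · have := pow_le_pow_left₀ (norm_nonneg _) h n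
    have h2 := norm_nonneg (z + w)
    have h3 := pow_nonneg h2 n
    linarith
  · have := pow_le_pow_left₀ (norm_nonneg _) h n
    have h2 := norm_nonneg z
    have h3 := pow_nonneg h2 n
    linarith

theorem norm_nonlin_le {β : ℝ → ℝ} {K : ℝ} {n : ℕ}
    (h : ∀ r, 0 ≤ r → |β (r ^ 2)| ≤ K * (r + r ^ n)) (z : ℂ) :
    ‖nonlin β z‖ ≤ K * ((‖z‖ + ‖z‖ ^ n) * ‖z‖) := by
  rw [nonlin, norm_mul, Complex.norm_real, Real.norm_eq_abs, ← mul_assoc]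
  exact mul_le_mul_of_nonneg_right (h _ (norm_nonneg z)) (norm_nonneg z)

theorem hasDerivAt_nonlin_line {β : ℝ → ℝ} (hd : Differentiable ℝ β) (z w : ℂ) (t : ℝ) :
    HasDerivAt (fun t : ℝ => nonlin β (z + t * w))
      (((deriv β (‖z + t * w‖ ^ 2) * (2 * ((starRingEnd ℂ) w * (z + t * w)).re) : ℝ) : ℂ) *
        (z + t * w) + (β (‖z + t * w‖ ^ 2) : ℂ) * w) t := by
  have h1 : HasDerivAt (fun t : ℝ => z + t * w) w t := by
    simpa using ((Complex.ofRealCLM.hasDerivAt (x := t)).mul_const w).const_add z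
  have h2 := (hd (‖z + t * w‖ ^ 2)).hasDerivAt.comp t (hasDerivAt_norm_sq_line z w t)
  exact h2.ofReal_comp.mul h1

theorem hasDerivAt_primitive_line {β : ℝ → ℝ} (hc : Continuous β) (z w : ℂ) (t : ℝ) :
    HasDerivAt (fun t : ℝ => primitive β (‖z + t * w‖ ^ 2))
      (2 * ((starRingEnd ℂ) w * nonlin β (z + t * w)).re) t := by
  have h1 : HasDerivAt (primitive β) (β (‖z + t * w‖ ^ 2)) (‖z + t * w‖ ^ 2) :=
    intervalIntegral.integral_hasDerivAt_right (hc.intervalIntegrable _ _)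
      (hc.stronglyMeasurableAtFilter _ _) hc.continuousAt
  have h2 := h1.comp t (hasDerivAt_norm_sq_line z w t)
  refine h2.congr_deriv ?_
  unfold nonlin
  rw [mul_left_comm ((starRingEnd ℂ) w), Complex.re_ofReal_mul]
  ring

/-- The growth bounds follow from the mean value inequality on the segment from `z` to `z + w`. -/
theorem exists_growthBounds {β : ℝ → ℝ} (hβ : IsAdmissibleNonlinearity β) :
    ∃ C n, GrowthBounds β C n := by
  obtain ⟨K, n, hK, hn, h0, h1⟩ := exists_beta_bounds hβ
  have hd : Differentiable ℝ β := hβ.smooth.differentiable (by simp)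
  have lip : ∀ z w, ‖nonlin β (z + w) - nonlin β z‖ ≤
      3 * K * (‖w‖ * growthWeight n (z + w) z) := by
    intro z w
    have := norm_image_sub_le_of_norm_deriv_le_segment_01' (f := fun t : ℝ => nonlin β (z + t * w))
      (C := 3 * K * (‖w‖ * growthWeight n (z + w) z))
      (fun t _ => (hasDerivAt_nonlin_line hd z w t).hasDerivWithinAt) (fun t ht => ?_)
    · simpa using this
    · have ht' : t ∈ Icc (0 : ℝ) 1 := ⟨ht.1, ht.2.le⟩
      have hw := norm_add_pow_line_le n z w ht'
      set ζ := z + t * w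
      have a0 := h0 ‖ζ‖ (norm_nonneg _)
      have a1 := h1 ‖ζ‖ (norm_nonneg _)
      have a2 : |((starRingEnd ℂ) w * ζ).re| ≤ ‖w‖ * ‖ζ‖ := by
        refine (Complex.abs_re_le_norm _).trans ?_
        rw [norm_mul, RCLike.norm_conj]
      calc ‖((deriv β (‖ζ‖ ^ 2) * (2 * ((starRingEnd ℂ) w * ζ).re) : ℝ) : ℂ) * ζ +
            (β (‖ζ‖ ^ 2) : ℂ) * w‖
          ≤ |deriv β (‖ζ‖ ^ 2)| * (2 * |((starRingEnd ℂ) w * ζ).re|) * ‖ζ‖ +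
            |β (‖ζ‖ ^ 2)| * ‖w‖ := by
            refine (norm_add_le _ _).trans_eq ?_
            rw [norm_mul, norm_mul, Complex.norm_real, Complex.norm_real, Real.norm_eq_abs,
              Real.norm_eq_abs, abs_mul, abs_mul, abs_two]
        _ ≤ |deriv β (‖ζ‖ ^ 2)| * (2 * (‖w‖ * ‖ζ‖)) * ‖ζ‖ + |β (‖ζ‖ ^ 2)| * ‖w‖ := by gcongr
        _ = 2 * |‖ζ‖ ^ 2 * deriv β (‖ζ‖ ^ 2)| * ‖w‖ + |β (‖ζ‖ ^ 2)| * ‖w‖ := by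
            rw [abs_mul, abs_of_nonneg (sq_nonneg ‖ζ‖)]; ring
        _ ≤ 2 * (K * (‖ζ‖ + ‖ζ‖ ^ n)) * ‖w‖ + (K * (‖ζ‖ + ‖ζ‖ ^ n)) * ‖w‖ := by gcongr
        _ = 3 * K * (‖w‖ * (‖ζ‖ + ‖ζ‖ ^ n)) := by ring
        _ ≤ _ := by gcongr
  have prim : ∀ z w, |primitive β (‖z + w‖ ^ 2) - primitive β (‖z‖ ^ 2)| ≤
      2 * K * (‖w‖ * (growthWeight n (z + w) z * (‖z + w‖ + ‖z‖))) := by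
    intro z w
    have := norm_image_sub_le_of_norm_deriv_le_segment_01'
      (f := fun t : ℝ => primitive β (‖z + t * w‖ ^ 2))
      (C := 2 * K * (‖w‖ * (growthWeight n (z + w) z * (‖z + w‖ + ‖z‖))))
      (fun t _ => (hasDerivAt_primitive_line hβ.smooth.continuous z w t).hasDerivWithinAt)
      (fun t ht => ?_)
    · simpa using this
    · have ht' : t ∈ Icc (0 : ℝ) 1 := ⟨ht.1, ht.2.le⟩
      have hw := norm_add_pow_line_le n z w ht'
      have hw2 : ‖z + t * w‖ ≤ ‖z + w‖ + ‖z‖ := (norm_line_le z w ht').trans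
        (max_le (le_add_of_nonneg_left (norm_nonneg _)) (le_add_of_nonneg_right (norm_nonneg _)))
      have a := norm_nonlin_le h0 (z + t * w)
      set ζ := z + t * w
      rw [norm_mul, Real.norm_eq_abs, Real.norm_eq_abs, abs_two]
      calc 2 * |((starRingEnd ℂ) w * nonlin β ζ).re| ≤ 2 * (‖w‖ * ‖nonlin β ζ‖) := by
            refine mul_le_mul_of_nonneg_left ((Complex.abs_re_le_norm _).trans_eq ?_) zero_le_two
            rw [norm_mul, RCLike.norm_conj]
        _ ≤ 2 * (‖w‖ * (K * ((‖ζ‖ + ‖ζ‖ ^ n) * ‖ζ‖))) := by gcongr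
        _ ≤ 2 * (‖w‖ * (K * (growthWeight n (z + w) z * (‖z + w‖ + ‖z‖)))) := by
            have := growthWeight_nonneg n (z + w) z
            gcongr
        _ = _ := by ring
  refine ⟨12 * K, n, by positivity, hn, fun z w => ?_, fun z w => ?_, fun z w => ?_⟩
  · have := lip w (z - w)
    rw [add_sub_cancel] at this
    refine this.trans (mul_le_mul_of_nonneg_right (by linarith)
      (mul_nonneg (norm_nonneg _) (growthWeight_nonneg _ _ _)))
  · have := prim w (z - w)
    rw [add_sub_cancel] at this
    refine this.trans (mul_le_mul_of_nonneg_right (by linarith)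
      (mul_nonneg (norm_nonneg _) (mul_nonneg (growthWeight_nonneg _ _ _) (by positivity))))
  · have hder : ∀ t : ℝ, HasDerivAt (fun t : ℝ => primitive β (‖z + t * w‖ ^ 2) -
        t * (2 * ((starRingEnd ℂ) w * nonlin β z).re))
        (2 * ((starRingEnd ℂ) w * nonlin β (z + t * w)).re -
          2 * ((starRingEnd ℂ) w * nonlin β z).re) t := by
      intro t
      have h2 := (hasDerivAt_id t).mul_const (2 * ((starRingEnd ℂ) w * nonlin β z).re)
      rw [one_mul] at h2
      exact (hasDerivAt_primitive_line hβ.smooth.continuous z w t).sub h2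
    have := norm_image_sub_le_of_norm_deriv_le_segment_01'
      (C := 12 * K * (‖w‖ ^ 2 * growthWeight n (z + w) z))
      (fun t _ => (hder t).hasDerivWithinAt) (fun t ht => ?_)
    · rw [Real.norm_eq_abs] at this
      convert this using 2
      simp
      ring
    · have ht' : t ∈ Icc (0 : ℝ) 1 := ⟨ht.1, ht.2.le⟩
      have hw := norm_add_pow_line_le n z w ht'
      have a := lip z (t * w)
      have b : growthWeight n (z + t * w) z ≤ 2 * growthWeight n (z + w) z := by
        have h0 := norm_nonneg (z + w)
        have h1 := pow_nonneg h0 n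
        have : ‖z‖ + ‖z‖ ^ n ≤ growthWeight n (z + w) z := by unfold growthWeight; linarith
        calc growthWeight n (z + t * w) z
            = (‖z + t * w‖ + ‖z + t * w‖ ^ n) + (‖z‖ + ‖z‖ ^ n) := by unfold growthWeight; ring
          _ ≤ _ := by linarith
      have c : ‖(t : ℂ) * w‖ ≤ ‖w‖ := by
        rw [norm_mul, Complex.norm_real, Real.norm_of_nonneg ht.1]
        exact mul_le_of_le_one_left (norm_nonneg _) ht.2.le
      rw [← mul_sub, ← Complex.sub_re, ← mul_sub, norm_mul, Real.norm_eq_abs, Real.norm_eq_abs,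
        abs_two]
      have g0 := growthWeight_nonneg n (z + w) z
      have g1 := growthWeight_nonneg n (z + t * w) z
      calc 2 * |((starRingEnd ℂ) w * (nonlin β (z + t * w) - nonlin β z)).re|
          ≤ 2 * (‖w‖ * ‖nonlin β (z + t * w) - nonlin β z‖) := by
            refine mul_le_mul_of_nonneg_left ((Complex.abs_re_le_norm _).trans_eq ?_) zero_le_two
            rw [norm_mul, RCLike.norm_conj]
        _ ≤ 2 * (‖w‖ * (3 * K * (‖w‖ * (2 * growthWeight n (z + w) z)))) := by
            refine mul_le_mul_of_nonneg_left (mul_le_mul_of_nonneg_left (a.trans ?_)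
              (norm_nonneg _)) zero_le_two
            gcongr
        _ = _ := by ring

end

section

/-! ### The nonlinear term on `H¹` -/

/-- The force `(V + β(|z|²)) z`. -/
def force (V : Plane → ℝ) (β : ℝ → ℝ) (x : Plane) (z : ℂ) : ℂ :=
  ((V x + β (‖z‖ ^ 2) : ℝ) : ℂ) * z

/-- The density `V |z|² + B(|z|²)` of the potential part of the energy. -/
def potDensity (V : Plane → ℝ) (β : ℝ → ℝ) (x : Plane) (z : ℂ) : ℝ :=
  V x * ‖z‖ ^ 2 + primitive β (‖z‖ ^ 2)

/-- The weight `|V| + |f| + |g| + |f|ⁿ + |g|ⁿ` that controls increments of the force. -/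
def weight (V : Plane → ℝ) (n : ℕ) (f g : Plane → ℂ) (x : Plane) : ℝ :=
  |V x| + growthWeight n (f x) (g x)

/-- All that the proof uses about the potential and the nonlinearity. -/
structure ForceBounds (V : Plane → ℝ) (β : ℝ → ℝ) (C : ℝ) (n : ℕ) : Prop where
  nonneg : 0 ≤ C
  one_le : 1 ≤ n
  schwartz : ∃ W : 𝓢(Plane, ℝ), ⇑W = V
  smooth : ContDiff ℝ (⊤ : ℕ∞) β
  lipschitz : ∀ x z w, ‖force V β x z - force V β x w‖ ≤
    C * (‖z - w‖ * (|V x| + growthWeight n z w))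
  potDensity_sub : ∀ x z w, |potDensity V β x z - potDensity V β x w| ≤
    C * (‖z - w‖ * ((|V x| + growthWeight n z w) * (‖z‖ + ‖w‖)))
  taylor : ∀ x z w, |potDensity V β x (z + w) - potDensity V β x z -
    2 * ((starRingEnd ℂ) w * force V β x z).re| ≤
    C * (‖w‖ ^ 2 * (|V x| + growthWeight n (z + w) z))

theorem exists_schwartz_eq_potential {V : Plane → ℝ} (hV : IsAdmissiblePotential V) :
    ∃ W : 𝓢(Plane, ℝ), ⇑W = V := by
  refine ⟨⟨V, hV.smooth, fun k n => ?_⟩, rfl⟩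
  obtain ⟨C, hC, a, ha, h⟩ := hV.decay n
  refine ⟨C * (k.factorial / a ^ k), fun x => ?_⟩
  have h1 := Real.pow_div_factorial_le_exp (a * ‖x‖) (by positivity) k
  have hk : (0 : ℝ) < k.factorial := by exact_mod_cast k.factorial_pos
  rw [div_le_iff₀ hk, mul_pow] at h1
  have h2 : ‖x‖ ^ k * Real.exp (-a * ‖x‖) ≤ k.factorial / a ^ k := by
    rw [le_div_iff₀ (by positivity), neg_mul, Real.exp_neg]
    calc ‖x‖ ^ k * (Real.exp (a * ‖x‖))⁻¹ * a ^ k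
        = (a ^ k * ‖x‖ ^ k) * (Real.exp (a * ‖x‖))⁻¹ := by ring
      _ ≤ (Real.exp (a * ‖x‖) * k.factorial) * (Real.exp (a * ‖x‖))⁻¹ := by gcongr
      _ = k.factorial := by
        have := (Real.exp_pos (a * ‖x‖)).ne'
        field_simp
  calc ‖x‖ ^ k * ‖iteratedFDeriv ℝ n V x‖
      ≤ ‖x‖ ^ k * (C * Real.exp (-a * ‖x‖)) := by gcongr; exact h x
    _ = C * (‖x‖ ^ k * Real.exp (-a * ‖x‖)) := by ring
    _ ≤ _ := by gcongr

theorem force_eq (V : Plane → ℝ) (β : ℝ → ℝ) (x : Plane) (z : ℂ) :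
    force V β x z = V x * z + nonlin β z := by
  simp only [force, nonlin]
  push_cast
  ring

theorem exists_forceBounds {V : Plane → ℝ} {β : ℝ → ℝ} (hβ : IsAdmissibleNonlinearity β)
    (hV : IsAdmissiblePotential V) : ∃ C n, ForceBounds V β C n := by
  obtain ⟨C, n, h⟩ := exists_growthBounds hβ
  have hC := h.nonneg
  refine ⟨C + 1, n, by linarith, h.one_le, exists_schwartz_eq_potential hV, hβ.smooth,
    fun x z w => ?_, fun x z w => ?_, fun x z w => ?_⟩
  · have hg := growthWeight_nonneg n z w
    have hv := abs_nonneg (V x)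
    have hz := norm_nonneg (z - w)
    calc ‖force V β x z - force V β x w‖
        = ‖(V x : ℂ) * (z - w) + (nonlin β z - nonlin β w)‖ := by
          rw [force_eq, force_eq]; congr 1; ring
      _ ≤ |V x| * ‖z - w‖ + C * (‖z - w‖ * growthWeight n z w) := by
          refine (norm_add_le _ _).trans (add_le_add ?_ (h.lipschitz z w))
          rw [norm_mul, Complex.norm_real, Real.norm_eq_abs]
      _ ≤ _ := by
          have h1 := mul_nonneg hv hz
          have h2 := mul_nonneg hz hg
          nlinarith [mul_nonneg hC h1]
  · have hg := growthWeight_nonneg n z w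
    have hv := abs_nonneg (V x)
    have hz := norm_nonneg (z - w)
    have hs : 0 ≤ ‖z‖ + ‖w‖ := by positivity
    have h0 : |‖z‖ ^ 2 - ‖w‖ ^ 2| ≤ ‖z - w‖ * (‖z‖ + ‖w‖) := by
      rw [sq_sub_sq, abs_mul, abs_of_nonneg hs, mul_comm]
      exact mul_le_mul_of_nonneg_right (abs_norm_sub_norm_le z w) hs
    calc |potDensity V β x z - potDensity V β x w|
        = |V x * (‖z‖ ^ 2 - ‖w‖ ^ 2) + (primitive β (‖z‖ ^ 2) - primitive β (‖w‖ ^ 2))| := by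
          simp only [potDensity]; congr 1; ring
      _ ≤ |V x| * (‖z - w‖ * (‖z‖ + ‖w‖)) +
          C * (‖z - w‖ * (growthWeight n z w * (‖z‖ + ‖w‖))) := by
          refine (abs_add_le _ _).trans (add_le_add ?_ (h.primitive_sub z w))
          rw [abs_mul]
          exact mul_le_mul_of_nonneg_left h0 hv
      _ ≤ _ := by
          have h1 := mul_nonneg hv (mul_nonneg hz hs)
          have h2 := mul_nonneg (mul_nonneg hz hg) hs
          nlinarith [mul_nonneg hC h1]
  · have hg := growthWeight_nonneg n (z + w) z
    have hv := abs_nonneg (V x)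
    have h0 : ‖z + w‖ ^ 2 - ‖z‖ ^ 2 - 2 * ((starRingEnd ℂ) w * z).re = ‖w‖ ^ 2 := by
      simp only [← Complex.normSq_eq_norm_sq, Complex.normSq_apply, Complex.mul_re,
        Complex.conj_re, Complex.conj_im, Complex.add_re, Complex.add_im]
      ring
    have h1 : ((starRingEnd ℂ) w * force V β x z).re =
        V x * ((starRingEnd ℂ) w * z).re + ((starRingEnd ℂ) w * nonlin β z).re := by
      rw [force_eq, mul_add, Complex.add_re, mul_left_comm, Complex.re_ofReal_mul]
    calc |potDensity V β x (z + w) - potDensity V β x z -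
          2 * ((starRingEnd ℂ) w * force V β x z).re|
        = |V x * (‖z + w‖ ^ 2 - ‖z‖ ^ 2 - 2 * ((starRingEnd ℂ) w * z).re) +
          (primitive β (‖z + w‖ ^ 2) - primitive β (‖z‖ ^ 2) -
            2 * ((starRingEnd ℂ) w * nonlin β z).re)| := by
          rw [h1]; simp only [potDensity]; congr 1; ring
      _ ≤ |V x| * ‖w‖ ^ 2 + C * (‖w‖ ^ 2 * growthWeight n (z + w) z) := by
          refine (abs_add_le _ _).trans (add_le_add ?_ (h.taylor z w))
          rw [h0, abs_mul, abs_of_nonneg (sq_nonneg ‖w‖)]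
      _ ≤ _ := by
          have h1 := mul_nonneg hv (sq_nonneg ‖w‖)
          have h2 := mul_nonneg (sq_nonneg ‖w‖) hg
          nlinarith [mul_nonneg hC h1]

variable {V : Plane → ℝ} {β : ℝ → ℝ} {C : ℝ} {n : ℕ}

theorem force_zero (V : Plane → ℝ) (β : ℝ → ℝ) (x : Plane) : force V β x 0 = 0 := by
  simp [force]

theorem potDensity_zero (V : Plane → ℝ) (β : ℝ → ℝ) (x : Plane) : potDensity V β x 0 = 0 := by
  simp [potDensity, primitive]

theorem weight_nonneg (V : Plane → ℝ) (n : ℕ) (f g : Plane → ℂ) (x : Plane) :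
    0 ≤ weight V n f g x :=
  add_nonneg (abs_nonneg _) (growthWeight_nonneg _ _ _)

namespace ForceBounds

theorem continuous_potential (h : ForceBounds V β C n) : Continuous V := by
  obtain ⟨W, rfl⟩ := h.schwartz
  exact W.continuous

theorem aestronglyMeasurable_force (h : ForceBounds V β C n) {f : Plane → ℂ}
    (hf : AEStronglyMeasurable f volume) :
    AEStronglyMeasurable (fun x => force V β x (f x)) volume := by
  have hc : Continuous fun p : Plane × ℂ => force V β p.1 p.2 := by
    have hV := h.continuous_potential
    have hb := h.smooth.continuous
    unfold force
    fun_prop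
  exact hc.comp_aestronglyMeasurable (aestronglyMeasurable_id.prodMk hf)

theorem aestronglyMeasurable_potDensity (h : ForceBounds V β C n) {f : Plane → ℂ}
    (hf : AEStronglyMeasurable f volume) :
    AEStronglyMeasurable (fun x => potDensity V β x (f x)) volume := by
  have hc : Continuous fun p : Plane × ℂ => potDensity V β p.1 p.2 := by
    have hV := h.continuous_potential
    have hp : Continuous (primitive β) :=
      intervalIntegral.continuous_primitive
        (fun a b => h.smooth.continuous.intervalIntegrable a b) 0
    unfold potDensity
    fun_prop
  exact hc.comp_aestronglyMeasurable (aestronglyMeasurable_id.prodMk hf)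

theorem aestronglyMeasurable_weight (h : ForceBounds V β C n) {f g : Plane → ℂ}
    (hf : AEStronglyMeasurable f volume) (hg : AEStronglyMeasurable g volume) :
    AEStronglyMeasurable (weight V n f g) volume := by
  have hV : AEStronglyMeasurable V volume := h.continuous_potential.aestronglyMeasurable
  unfold weight growthWeight
  exact hV.norm.add (((hf.norm.add hg.norm).add (hf.norm.pow n)).add (hg.norm.pow n))

end ForceBounds

theorem H1.exists_eLpNorm_four_le : ∃ K : ℝ, 0 ≤ K ∧ ∀ u : H1,
    eLpNorm u.fn 4 volume ≤ ENNReal.ofReal (K * ‖u‖) := by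
  obtain ⟨K, hK, h⟩ := H1.exists_eLpNorm_le 1
  exact ⟨K, hK, fun u => by simpa using h u⟩

theorem H1.exists_eLpNorm_pow_four_le (n : ℕ) (hn : 1 ≤ n) : ∃ K : ℝ, 0 ≤ K ∧ ∀ u : H1,
    eLpNorm (fun x => ‖u.fn x‖ ^ n) 4 volume ≤ ENNReal.ofReal ((K * ‖u‖) ^ n) := by
  obtain ⟨K, hK, h⟩ := H1.exists_eLpNorm_le (2 * n - 1)
  refine ⟨K, hK, fun u => ?_⟩
  have h1 := eLpNorm_norm_pow_natCast (μ := volume) u.fn (m := 4) (n := n) (by omega) (by omega)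
  have h2 : 2 * (2 * n - 1 + 1) = 4 * n := by omega
  have h3 := h u
  rw [h2] at h3
  rw [ENNReal.ofReal_pow (by positivity)]
  calc eLpNorm (fun x => ‖u.fn x‖ ^ n) 4 volume = eLpNorm u.fn (4 * n : ℕ) volume ^ n := by
        simpa using h1
    _ ≤ _ := by gcongr

/-- The weight is bounded in `L⁴` on bounded sets of `H¹`. -/
theorem ForceBounds.exists_eLpNorm_weight_le (h : ForceBounds V β C n) (R : ℝ) :
    ∃ K : ℝ, 0 ≤ K ∧ ∀ u v : H1, ‖u‖ ≤ R → ‖v‖ ≤ R →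
      eLpNorm (weight V n u.fn v.fn) 4 volume ≤ ENNReal.ofReal K := by
  obtain ⟨W, hW⟩ := h.schwartz
  obtain ⟨K₁, hK₁, h1⟩ := H1.exists_eLpNorm_four_le
  obtain ⟨K₂, hK₂, h2⟩ := H1.exists_eLpNorm_pow_four_le n h.one_le
  have hWf : eLpNorm W 4 volume ≠ ∞ := (W.memLp 4 volume).2.ne
  refine ⟨(eLpNorm W 4 volume).toReal + (K₁ * |R| + K₁ * |R| + (K₂ * |R|) ^ n + (K₂ * |R|) ^ n),
    by positivity, fun u v hu hv => ?_⟩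
  have hu' := hu.trans (le_abs_self R)
  have hv' := hv.trans (le_abs_self R)
  have m1 : ∀ u : H1, AEStronglyMeasurable (fun x => ‖u.fn x‖) volume := fun u =>
    (Lp.aestronglyMeasurable u.fn).norm
  have m2 : ∀ u : H1, AEStronglyMeasurable (fun x => ‖u.fn x‖ ^ n) volume := fun u =>
    (m1 u).pow n
  have mV : AEStronglyMeasurable (fun x => |V x|) volume :=
    h.continuous_potential.aestronglyMeasurable.norm
  have b1 : ∀ u : H1, ‖u‖ ≤ |R| →
      eLpNorm (fun x => ‖u.fn x‖) 4 volume ≤ ENNReal.ofReal (K₁ * |R|) := fun u hu => by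
    rw [eLpNorm_norm]
    exact (h1 u).trans (ENNReal.ofReal_le_ofReal (by gcongr))
  have b2 : ∀ u : H1, ‖u‖ ≤ |R| →
      eLpNorm (fun x => ‖u.fn x‖ ^ n) 4 volume ≤ ENNReal.ofReal ((K₂ * |R|) ^ n) := fun u hu =>
    (h2 u).trans (ENNReal.ofReal_le_ofReal (by gcongr))
  have bV : eLpNorm (fun x => |V x|) 4 volume = eLpNorm W 4 volume := by
    rw [hW]
    exact eLpNorm_norm V
  have e : weight V n u.fn v.fn = (fun x => |V x|) + ((fun x => ‖u.fn x‖) +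
      (fun x => ‖v.fn x‖) + (fun x => ‖u.fn x‖ ^ n) + fun x => ‖v.fn x‖ ^ n) := rfl
  have h4 : (1 : ℝ≥0∞) ≤ 4 := by norm_num
  rw [e, ENNReal.ofReal_add (by positivity) (by positivity),
    ENNReal.ofReal_add (by positivity) (by positivity),
    ENNReal.ofReal_add (by positivity) (by positivity),
    ENNReal.ofReal_add (by positivity) (by positivity), ENNReal.ofReal_toReal hWf]
  refine (eLpNorm_add_le mV (((m1 u).add (m1 v)).add (m2 u) |>.add (m2 v)) h4).trans
    (add_le_add bV.le ?_)
  refine (eLpNorm_add_le (((m1 u).add (m1 v)).add (m2 u)) (m2 v) h4).trans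
    (add_le_add ?_ (b2 v hv'))
  refine (eLpNorm_add_le ((m1 u).add (m1 v)) (m2 u) h4).trans (add_le_add ?_ (b2 u hu'))
  exact (eLpNorm_add_le (m1 u) (m1 v) h4).trans (add_le_add (b1 u hu') (b1 v hv'))

/-- The weight is bounded where both functions are. -/
theorem ForceBounds.exists_weight_le (h : ForceBounds V β C n) (M : ℝ) :
    ∃ K : ℝ, 0 ≤ K ∧ ∀ x z w, ‖z‖ ≤ M → ‖w‖ ≤ M → |V x| + growthWeight n z w ≤ K := by
  obtain ⟨W, hW⟩ := h.schwartz
  obtain ⟨A, hA⟩ := W.decay 0 0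
  refine ⟨|A| + (|M| + |M| + |M| ^ n + |M| ^ n), by positivity, fun x z w hz hw => ?_⟩
  have h1 := hA.2 x
  simp only [pow_zero, one_mul, norm_iteratedFDeriv_zero, Real.norm_eq_abs, hW] at h1
  have h2 := hz.trans (le_abs_self M)
  have h3 := hw.trans (le_abs_self M)
  unfold growthWeight
  have h4 := h1.trans (le_abs_self A)
  gcongr

theorem ForceBounds.eLpNorm_force_sub_le (h : ForceBounds V β C n) {f g : Plane → ℂ}
    (hf : AEStronglyMeasurable f volume) (hg : AEStronglyMeasurable g volume) :
    eLpNorm (fun x => force V β x (f x) - force V β x (g x)) 2 volume ≤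
      ENNReal.ofReal C * (eLpNorm (fun x => f x - g x) 4 volume *
        eLpNorm (weight V n f g) 4 volume) := by
  refine (eLpNorm_le_mul_eLpNorm_of_ae_le_mul (g := fun x => ‖f x - g x‖ * ‖weight V n f g x‖)
    (c := C) (Eventually.of_forall fun x => ?_) 2).trans ?_
  · rw [norm_mul, norm_norm, norm_norm, Real.norm_of_nonneg (weight_nonneg V n f g x)]
    exact h.lipschitz x (f x) (g x)
  · gcongr
    exact eLpNorm_two_mul_le (hf.sub hg) (h.aestronglyMeasurable_weight hf hg)

theorem ForceBounds.memLp_force (h : ForceBounds V β C n) (u : H1) :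
    MemLp (fun x => force V β x (u.fn x)) 2 volume := by
  refine ⟨h.aestronglyMeasurable_force (Lp.aestronglyMeasurable _), ?_⟩
  obtain ⟨K, hK, hw⟩ := h.exists_eLpNorm_weight_le ‖u‖
  obtain ⟨K₁, hK₁, h1⟩ := H1.exists_eLpNorm_four_le
  have h0 := h.eLpNorm_force_sub_le (Lp.aestronglyMeasurable u.fn)
    (aestronglyMeasurable_const (b := (0 : ℂ)))
  simp only [force_zero, sub_zero] at h0
  have hw0 : eLpNorm (weight V n u.fn fun _ => 0) 4 volume ≤
      eLpNorm (weight V n u.fn u.fn) 4 volume := by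
    refine eLpNorm_mono fun x => ?_
    rw [Real.norm_of_nonneg (weight_nonneg _ _ _ _ _), Real.norm_of_nonneg (weight_nonneg _ _ _ _ _)]
    have hn := h.one_le
    unfold weight growthWeight
    rw [norm_zero, zero_pow (by omega)]
    have := norm_nonneg (u.fn x)
    have := pow_nonneg this n
    linarith
  refine (h0.trans (mul_le_mul' le_rfl (mul_le_mul' (h1 u)
    (hw0.trans (hw u u le_rfl le_rfl))))).trans_lt ?_
  rw [← ENNReal.ofReal_mul (by positivity), ← ENNReal.ofReal_mul h.nonneg]
  exact ENNReal.ofReal_lt_top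

open Classical in
/-- The force term `(V + β(|f|²)) f` as an element of `L²`, and `0` if it is not in `L²`. -/
def nl (V : Plane → ℝ) (β : ℝ → ℝ) (f : L2) : L2 :=
  if h : MemLp (fun x => force V β x (f x)) 2 volume then h.toLp _ else 0

theorem coeFn_nl {f : L2} (h : MemLp (fun x => force V β x (f x)) 2 volume) :
    nl V β f =ᵐ[volume] fun x => force V β x (f x) := by
  rw [nl, dif_pos h]
  exact h.coeFn_toLp

theorem norm_nl_sub {f g : L2} (hf : MemLp (fun x => force V β x (f x)) 2 volume)
    (hg : MemLp (fun x => force V β x (g x)) 2 volume) :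
    ‖nl V β f - nl V β g‖ =
      (eLpNorm (fun x => force V β x (f x) - force V β x (g x)) 2 volume).toReal := by
  rw [Lp.norm_def]
  congr 1
  refine eLpNorm_congr_ae ?_
  filter_upwards [Lp.coeFn_sub (nl V β f) (nl V β g), coeFn_nl hf, coeFn_nl hg] with x h1 h2 h3
  rw [h1, Pi.sub_apply, h2, h3]

theorem eLpNorm_coeFn_sub (f g : L2) (p : ℝ≥0∞) :
    eLpNorm (fun x => f x - g x) p volume = eLpNorm (f - g : L2) p volume :=
  (eLpNorm_congr_ae (Lp.coeFn_sub f g)).symm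

/-- The force is Lipschitz from bounded sets of `H¹` to `L²`. -/
theorem ForceBounds.exists_norm_nl_sub_le (h : ForceBounds V β C n) (R : ℝ) :
    ∃ K : ℝ, 0 ≤ K ∧ ∀ u v : H1, ‖u‖ ≤ R → ‖v‖ ≤ R →
      ‖nl V β u.fn - nl V β v.fn‖ ≤ K * ‖u - v‖ := by
  obtain ⟨K, hK, hw⟩ := h.exists_eLpNorm_weight_le R
  obtain ⟨K₁, hK₁, h1⟩ := H1.exists_eLpNorm_four_le
  have hC := h.nonneg
  refine ⟨C * (K₁ * K), by positivity, fun u v hu hv => ?_⟩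
  rw [norm_nl_sub (h.memLp_force u) (h.memLp_force v)]
  refine ENNReal.toReal_le_of_le_ofReal (by positivity) ?_
  refine (h.eLpNorm_force_sub_le (Lp.aestronglyMeasurable _) (Lp.aestronglyMeasurable _)).trans ?_
  rw [eLpNorm_coeFn_sub, ← H1.fn_sub]
  refine (mul_le_mul' le_rfl (mul_le_mul' (h1 (u - v)) (hw u v hu hv))).trans_eq ?_
  rw [← ENNReal.ofReal_mul (by positivity), ← ENNReal.ofReal_mul hC]
  congr 1
  ring

/-- On bounded functions the force is Lipschitz in `L²`. -/
theorem ForceBounds.exists_norm_nl_sub_le_of_bounded (h : ForceBounds V β C n) (M : ℝ) :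
    ∃ K : ℝ, 0 ≤ K ∧ ∀ u v : H1, (∀ᵐ x, ‖u.fn x‖ ≤ M) → (∀ᵐ x, ‖v.fn x‖ ≤ M) →
      ‖nl V β u.fn - nl V β v.fn‖ ≤ K * ‖u.fn - v.fn‖ := by
  obtain ⟨K, hK, hw⟩ := h.exists_weight_le M
  have hC := h.nonneg
  refine ⟨C * K, by positivity, fun u v hu hv => ?_⟩
  rw [norm_nl_sub (h.memLp_force u) (h.memLp_force v), Lp.norm_def]
  have h1 : eLpNorm (fun x => force V β x (u.fn x) - force V β x (v.fn x)) 2 volume ≤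
      ENNReal.ofReal (C * K) * eLpNorm (u.fn - v.fn : L2) 2 volume := by
    rw [← eLpNorm_coeFn_sub]
    refine eLpNorm_le_mul_eLpNorm_of_ae_le_mul ?_ 2
    filter_upwards [hu, hv] with x h1 h2
    refine (h.lipschitz x _ _).trans ?_
    rw [mul_assoc, mul_comm K]
    gcongr
    exact hw x _ _ h1 h2
  refine (ENNReal.toReal_mono ?_ h1).trans_eq ?_
  · exact ENNReal.mul_ne_top ENNReal.ofReal_ne_top (Lp.eLpNorm_ne_top _)
  · rw [ENNReal.toReal_mul, ENNReal.toReal_ofReal (by positivity)]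

/-- The potential part `∫ V |f|² + B(|f|²)` of (twice) the energy. -/
def potEnergy (V : Plane → ℝ) (β : ℝ → ℝ) (f : L2) : ℝ := ∫ x, potDensity V β x (f x)

theorem ForceBounds.lintegral_potDensity_sub_le (h : ForceBounds V β C n) (f g : L2) :
    ∫⁻ x, ‖potDensity V β x (f x) - potDensity V β x (g x)‖ₑ ≤
      ENNReal.ofReal C * (eLpNorm (f - g : L2) 4 volume *
        eLpNorm (weight V n f g) 4 volume * eLpNorm (fun x => ‖f x‖ + ‖g x‖) 2 volume) := by
  have mf := Lp.aestronglyMeasurable f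
  have mg := Lp.aestronglyMeasurable g
  rw [← eLpNorm_coeFn_sub]
  refine le_trans ?_ (mul_le_mul' le_rfl (lintegral_enorm_mul_mul_le (mf.sub mg)
    (h.aestronglyMeasurable_weight mf mg) (mf.norm.add mg.norm)))
  rw [← lintegral_const_mul' _ _ ENNReal.ofReal_ne_top]
  refine lintegral_mono fun x => ?_
  have h1 := h.potDensity_sub x (f x) (g x)
  rw [← ofReal_norm, ← ofReal_norm, ← ofReal_norm,
    ← ofReal_norm, ← ENNReal.ofReal_mul (norm_nonneg _),
    ← ENNReal.ofReal_mul (by positivity), ← ENNReal.ofReal_mul h.nonneg]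
  refine ENNReal.ofReal_le_ofReal ?_
  rw [Real.norm_of_nonneg (weight_nonneg V n f g x), Real.norm_eq_abs,
    Real.norm_of_nonneg (by positivity), mul_assoc]
  exact h1

theorem ForceBounds.exists_lintegral_potDensity_sub_le (h : ForceBounds V β C n) (R : ℝ) :
    ∃ K : ℝ, 0 ≤ K ∧ ∀ u v : H1, ‖u‖ ≤ R → ‖v‖ ≤ R →
      ∫⁻ x, ‖potDensity V β x (u.fn x) - potDensity V β x (v.fn x)‖ₑ ≤
        ENNReal.ofReal (K * (eLpNorm (u - v).fn 4 volume).toReal) := by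
  obtain ⟨K, hK, hw⟩ := h.exists_eLpNorm_weight_le R
  obtain ⟨K₁, hK₁, h1⟩ := H1.exists_eLpNorm_four_le
  have hC := h.nonneg
  refine ⟨C * (K * (|R| + |R|)), by positivity, fun u v hu hv => ?_⟩
  refine (h.lintegral_potDensity_sub_le u.fn v.fn).trans ?_
  have h2 : ∀ u : H1, ‖u‖ ≤ R → eLpNorm (fun x => ‖u.fn x‖) 2 volume ≤ ENNReal.ofReal |R| := by
    intro u hu
    rw [eLpNorm_norm]
    refine ENNReal.le_ofReal_iff_toReal_le (Lp.eLpNorm_ne_top _) (abs_nonneg R) |>.2 ?_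
    rw [← Lp.norm_def]
    exact (H1.norm_fn_le u).trans (hu.trans (le_abs_self R))
  have h3 : eLpNorm (fun x => ‖u.fn x‖ + ‖v.fn x‖) 2 volume ≤ ENNReal.ofReal (|R| + |R|) := by
    rw [ENNReal.ofReal_add (abs_nonneg R) (abs_nonneg R)]
    exact (eLpNorm_add_le (Lp.aestronglyMeasurable _).norm (Lp.aestronglyMeasurable _).norm
      (by norm_num)).trans (add_le_add (h2 u hu) (h2 v hv))
  have hfin : eLpNorm (u - v).fn 4 volume ≠ ∞ := ((h1 (u - v)).trans_lt ENNReal.ofReal_lt_top).ne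
  rw [← H1.fn_sub, ← ENNReal.ofReal_toReal hfin]
  refine (mul_le_mul' le_rfl (mul_le_mul' (mul_le_mul' le_rfl (hw u v hu hv)) h3)).trans_eq ?_
  rw [← ENNReal.ofReal_mul (by positivity), ← ENNReal.ofReal_mul (by positivity),
    ← ENNReal.ofReal_mul hC]
  congr 1
  rw [ENNReal.toReal_ofReal (by positivity)]
  ring

theorem ForceBounds.integrable_potDensity (h : ForceBounds V β C n) (u : H1) :
    Integrable (fun x => potDensity V β x (u.fn x)) := by
  refine ⟨h.aestronglyMeasurable_potDensity (Lp.aestronglyMeasurable _), ?_⟩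
  obtain ⟨K, -, hK⟩ := h.exists_lintegral_potDensity_sub_le ‖u‖
  have h1 := hK u 0 le_rfl (by simp)
  refine lt_of_le_of_lt (le_trans (lintegral_mono_ae ?_) h1) ENNReal.ofReal_lt_top
  filter_upwards [Lp.coeFn_zero ℂ 2 (volume : Measure Plane)] with x hx
  have : (0 : H1).fn = 0 := rfl
  rw [this, hx, Pi.zero_apply, potDensity_zero, sub_zero]

theorem ForceBounds.exists_abs_potEnergy_sub_le (h : ForceBounds V β C n) (R : ℝ) :
    ∃ K : ℝ, 0 ≤ K ∧ ∀ u v : H1, ‖u‖ ≤ R → ‖v‖ ≤ R →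
      |potEnergy V β u.fn - potEnergy V β v.fn| ≤
        K * (eLpNorm (u - v).fn 4 volume).toReal := by
  obtain ⟨K, hK, hb⟩ := h.exists_lintegral_potDensity_sub_le R
  refine ⟨K, hK, fun u v hu hv => ?_⟩
  rw [potEnergy, potEnergy, ← integral_sub (h.integrable_potDensity u) (h.integrable_potDensity v),
    ← Real.norm_eq_abs]
  refine (norm_integral_le_lintegral_norm _).trans ?_
  refine ENNReal.toReal_le_of_le_ofReal (by positivity) ?_
  simp only [ofReal_norm]
  exact hb u v hu hv

theorem ForceBounds.inner_nl (h : ForceBounds V β C n) (w : L2) (v : H1) :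
    (Integrable fun x => (starRingEnd ℂ) (w x) * force V β x (v.fn x)) ∧
      inner ℂ w (nl V β v.fn) = ∫ x, (starRingEnd ℂ) (w x) * force V β x (v.fn x) := by
  have h1 : (fun x => inner ℂ (w x) ((nl V β v.fn) x)) =ᵐ[volume]
      fun x => (starRingEnd ℂ) (w x) * force V β x (v.fn x) := by
    filter_upwards [coeFn_nl (h.memLp_force v)] with x hx
    rw [hx, RCLike.inner_apply, mul_comm]
  exact ⟨(L2.integrable_inner (𝕜 := ℂ) w (nl V β v.fn)).congr h1, integral_congr_ae h1⟩

theorem ForceBounds.abs_taylor_le (h : ForceBounds V β C n) (v w : H1) :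
    ENNReal.ofReal |potEnergy V β (v + w).fn - potEnergy V β v.fn -
      2 * (inner ℂ w.fn (nl V β v.fn)).re| ≤
      ∫⁻ x, ENNReal.ofReal
        (C * (‖w.fn x‖ ^ 2 * (|V x| + growthWeight n ((v + w).fn x) (v.fn x)))) := by
  obtain ⟨hi, he⟩ := h.inner_nl w.fn v
  have h1 : potEnergy V β (v + w).fn - potEnergy V β v.fn -
      2 * (inner ℂ w.fn (nl V β v.fn)).re = ∫ x, (potDensity V β x ((v + w).fn x) -
        potDensity V β x (v.fn x) -
        2 * ((starRingEnd ℂ) (w.fn x) * force V β x (v.fn x)).re) := by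
    have hre : (∫ x, (starRingEnd ℂ) (w.fn x) * force V β x (v.fn x)).re =
        ∫ x, ((starRingEnd ℂ) (w.fn x) * force V β x (v.fn x)).re := by
      simpa using (integral_re hi).symm
    have i1 : Integrable fun x => potDensity V β x ((v + w).fn x) - potDensity V β x (v.fn x) :=
      (h.integrable_potDensity _).sub (h.integrable_potDensity _)
    have i2 : Integrable fun x => 2 * ((starRingEnd ℂ) (w.fn x) * force V β x (v.fn x)).re :=
      hi.re.const_mul 2
    rw [integral_sub i1 i2, integral_sub (h.integrable_potDensity _) (h.integrable_potDensity _),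
      integral_const_mul, he, hre]
    rfl
  rw [h1, ← Real.norm_eq_abs, ofReal_norm]
  refine (enorm_integral_le_lintegral_enorm _).trans (lintegral_mono_ae ?_)
  have : (v + w).fn = v.fn + w.fn := by simp
  rw [this]
  filter_upwards [Lp.coeFn_add v.fn w.fn] with x hx
  rw [← ofReal_norm, Real.norm_eq_abs, hx]
  exact ENNReal.ofReal_le_ofReal (h.taylor x (v.fn x) (w.fn x))

/-- The second order Taylor estimate for the potential energy on bounded sets of `H¹`. -/
theorem ForceBounds.exists_abs_taylor_le (h : ForceBounds V β C n) (R : ℝ) :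
    ∃ K : ℝ, 0 ≤ K ∧ ∀ v w : H1, ‖v‖ ≤ R → ‖v + w‖ ≤ R →
      |potEnergy V β (v + w).fn - potEnergy V β v.fn - 2 * (inner ℂ w.fn (nl V β v.fn)).re| ≤
        K * ‖w‖ ^ 2 := by
  obtain ⟨K, hK, hw⟩ := h.exists_eLpNorm_weight_le R
  obtain ⟨K₁, hK₁, h1⟩ := H1.exists_eLpNorm_four_le
  have hC := h.nonneg
  refine ⟨C * (K₁ * K), by positivity, fun v w hv hvw => ?_⟩
  refine (ENNReal.ofReal_le_ofReal_iff (by positivity)).1 ((h.abs_taylor_le v w).trans ?_)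
  have mw := Lp.aestronglyMeasurable w.fn
  have h2 : eLpNorm w.fn 2 volume ≤ ENNReal.ofReal ‖w‖ := by
    refine ENNReal.le_ofReal_iff_toReal_le (Lp.eLpNorm_ne_top _) (norm_nonneg w) |>.2 ?_
    rw [← Lp.norm_def]
    exact H1.norm_fn_le w
  have h3 := lintegral_enorm_mul_mul_le mw (h.aestronglyMeasurable_weight
    (Lp.aestronglyMeasurable (v + w).fn) (Lp.aestronglyMeasurable v.fn)) mw
  have h4 : ∀ x, ENNReal.ofReal
      (C * (‖w.fn x‖ ^ 2 * (|V x| + growthWeight n ((v + w).fn x) (v.fn x)))) =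
      ENNReal.ofReal C * (‖w.fn x‖ₑ * ‖weight V n (v + w).fn v.fn x‖ₑ * ‖w.fn x‖ₑ) := by
    intro x
    rw [← ofReal_norm, ← ofReal_norm,
      Real.norm_of_nonneg (weight_nonneg V n _ _ x), ← ENNReal.ofReal_mul (norm_nonneg _),
      ← ENNReal.ofReal_mul (mul_nonneg (norm_nonneg _) (weight_nonneg V n _ _ x)),
      ← ENNReal.ofReal_mul hC, weight]
    congr 1
    ring
  simp only [h4]
  rw [lintegral_const_mul' _ _ ENNReal.ofReal_ne_top]
  refine (mul_le_mul' le_rfl (h3.trans (mul_le_mul' (mul_le_mul' (h1 w) (hw _ _ hvw hv))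
    h2))).trans_eq ?_
  rw [← ENNReal.ofReal_mul (by positivity), ← ENNReal.ofReal_mul (by positivity),
    ← ENNReal.ofReal_mul hC]
  congr 1
  ring

/-- For bounded functions the Taylor remainder is controlled by the `L²` norm. -/
theorem ForceBounds.exists_abs_taylor_le_of_bounded (h : ForceBounds V β C n) (M : ℝ) :
    ∃ K : ℝ, 0 ≤ K ∧ ∀ v w : H1, (∀ᵐ x, ‖v.fn x‖ ≤ M) → (∀ᵐ x, ‖(v + w).fn x‖ ≤ M) →
      |potEnergy V β (v + w).fn - potEnergy V β v.fn - 2 * (inner ℂ w.fn (nl V β v.fn)).re| ≤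
        K * ‖w.fn‖ ^ 2 := by
  obtain ⟨K, hK, hw⟩ := h.exists_weight_le M
  have hC := h.nonneg
  refine ⟨C * K, by positivity, fun v w hv hvw => ?_⟩
  refine (ENNReal.ofReal_le_ofReal_iff (by positivity)).1 ((h.abs_taylor_le v w).trans ?_)
  have h1 : ENNReal.ofReal (‖w.fn‖ ^ 2) = ∫⁻ x, ‖w.fn x‖ₑ ^ 2 := by
    rw [Lp.norm_def, ENNReal.ofReal_pow ENNReal.toReal_nonneg,
      ENNReal.ofReal_toReal (Lp.eLpNorm_ne_top _), eLpNorm_two_sq]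
  rw [ENNReal.ofReal_mul (by positivity), h1, ← lintegral_const_mul' _ _ ENNReal.ofReal_ne_top]
  refine lintegral_mono_ae ?_
  filter_upwards [hv, hvw] with x h2 h3
  rw [← ofReal_norm, ← ENNReal.ofReal_pow (norm_nonneg _),
    ← ENNReal.ofReal_mul (by positivity)]
  refine ENNReal.ofReal_le_ofReal ?_
  rw [mul_assoc, mul_comm K]
  gcongr
  exact hw x _ _ h3 h2

theorem norm_sq_L2_eq (f : L2) : ‖f‖ ^ 2 = ∫ x, ‖f x‖ ^ 2 := by
  have h1 : inner ℂ f f = ∫ x, inner ℂ (f x) (f x) := rfl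
  have h2 : (∫ x, ((‖f x‖ ^ 2 : ℝ) : ℂ)) = ((∫ x, ‖f x‖ ^ 2 : ℝ) : ℂ) := integral_ofReal
  have h3 : ((‖f‖ ^ 2 : ℝ) : ℂ) = ((∫ x, ‖f x‖ ^ 2 : ℝ) : ℂ) := by
    rw [← h2]
    simp only [inner_self_eq_norm_sq_to_K] at h1
    simpa using h1
  exact_mod_cast h3

theorem integrable_norm_sq_L2 (f : L2) : Integrable fun x => ‖f x‖ ^ 2 :=
  (Lp.memLp f).integrable_norm_pow two_ne_zero

theorem mass_eq (u : H1) : mass u = 2⁻¹ * ‖u.fn‖ ^ 2 := by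
  rw [mass, norm_sq_L2_eq]

theorem ForceBounds.energy_eq (h : ForceBounds V β C n) (u : H1) :
    energy V β u = 2⁻¹ * (∑ j, ‖u.partialDeriv j‖ ^ 2 + potEnergy V β u.fn) := by
  have h1 : ∀ x, (∑ j, ‖u.partialDeriv j x‖ ^ 2) + V x * ‖u.fn x‖ ^ 2 +
      primitive β (‖u.fn x‖ ^ 2) =
      (∑ j, ‖u.partialDeriv j x‖ ^ 2) + potDensity V β x (u.fn x) := fun x => by
    rw [potDensity, add_assoc]
  rw [energy, potEnergy]
  simp only [h1, norm_sq_L2_eq]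
  rw [integral_add (integrable_finsetSum _ fun j _ => integrable_norm_sq_L2 _)
    (h.integrable_potDensity u), integral_finsetSum _ fun j _ => integrable_norm_sq_L2 _]

end

section

/-! ### The free Schrödinger group -/

theorem freeEvolutionL2_add (t : ℝ) (f g : L2) :
    freeEvolutionL2 t (f + g) = freeEvolutionL2 t f + freeEvolutionL2 t g := by
  have h : ∀ g g' : L2, ((memLp_freeSymbol t).toLp (freeSymbol t) • (g + g' : L2) : L2) =
      ((memLp_freeSymbol t).toLp (freeSymbol t) • g : L2) +
        ((memLp_freeSymbol t).toLp (freeSymbol t) • g' : L2) := fun g g' => by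
    refine Lp.ext ?_
    filter_upwards [Lp.coeFn_lpSMul (r := 2) ((memLp_freeSymbol t).toLp (freeSymbol t))
        (g + g' : L2),
      Lp.coeFn_add ((memLp_freeSymbol t).toLp (freeSymbol t) • g : L2)
        ((memLp_freeSymbol t).toLp (freeSymbol t) • g' : L2), Lp.coeFn_add g g',
      Lp.coeFn_lpSMul (r := 2) ((memLp_freeSymbol t).toLp (freeSymbol t)) g,
      Lp.coeFn_lpSMul (r := 2) ((memLp_freeSymbol t).toLp (freeSymbol t)) g'] with x h1 h2 h3 h4 h5
    rw [h1, h2, Pi.add_apply, Pi.smul_apply', h4, h5, h3]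
    simp only [Pi.add_apply, Pi.smul_apply', smul_eq_mul]
    ring
  simp only [freeEvolutionL2, FourierTransform.fourier_add, h, FourierTransform.fourierInv_add]

theorem freeEvolutionL2_smul (t : ℝ) (c : ℂ) (f : L2) :
    freeEvolutionL2 t (c • f) = c • freeEvolutionL2 t f := by
  have h : ∀ g : L2, ((memLp_freeSymbol t).toLp (freeSymbol t) • (c • g : L2) : L2) =
      c • ((memLp_freeSymbol t).toLp (freeSymbol t) • g : L2) := fun g => by
    refine Lp.ext ?_
    filter_upwards [Lp.coeFn_lpSMul (r := 2) ((memLp_freeSymbol t).toLp (freeSymbol t)) (c • g : L2),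
      Lp.coeFn_smul c ((memLp_freeSymbol t).toLp (freeSymbol t) • g : L2), Lp.coeFn_smul c g,
      Lp.coeFn_lpSMul (r := 2) ((memLp_freeSymbol t).toLp (freeSymbol t)) g] with x h1 h2 h3 h4
    rw [h1, h2, Pi.smul_apply, Pi.smul_apply', h4, h3]
    simp only [Pi.smul_apply, Pi.smul_apply', smul_eq_mul]
    ring
  simp only [freeEvolutionL2, FourierTransform.fourier_smul, h, FourierTransform.fourierInv_smul]

theorem norm_freeEvolutionL2 (t : ℝ) (f : L2) : ‖freeEvolutionL2 t f‖ = ‖f‖ := by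
  rw [freeEvolutionL2, ← Lp.norm_fourier_eq, FourierTransform.fourier_fourierInv_eq,
    ← Lp.norm_fourier_eq f, Lp.norm_def, Lp.norm_def]
  congr 1
  refine eLpNorm_congr_norm_ae ?_
  filter_upwards [Lp.coeFn_lpSMul (r := 2) ((memLp_freeSymbol t).toLp (freeSymbol t)) (𝓕 f : L2),
    (memLp_freeSymbol t).coeFn_toLp] with x h1 h2
  rw [h1, Pi.smul_apply', h2, norm_smul, norm_freeSymbol, one_mul]

/-- `e^{itΔ}` as a linear isometry of `L²`. -/
def freeIsometry (t : ℝ) : L2 →ₗᵢ[ℂ] L2 where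
  toFun := freeEvolutionL2 t
  map_add' := freeEvolutionL2_add t
  map_smul' := freeEvolutionL2_smul t
  norm_map' := norm_freeEvolutionL2 t

/-- `e^{itΔ}` on Schwartz functions. -/
def freeS (t : ℝ) (ψ : 𝓢(Plane, ℂ)) : 𝓢(Plane, ℂ) :=
  SchwartzMap.fourierMultiplierCLM ℂ (freeSymbol t) ψ

theorem fourier_freeS (t : ℝ) (ψ : 𝓢(Plane, ℂ)) (ξ : Plane) :
    (𝓕 (freeS t ψ)) ξ = freeSymbol t ξ * (𝓕 ψ) ξ := by
  rw [freeS, SchwartzMap.fourierMultiplierCLM_apply, FourierTransform.fourier_fourierInv_eq,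
    SchwartzMap.smulLeftCLM_apply_apply (hasTemperateGrowth_freeSymbol t), smul_eq_mul]

theorem freeEvolutionL2_toL2 (t : ℝ) (ψ : 𝓢(Plane, ℂ)) :
    freeEvolutionL2 t (toL2 ψ) = toL2 (freeS t ψ) := by
  have h : ((memLp_freeSymbol t).toLp (freeSymbol t) • (toL2 (𝓕 ψ)) : L2) =
      toL2 (𝓕 (freeS t ψ)) := by
    refine Lp.ext ?_
    filter_upwards [Lp.coeFn_lpSMul (r := 2) ((memLp_freeSymbol t).toLp (freeSymbol t))
      (toL2 (𝓕 ψ)), (memLp_freeSymbol t).coeFn_toLp, (𝓕 ψ).coeFn_toLp 2 volume,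
      (𝓕 (freeS t ψ)).coeFn_toLp 2 volume] with x h1 h2 h3 h4
    rw [h1, Pi.smul_apply', h2, h3, h4, fourier_freeS, smul_eq_mul]
  rw [freeEvolutionL2, SchwartzMap.toLp_fourier_eq, h, SchwartzMap.toLp_fourierInv_eq,
    FourierTransform.fourierInv_fourier_eq]

theorem norm_toL2_freeS (t : ℝ) (ψ : 𝓢(Plane, ℂ)) : ‖toL2 (freeS t ψ)‖ = ‖toL2 ψ‖ := by
  rw [← freeEvolutionL2_toL2, norm_freeEvolutionL2]

theorem inner_toL2_freeS (t : ℝ) (ψ η : 𝓢(Plane, ℂ)) :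
    inner ℂ (toL2 (freeS t ψ)) (toL2 (freeS t η)) = inner ℂ (toL2 ψ) (toL2 η) := by
  rw [← freeEvolutionL2_toL2, ← freeEvolutionL2_toL2]
  exact (freeIsometry t).inner_map_map _ _

theorem freeS_freeS (s t : ℝ) (ψ : 𝓢(Plane, ℂ)) : freeS s (freeS t ψ) = freeS (s + t) ψ := by
  rw [freeS, freeS, freeS, SchwartzMap.fourierMultiplierCLM_fourierMultiplierCLM_apply
    (hasTemperateGrowth_freeSymbol s) (hasTemperateGrowth_freeSymbol t)]
  congr 1
  congr 1
  ext ξ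
  rw [Pi.mul_apply, freeSymbol, freeSymbol, freeSymbol, ← Complex.exp_add]
  congr 1
  push_cast
  ring

theorem freeS_zero (ψ : 𝓢(Plane, ℂ)) : freeS 0 ψ = ψ := by
  have h : freeSymbol 0 = fun _ => 1 := by
    ext ξ
    simp [freeSymbol]
  rw [freeS, h, SchwartzMap.fourierMultiplierCLM_const]
  simp

theorem inner_toL2_freeS_right (t : ℝ) (ψ η : 𝓢(Plane, ℂ)) :
    inner ℂ (toL2 ψ) (toL2 (freeS t η)) = inner ℂ (toL2 (freeS (-t) ψ)) (toL2 η) := by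
  rw [← inner_toL2_freeS t (freeS (-t) ψ), freeS_freeS, add_neg_cancel, freeS_zero]

theorem lineDeriv_freeS (t : ℝ) (m : Plane) (ψ : 𝓢(Plane, ℂ)) :
    ∂_{m} (freeS t ψ) = freeS t (∂_{m} ψ) := by
  have hs := hasTemperateGrowth_freeSymbol t
  have hi : (fun x : Plane => ((inner ℝ x m : ℝ) : ℂ)).HasTemperateGrowth := by fun_prop
  have hi' : (fun x : Plane => (inner ℝ x m : ℝ)).HasTemperateGrowth := by fun_prop
  have h2 : ∀ η : 𝓢(Plane, ℂ), SchwartzMap.fourierMultiplierCLM ℂ (inner ℝ · m) η =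
      SchwartzMap.fourierMultiplierCLM ℂ (fun x : Plane => ((inner ℝ x m : ℝ) : ℂ)) η :=
    fun η => (SchwartzMap.fourierMultiplierCLM_ofReal ℂ hi' η).symm
  rw [SchwartzMap.lineDeriv_eq_fourierMultiplierCLM, SchwartzMap.lineDeriv_eq_fourierMultiplierCLM,
    h2, h2, freeS, freeS, map_smul,
    SchwartzMap.fourierMultiplierCLM_fourierMultiplierCLM_apply hi hs,
    SchwartzMap.fourierMultiplierCLM_fourierMultiplierCLM_apply hs hi, mul_comm (freeSymbol t)]

theorem norm_exp_neg_I_sub_le (a : ℝ) :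
    ‖Complex.exp (-(Complex.I * (a : ℂ))) - 1 + Complex.I * a‖ ≤ 3 * a ^ 2 := by
  have hn : ‖-(Complex.I * (a : ℂ))‖ = |a| := by simp
  rcases le_total |a| 1 with h | h
  · have h1 := Complex.norm_exp_sub_one_sub_id_le (x := -(Complex.I * (a : ℂ))) (by rw [hn]; exact h)
    rw [hn, sq_abs, sub_neg_eq_add] at h1
    nlinarith [sq_nonneg a]
  · have h1 : ‖Complex.exp (-(Complex.I * (a : ℂ)))‖ = 1 := by
      rw [Complex.norm_exp]; simp
    calc ‖Complex.exp (-(Complex.I * (a : ℂ))) - 1 + Complex.I * a‖ ≤ 1 + 1 + |a| := by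
          refine (norm_add_le _ _).trans (add_le_add ((norm_sub_le _ _).trans ?_) ?_)
          · rw [h1, norm_one]
          · simp
      _ ≤ 3 * |a| ^ 2 := by nlinarith
      _ = _ := by rw [sq_abs]

theorem fourier_laplacian (ψ : 𝓢(Plane, ℂ)) (ξ : Plane) :
    (𝓕 (Δ ψ)) ξ = -(((2 * Real.pi) ^ 2 * ‖ξ‖ ^ 2 : ℝ) : ℂ) * (𝓕 ψ) ξ := by
  have h : (fun x : Plane => ‖x‖ ^ 2).HasTemperateGrowth := by fun_prop
  rw [SchwartzMap.laplacian_eq_fourierMultiplierCLM, FourierTransform.fourier_smul,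
    SchwartzMap.fourierMultiplierCLM_apply, FourierTransform.fourier_fourierInv_eq,
    smul_apply, SchwartzMap.smulLeftCLM_apply_apply h]
  simp only [Complex.real_smul]
  push_cast
  ring

theorem fourier_freeS_sub (h : ℝ) (ψ : 𝓢(Plane, ℂ)) (ξ : Plane) :
    (𝓕 (freeS h ψ - ψ - ((h : ℂ) * Complex.I) • Δ ψ)) ξ =
      (freeSymbol h ξ - 1 + Complex.I * ((h * ((2 * Real.pi) ^ 2 * ‖ξ‖ ^ 2) : ℝ) : ℂ)) *
        (𝓕 ψ) ξ := by
  rw [sub_eq_add_neg, sub_eq_add_neg, FourierTransform.fourier_add,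
    FourierTransform.fourier_add, FourierTransform.fourier_neg, FourierTransform.fourier_neg,
    FourierTransform.fourier_smul]
  have e : ∀ f g k : 𝓢(Plane, ℂ), (f + -g + -(((h : ℂ) * Complex.I) • k)) ξ =
      f ξ - g ξ - (h : ℂ) * Complex.I * k ξ := fun f g k => by
    rw [← sub_eq_add_neg, ← sub_eq_add_neg]
    rfl
  rw [e, fourier_freeS, fourier_laplacian, Complex.ofReal_mul h]
  ring

theorem norm_fourier_freeS_sub_le (h : ℝ) (ψ : 𝓢(Plane, ℂ)) (ξ : Plane) :
    ‖(𝓕 (freeS h ψ - ψ - ((h : ℂ) * Complex.I) • Δ ψ)) ξ‖ ≤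
      3 * h ^ 2 * ‖(𝓕 (Δ (Δ ψ))) ξ‖ := by
  rw [fourier_freeS_sub, fourier_laplacian, fourier_laplacian, freeSymbol]
  generalize (𝓕 ψ) ξ = z
  have h3 := norm_exp_neg_I_sub_le (h * (2 * Real.pi) ^ 2 * ‖ξ‖ ^ 2)
  rw [mul_assoc h] at h3 ⊢
  generalize (2 * Real.pi) ^ 2 * ‖ξ‖ ^ 2 = a at h3 ⊢
  rw [norm_mul]
  refine (mul_le_mul_of_nonneg_right h3 (norm_nonneg z)).trans_eq ?_
  rw [norm_mul, norm_mul, norm_neg, Complex.norm_real, Real.norm_eq_abs, ← mul_assoc |a|,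
    ← pow_two, sq_abs]
  ring

theorem norm_toL2_freeS_sub_le (h : ℝ) (ψ : 𝓢(Plane, ℂ)) :
    ‖toL2 (freeS h ψ) - toL2 ψ - h • (Complex.I • toL2 (Δ ψ))‖ ≤
      3 * h ^ 2 * ‖toL2 (Δ (Δ ψ))‖ := by
  have e : toL2 (freeS h ψ) - toL2 ψ - h • (Complex.I • toL2 (Δ ψ)) =
      toL2 (freeS h ψ - ψ - ((h : ℂ) * Complex.I) • Δ ψ) := by
    rw [toL2_sub, toL2_sub, toL2_smul, mul_smul]
    congr 1
  have hF : ∀ χ : 𝓢(Plane, ℂ), ‖toL2 χ‖ = ‖toL2 (𝓕 χ)‖ := fun χ => by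
    rw [← Lp.norm_fourier_eq, SchwartzMap.toLp_fourier_eq]
  rw [e, hF, hF (Δ (Δ ψ))]
  refine Lp.norm_le_mul_norm_of_ae_le_mul ?_
  filter_upwards [(𝓕 (freeS h ψ - ψ - ((h : ℂ) * Complex.I) • Δ ψ)).coeFn_toLp 2 volume,
    (𝓕 (Δ (Δ ψ))).coeFn_toLp 2 volume] with ξ h1 h2
  rw [h1, h2]
  exact norm_fourier_freeS_sub_le h ψ ξ

theorem hasDerivAt_toL2_freeS (ψ : 𝓢(Plane, ℂ)) (t : ℝ) :
    HasDerivAt (fun s => toL2 (freeS s ψ)) (Complex.I • toL2 (Δ (freeS t ψ))) t := by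
  rw [hasDerivAt_iff_isLittleO_nhds_zero]
  refine Asymptotics.IsBigO.trans_isLittleO (g := fun h : ℝ => h ^ 2) ?_ ?_
  · refine Asymptotics.IsBigO.of_bound (3 * ‖toL2 (Δ (Δ (freeS t ψ)))‖)
      (Eventually.of_forall fun h => ?_)
    have h1 := norm_toL2_freeS_sub_le h (freeS t ψ)
    rw [freeS_freeS, add_comm h t] at h1
    refine h1.trans_eq ?_
    rw [Real.norm_of_nonneg (sq_nonneg h)]
    ring
  · exact Asymptotics.isLittleO_pow_id one_lt_two

end

section

/-! ### Dispersive estimate -/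

/-- Young's inequality `‖g ⋆ g‖₂² ≤ ‖g‖_{4/3}⁴`, in a form that needs Cauchy-Schwarz only. -/
theorem lintegral_conv_sq_le {g : Plane → ℝ≥0∞} (hg : Measurable g) :
    ∫⁻ x, (∫⁻ t, g t * g (x - t)) ^ 2 ≤ (∫⁻ x, g x ^ (4 / 3 : ℝ)) ^ 3 := by
  have hp : ∀ a : ℝ≥0∞, a = a ^ (2 / 3 : ℝ) * a ^ (1 / 3 : ℝ) := fun a => by
    rw [← ENNReal.rpow_add_of_nonneg _ _ (by norm_num) (by norm_num)]
    norm_num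
  have hp2 : ∀ a : ℝ≥0∞, (a ^ (2 / 3 : ℝ)) ^ 2 = a ^ (4 / 3 : ℝ) := fun a => by
    rw [← ENNReal.rpow_natCast, ← ENNReal.rpow_mul]
    norm_num
  have hp3 : ∀ a : ℝ≥0∞, (a ^ (1 / 3 : ℝ)) ^ 2 = a ^ (2 / 3 : ℝ) := fun a => by
    rw [← ENNReal.rpow_natCast, ← ENNReal.rpow_mul]
    norm_num
  have hm : ∀ (r : ℝ), Measurable fun t => g t ^ r := fun r => hg.pow_const r
  have hmx : ∀ (r : ℝ) (x : Plane), Measurable fun t => g (x - t) ^ r := fun r x =>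
    (hg.comp (measurable_const.sub measurable_id)).pow_const r
  set I := ∫⁻ x, g x ^ (4 / 3 : ℝ) with hI
  have h1 : ∀ x, ∫⁻ t, g t ^ (2 / 3 : ℝ) * g (x - t) ^ (2 / 3 : ℝ) ≤ I := fun x => by
    have := lintegral_mul_sq_le (μ := (volume : Measure Plane)) (hm (2 / 3)).aemeasurable
      (hmx (2 / 3) x).aemeasurable
    simp only [hp2] at this
    rw [lintegral_sub_left_eq_self (fun t => g t ^ (4 / 3 : ℝ)) x, ← hI, ← pow_two] at this
    exact (ENNReal.pow_le_pow_left_iff two_ne_zero).1 this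
  have h2 : ∀ x, (∫⁻ t, g t * g (x - t)) ^ 2 ≤
      (∫⁻ t, g t ^ (4 / 3 : ℝ) * g (x - t) ^ (4 / 3 : ℝ)) * I := fun x => by
    have e : ∀ t, g t * g (x - t) = (g t ^ (2 / 3 : ℝ) * g (x - t) ^ (2 / 3 : ℝ)) *
        (g t ^ (1 / 3 : ℝ) * g (x - t) ^ (1 / 3 : ℝ)) := fun t => by
      rw [mul_mul_mul_comm, ← hp, ← hp]
    simp only [e]
    refine (lintegral_mul_sq_le (f := fun t => g t ^ (2 / 3 : ℝ) * g (x - t) ^ (2 / 3 : ℝ))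
      (g := fun t => g t ^ (1 / 3 : ℝ) * g (x - t) ^ (1 / 3 : ℝ))
      ((hm _).mul (hmx _ x)).aemeasurable ((hm _).mul (hmx _ x)).aemeasurable).trans ?_
    simp only [mul_pow, hp2, hp3]
    exact mul_le_mul' le_rfl (h1 x)
  refine (lintegral_mono h2).trans ?_
  have hmm : Measurable fun p : Plane × Plane => g p.2 ^ (4 / 3 : ℝ) * g (p.1 - p.2) ^ (4 / 3 : ℝ) :=
    ((hm _).comp measurable_snd).mul ((hm _).comp (measurable_fst.sub measurable_snd))
  rw [lintegral_mul_const _ hmm.lintegral_prod_right', lintegral_lintegral_swap hmm.aemeasurable]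
  have h3 : ∀ t, ∫⁻ x, g t ^ (4 / 3 : ℝ) * g (x - t) ^ (4 / 3 : ℝ) = g t ^ (4 / 3 : ℝ) * I :=
    fun t => by
      have hx : Measurable fun x => g (x - t) ^ (4 / 3 : ℝ) :=
        (hg.comp (measurable_id.sub measurable_const)).pow_const _
      rw [lintegral_const_mul _ hx,
        lintegral_sub_right_eq_self (fun x => g x ^ (4 / 3 : ℝ)) t]
  simp only [h3]
  rw [lintegral_mul_const _ (hm _), ← hI, pow_succ, pow_two]

/-- The Hausdorff-Young inequality for the exponent `4/3`: the square of `𝓕 g` is the Fourier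
transform of `g ⋆ g`. -/
theorem lintegral_fourier_pow_four_le (g : 𝓢(Plane, ℂ)) :
    ∫⁻ x, ‖(𝓕 g) x‖ₑ ^ 4 ≤ (∫⁻ x, ‖g x‖ₑ ^ (4 / 3 : ℝ)) ^ 3 := by
  set G := SchwartzMap.convolution (ContinuousLinearMap.mul ℂ ℂ) g g with hG
  have h1 : ∀ x, ‖(𝓕 g) x‖ₑ ^ 4 = ‖(𝓕 G) x‖ₑ ^ 2 := fun x => by
    rw [hG, SchwartzMap.fourier_convolution, SchwartzMap.pairing_apply_apply,
      ContinuousLinearMap.mul_apply', enorm_mul]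
    ring
  have h2 : ∫⁻ x, ‖(𝓕 G) x‖ₑ ^ 2 = ∫⁻ x, ‖G x‖ₑ ^ 2 := by
    have e : toL2 (𝓕 G) = 𝓕 (toL2 G) := (SchwartzMap.toLp_fourier_eq G).symm
    rw [lintegral_enorm_sq_toL2, lintegral_enorm_sq_toL2, e, Lp.norm_fourier_eq]
  simp only [h1]
  rw [h2]
  refine le_trans (lintegral_mono fun x => ?_)
    (lintegral_conv_sq_le g.continuous.enorm.measurable)
  gcongr
  rw [hG, SchwartzMap.convolution_apply]
  refine (enorm_integral_le_lintegral_enorm _).trans_eq (lintegral_congr fun t => ?_)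
  rw [ContinuousLinearMap.mul_apply', enorm_mul]

theorem freeS_apply (t : ℝ) (ψ : 𝓢(Plane, ℂ)) (x : Plane) :
    freeS t ψ x = ∫ w : Plane, Complex.exp (2 * Real.pi * Complex.I * inner ℝ x w) *
      (freeSymbol t w * (𝓕 ψ) w) := by
  have h1 : freeS t ψ = 𝓕⁻ (𝓕 (freeS t ψ)) := by simp
  rw [h1, SchwartzMap.fourierInv_coe, Real.fourierInv_eq']
  refine integral_congr_ae (Eventually.of_forall fun w => ?_)
  simp only [fourier_freeS, smul_eq_mul, real_inner_comm x w]
  congr 2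
  push_cast
  ring

/-- The Fourier transform of a Gaussian, moved to the other factor of a pairing; the exponent of the
prefactor `π / b` is half the dimension. -/
theorem freeS_gaussian_identity (ψ : 𝓢(Plane, ℂ)) (x : Plane) {b : ℂ} (hb : 0 < b.re) :
    ∫ w : Plane, Complex.exp (-b * ‖w‖ ^ 2 + 2 * Real.pi * Complex.I * inner ℝ x w) *
      (𝓕 ψ) w =
    (Real.pi / b) * ∫ w : Plane, Complex.exp (-Real.pi ^ 2 * ‖x - w‖ ^ 2 / b) * ψ w := by
  have J : Integrable (fun w : Plane =>
      Complex.exp (-b * ‖w‖ ^ 2 + 2 * Real.pi * Complex.I * inner ℝ x w)) :=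
    GaussianFourier.integrable_cexp_neg_mul_sq_norm_add hb _ _
  have h : ∫ w : Plane, 𝓕 (fun w : Plane =>
        Complex.exp (-b * ‖w‖ ^ 2 + 2 * Real.pi * Complex.I * inner ℝ x w)) w • ψ w =
      ∫ w : Plane, Complex.exp (-b * ‖w‖ ^ 2 + 2 * Real.pi * Complex.I * inner ℝ x w) •
        (𝓕 ψ) w := by
    simpa using! (VectorFourier.integral_fourierIntegral_smul_eq_flip (L := innerₗ Plane)
      Real.continuous_fourierChar continuous_inner J ψ.integrable)
  simp only [smul_eq_mul] at h
  rw [← h, ← integral_const_mul]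
  refine integral_congr_ae (Eventually.of_forall fun w => ?_)
  simp only
  rw [fourier_gaussian_innerProductSpace' hb]
  have : (Module.finrank ℝ Plane / 2 : ℂ) = 1 := by simp
  rw [this, Complex.cpow_one]
  ring

/-- The integral kernel of `e^{itΔ}`. -/
theorem freeS_apply_eq_kernel {t : ℝ} (ht : t ≠ 0) (ψ : 𝓢(Plane, ℂ)) (x : Plane) :
    freeS t ψ x = (Real.pi / (Complex.I * (t * (2 * Real.pi) ^ 2 : ℝ))) *
      ∫ w : Plane, Complex.exp (-Real.pi ^ 2 * ‖x - w‖ ^ 2 /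
        (Complex.I * (t * (2 * Real.pi) ^ 2 : ℝ))) * ψ w := by
  set b₀ : ℂ := Complex.I * (t * (2 * Real.pi) ^ 2 : ℝ) with hb₀
  have hb0 : b₀ ≠ 0 := by
    rw [hb₀]
    refine mul_ne_zero Complex.I_ne_zero (Complex.ofReal_ne_zero.2 ?_)
    have := Real.pi_pos.ne'
    positivity
  have hre0 : b₀.re = 0 := by rw [hb₀, Complex.re_mul_ofReal, Complex.I_re, zero_mul]
  have hre : ∀ σ : ℝ, (σ + b₀).re = σ := fun σ => by simp [hre0]
  -- both sides of the Gaussian identity for `b = σ + b₀` converge as `σ → 0⁺`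
  have h1 : Tendsto (fun σ : ℝ => ∫ w : Plane, Complex.exp (-(σ + b₀) * ‖w‖ ^ 2 +
      2 * Real.pi * Complex.I * inner ℝ x w) * (𝓕 ψ) w) (𝓝[>] 0) (𝓝 (freeS t ψ x)) := by
    rw [freeS_apply]
    refine tendsto_integral_filter_of_dominated_convergence (fun w => ‖(𝓕 ψ) w‖) ?_ ?_
      (𝓕 ψ).integrable.norm (Eventually.of_forall fun w => ?_)
    · refine Eventually.of_forall fun σ => Continuous.aestronglyMeasurable ?_
      have := (𝓕 ψ).continuous
      fun_prop
    · filter_upwards [self_mem_nhdsWithin] with σ (hσ : 0 < σ)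
      refine Eventually.of_forall fun w => ?_
      rw [norm_mul, Complex.norm_exp]
      refine mul_le_of_le_one_left (norm_nonneg _) (Real.exp_le_one_iff.2 ?_)
      have e : (-(σ + b₀) * ‖w‖ ^ 2 + 2 * Real.pi * Complex.I * (inner ℝ x w : ℝ)).re =
          -(σ * ‖w‖ ^ 2) := by
        have : (-(σ + b₀) * ‖w‖ ^ 2 + 2 * Real.pi * Complex.I * (inner ℝ x w : ℝ)) =
            -((σ + b₀) * ((‖w‖ ^ 2 : ℝ) : ℂ)) +
              Complex.I * ((2 * Real.pi * inner ℝ x w : ℝ) : ℂ) := by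
          push_cast; ring
        rw [this, Complex.add_re, Complex.neg_re, Complex.re_mul_ofReal, hre,
          Complex.re_mul_ofReal]
        simp
      rw [e]
      have := mul_nonneg hσ.le (sq_nonneg ‖w‖)
      linarith
    · have e : Complex.exp (2 * Real.pi * Complex.I * inner ℝ x w) *
          (freeSymbol t w * (𝓕 ψ) w) = Complex.exp (-((0 : ℝ) + b₀) * ‖w‖ ^ 2 +
          2 * Real.pi * Complex.I * inner ℝ x w) * (𝓕 ψ) w := by
        rw [freeSymbol, ← mul_assoc, ← Complex.exp_add]
        congr 2
        rw [hb₀]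
        push_cast
        ring
      rw [e]
      refine Tendsto.mono_left ?_ nhdsWithin_le_nhds
      have hc : Continuous fun σ : ℝ => Complex.exp (-(σ + b₀) * ‖w‖ ^ 2 +
          2 * Real.pi * Complex.I * inner ℝ x w) * (𝓕 ψ) w := by fun_prop
      exact hc.tendsto 0
  have h2 : Tendsto (fun σ : ℝ => (Real.pi / (σ + b₀)) * ∫ w : Plane,
      Complex.exp (-Real.pi ^ 2 * ‖x - w‖ ^ 2 / (σ + b₀)) * ψ w) (𝓝[>] 0)
      (𝓝 ((Real.pi / b₀) * ∫ w : Plane, Complex.exp (-Real.pi ^ 2 * ‖x - w‖ ^ 2 / b₀) * ψ w)) := by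
    have hσ0 : Tendsto (fun σ : ℝ => (σ + b₀ : ℂ)) (𝓝[>] 0) (𝓝 b₀) := by
      have hc : Continuous fun σ : ℝ => (σ + b₀ : ℂ) := by fun_prop
      have := hc.tendsto 0
      simp only [Complex.ofReal_zero, zero_add] at this
      exact this.mono_left nhdsWithin_le_nhds
    refine (tendsto_const_nhds.div hσ0 hb0).mul ?_
    refine tendsto_integral_filter_of_dominated_convergence (fun w => ‖ψ w‖) ?_ ?_
      ψ.integrable.norm (Eventually.of_forall fun w => ?_)
    · refine Eventually.of_forall fun σ => Continuous.aestronglyMeasurable ?_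
      have := ψ.continuous
      fun_prop
    · filter_upwards [self_mem_nhdsWithin] with σ (hσ : 0 < σ)
      refine Eventually.of_forall fun w => ?_
      rw [norm_mul, Complex.norm_exp]
      refine mul_le_of_le_one_left (norm_nonneg _) (Real.exp_le_one_iff.2 ?_)
      have e : (-Real.pi ^ 2 * ‖x - w‖ ^ 2 / (σ + b₀) : ℂ) =
          ((-(Real.pi ^ 2 * ‖x - w‖ ^ 2) : ℝ) : ℂ) * (σ + b₀ : ℂ)⁻¹ := by
        push_cast; ring
      rw [e, Complex.re_ofReal_mul, Complex.inv_re, hre, neg_mul]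
      have : 0 ≤ Real.pi ^ 2 * ‖x - w‖ ^ 2 * (σ / Complex.normSq (σ + b₀)) :=
        mul_nonneg (by positivity) (div_nonneg hσ.le (Complex.normSq_nonneg _))
      linarith
    · exact ((tendsto_const_nhds.div hσ0 hb0).cexp).mul_const _
  refine tendsto_nhds_unique (h1.congr' ?_) h2
  filter_upwards [self_mem_nhdsWithin] with σ (hσ : 0 < σ)
  exact freeS_gaussian_identity ψ x (by rw [hre]; exact hσ)

/-- Up to a phase and a dilation, `e^{itΔ} ψ` is the Fourier transform of `ψ` multiplied by a
quadratic phase. -/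
theorem exists_norm_freeS_eq {t : ℝ} (ht : t ≠ 0) (ψ : 𝓢(Plane, ℂ)) :
    ∃ g : 𝓢(Plane, ℂ), (∀ x, ‖g x‖ = ‖ψ x‖) ∧
      ∀ x, ‖freeS t ψ x‖ = (4 * Real.pi * |t|)⁻¹ * ‖(𝓕 g) ((4 * Real.pi * t)⁻¹ • x)‖ := by
  -- after expansion of `|x - w|²` in the kernel, the phase `e^{i|w|²/4t}` is a free symbol at the
  -- time `s`
  set s : ℝ := -((4 * t) * (2 * Real.pi) ^ 2)⁻¹ with hs
  have hπ := Real.pi_pos.ne'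
  have hg : ∀ x, SchwartzMap.smulLeftCLM ℂ (freeSymbol s) ψ x = freeSymbol s x * ψ x := fun x => by
    rw [SchwartzMap.smulLeftCLM_apply_apply (hasTemperateGrowth_freeSymbol s), smul_eq_mul]
  refine ⟨SchwartzMap.smulLeftCLM ℂ (freeSymbol s) ψ, fun x => ?_, fun x => ?_⟩
  · rw [hg, norm_mul, norm_freeSymbol, one_mul]
  · rw [freeS_apply_eq_kernel ht, SchwartzMap.fourier_coe, Real.fourier_eq', norm_mul]
    have e : ∀ w : Plane, Complex.exp (-Real.pi ^ 2 * ‖x - w‖ ^ 2 /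
        (Complex.I * (t * (2 * Real.pi) ^ 2 : ℝ))) * ψ w =
        Complex.exp (((‖x‖ ^ 2 / (4 * t) : ℝ) : ℂ) * Complex.I) *
          (Complex.exp (((-2 * Real.pi * inner ℝ w ((4 * Real.pi * t)⁻¹ • x) : ℝ) : ℂ) * Complex.I) •
            (SchwartzMap.smulLeftCLM ℂ (freeSymbol s) ψ) w) := fun w => by
      rw [hg, smul_eq_mul, freeSymbol, ← mul_assoc, ← mul_assoc, ← Complex.exp_add,
        ← Complex.exp_add]
      congr 2
      have h1 : ((‖x - w‖ : ℝ) : ℂ) ^ 2 = ((‖x‖ ^ 2 - 2 * inner ℝ x w + ‖w‖ ^ 2 : ℝ) : ℂ) := by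
        rw [← norm_sub_sq_real]; push_cast; ring
      have ht' : (t : ℂ) ≠ 0 := Complex.ofReal_ne_zero.2 ht
      have hπ' : (Real.pi : ℂ) ≠ 0 := Complex.ofReal_ne_zero.2 hπ
      rw [h1, inner_smul_right, real_inner_comm x w, hs]
      push_cast
      field_simp
      ring_nf
      simp only [Complex.I_sq]
      ring
    simp only [e]
    rw [integral_const_mul, norm_mul, Complex.norm_exp_ofReal_mul_I, one_mul]
    congr 1
    rw [norm_div, norm_mul, Complex.norm_I, one_mul, Complex.norm_real, Complex.norm_real,
      Real.norm_eq_abs, Real.norm_eq_abs, abs_mul, abs_of_pos Real.pi_pos,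
      abs_of_pos (by positivity : (0 : ℝ) < (2 * Real.pi) ^ 2)]
    have := abs_pos.2 ht
    field_simp
    ring

/-- The dispersive estimate from `L^{4/3}` to `L⁴`. -/
theorem lintegral_freeS_pow_four_le {t : ℝ} (ht : t ≠ 0) (ψ : 𝓢(Plane, ℂ)) :
    ∫⁻ x, ‖freeS t ψ x‖ₑ ^ 4 ≤
      ENNReal.ofReal ((4 * Real.pi * |t|)⁻¹ ^ 2) * (∫⁻ x, ‖ψ x‖ₑ ^ (4 / 3 : ℝ)) ^ 3 := by
  obtain ⟨g, hg, h⟩ := exists_norm_freeS_eq ht ψ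
  have hge : ∀ x, ‖g x‖ₑ = ‖ψ x‖ₑ := fun x => by
    rw [← ofReal_norm, hg, ofReal_norm]
  set a : ℝ := 4 * Real.pi * |t| with ha
  have ha0 : 0 < a := by have := abs_pos.2 ht; have := Real.pi_pos; positivity
  have hr : (4 * Real.pi * t)⁻¹ ≠ 0 := by have := Real.pi_pos.ne'; positivity
  have hm : Measurable fun x : Plane => ‖(𝓕 g) x‖ₑ ^ 4 :=
    (𝓕 g).continuous.enorm.measurable.pow_const 4
  have h1 : ∀ x, ‖freeS t ψ x‖ₑ ^ 4 =
      ENNReal.ofReal (a⁻¹ ^ 4) * ‖(𝓕 g) ((4 * Real.pi * t)⁻¹ • x)‖ₑ ^ 4 := fun x => by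
    rw [← ofReal_norm, h x, ENNReal.ofReal_mul (by positivity), mul_pow,
      ENNReal.ofReal_pow (by positivity), ofReal_norm]
  have h2 : ∫⁻ x, ‖(𝓕 g) ((4 * Real.pi * t)⁻¹ • x)‖ₑ ^ 4 =
      ENNReal.ofReal (a ^ 2) * ∫⁻ x, ‖(𝓕 g) x‖ₑ ^ 4 := by
    have h3 := lintegral_map (μ := (volume : Measure Plane)) hm
      (measurable_const_smul (4 * Real.pi * t)⁻¹)
    rw [Measure.map_addHaar_smul _ hr, lintegral_smul_measure, smul_eq_mul] at h3
    rw [← h3]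
    congr 2
    rw [finrank_euclideanSpace_fin, inv_pow, inv_inv, abs_pow, abs_mul, abs_mul,
      abs_of_pos Real.pi_pos, ha]
    norm_num
  simp only [h1]
  have hm' : Measurable fun x : Plane => ‖(𝓕 g) ((4 * Real.pi * t)⁻¹ • x)‖ₑ ^ 4 :=
    hm.comp (measurable_const_smul _)
  rw [lintegral_const_mul _ hm', h2, ← mul_assoc,
    ← ENNReal.ofReal_mul (by positivity)]
  have e : a⁻¹ ^ 4 * a ^ 2 = a⁻¹ ^ 2 := by field_simp
  rw [e]
  gcongr
  refine (lintegral_fourier_pow_four_le g).trans_eq ?_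
  simp only [hge]

end

section

/-! ### Morrey's inequality -/

theorem enorm_le_add_lintegral_fderiv {E : Type*} [NormedAddCommGroup E] [NormedSpace ℝ E]
    {u : E → ℂ} (hu : ContDiff ℝ 1 u) (x : E) {v : E} (hv : ‖v‖ ≤ 1) :
    ‖u x‖ₑ ≤ ‖u (x + v)‖ₑ + ∫⁻ s in Ioc (0 : ℝ) 1, ‖fderiv ℝ u (x + s • v)‖ₑ := by
  have hd : ∀ s : ℝ, HasDerivAt (fun s : ℝ => u (x + s • v)) (fderiv ℝ u (x + s • v) v) s := by
    intro s
    have h1 : HasDerivAt (fun s : ℝ => x + s • v) v s := by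
      simpa using ((hasDerivAt_id s).smul_const v).const_add x
    exact ((hu.differentiable one_ne_zero) (x + s • v)).hasFDerivAt.comp_hasDerivAt s h1
  have hc : Continuous fun s : ℝ => fderiv ℝ u (x + s • v) v := by
    have := hu.continuous_fderiv one_ne_zero
    fun_prop
  have h1 := intervalIntegral.integral_eq_sub_of_hasDerivAt (a := 0) (b := 1)
    (fun s _ => hd s) (hc.intervalIntegrable 0 1)
  rw [one_smul, zero_smul, add_zero, intervalIntegral.integral_of_le zero_le_one] at h1
  have h2 : u x = u (x + v) - ∫ s in Ioc (0 : ℝ) 1, fderiv ℝ u (x + s • v) v := by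
    rw [h1]; ring
  rw [h2]
  refine enorm_sub_le.trans (add_le_add le_rfl ?_)
  refine (enorm_integral_le_lintegral_enorm _).trans (lintegral_mono fun s => ?_)
  rw [← ofReal_norm, ← ofReal_norm]
  exact ENNReal.ofReal_le_ofReal ((ContinuousLinearMap.le_opNorm _ _).trans
    (mul_le_of_le_one_right (norm_nonneg _) hv))

theorem lintegral_enorm_ball_le {E : Type*} [NormedAddCommGroup E] [MeasurableSpace E]
    [BorelSpace E] {F : Type*} [NormedAddCommGroup F] {f : E → F} {μ : Measure E}
    (hf : Continuous f) [SecondCountableTopologyEither E F] {p : ℝ≥0∞} (hp : 1 ≤ p) (B : Set E) :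
    ∫⁻ v in B, ‖f v‖ₑ ∂μ ≤ eLpNorm f p μ * μ B ^ (1 / (1 : ℝ≥0∞).toReal - 1 / p.toReal) := by
  have h := eLpNorm_le_eLpNorm_mul_rpow_measure_univ (μ := μ.restrict B) hp
    hf.aestronglyMeasurable
  rw [eLpNorm_one_eq_lintegral_enorm, Measure.restrict_apply_univ] at h
  exact h.trans (mul_le_mul' (eLpNorm_mono_measure _ Measure.restrict_le_self) le_rfl)

/-- Morrey's inequality in the plane. The identity `u(x) = u(x + v) - ∫₀¹ ∇u(x + s v) · v ds` is
averaged over the unit ball of vectors `v`; the average of `|∇u(x + s v)|` is at most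
`C s^{-1/2} ‖∇u‖₄`, which is integrable in `s`. -/
theorem exists_enorm_le_eLpNorm_fderiv {E : Type*} [NormedAddCommGroup E] [InnerProductSpace ℝ E]
    [FiniteDimensional ℝ E] [MeasurableSpace E] [BorelSpace E] (hE : Module.finrank ℝ E = 2) :
    ∃ K : ℝ≥0∞, K ≠ ∞ ∧ ∀ u : E → ℂ, ContDiff ℝ 1 u → ∀ x,
      ‖u x‖ₑ ≤ K * (eLpNorm u 2 volume + eLpNorm (fderiv ℝ u) 4 volume) := by
  set B := Metric.ball (0 : E) 1 with hB
  have hB0 : volume B ≠ 0 := (Metric.measure_ball_pos volume _ one_pos).ne'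
  have hB1 : volume B ≠ ∞ := measure_ball_lt_top.ne
  set A := ∫⁻ s in Ioc (0 : ℝ) 1, ENNReal.ofReal (s ^ (-(1 / 2) : ℝ)) with hA
  have hAf : A ≠ ∞ := by
    have h1 : IntegrableOn (fun s : ℝ => s ^ (-(1 / 2) : ℝ)) (Ioc 0 1) :=
      (intervalIntegrable_iff_integrableOn_Ioc_of_le zero_le_one).1
        (intervalIntegral.intervalIntegrable_rpow' (by norm_num))
    exact h1.lintegral_lt_top.ne
  set K₁ := volume B ^ (1 / (1 : ℝ≥0∞).toReal - 1 / (2 : ℝ≥0∞).toReal) with hK₁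
  set K₂ := volume B ^ (1 / (1 : ℝ≥0∞).toReal - 1 / (4 : ℝ≥0∞).toReal) with hK₂
  have hK₁f : K₁ ≠ ∞ := ENNReal.rpow_ne_top_of_nonneg (by norm_num) hB1
  have hK₂f : K₂ ≠ ∞ := ENNReal.rpow_ne_top_of_nonneg (by norm_num) hB1
  refine ⟨(volume B)⁻¹ * (K₁ + A * K₂), ENNReal.mul_ne_top (ENNReal.inv_ne_top.2 hB0)
    (ENNReal.add_ne_top.2 ⟨hK₁f, ENNReal.mul_ne_top hAf hK₂f⟩), fun u hu x => ?_⟩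
  have hc := hu.continuous
  have hcd := hu.continuous_fderiv one_ne_zero
  have h1 : ∫⁻ v in B, ‖u (x + v)‖ₑ ≤ eLpNorm u 2 volume * K₁ := by
    refine (lintegral_enorm_ball_le (f := fun v => u (x + v)) (by fun_prop)
      one_le_two B).trans_eq ?_
    rw [hK₁]
    congr 1
    exact eLpNorm_comp_measurePreserving hc.aestronglyMeasurable
      (measurePreserving_add_left volume x)
  have h2 : ∀ s : ℝ, 0 < s → ∫⁻ v in B, ‖fderiv ℝ u (x + s • v)‖ₑ ≤
      ENNReal.ofReal (s ^ (-(1 / 2) : ℝ)) * (eLpNorm (fderiv ℝ u) 4 volume * K₂) := by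
    intro s hs
    refine (lintegral_enorm_ball_le (f := fun v => fderiv ℝ u (x + s • v)) (by fun_prop)
      (p := 4) (by norm_num) B).trans_eq ?_
    rw [← mul_assoc]
    congr 1
    refine (ENNReal.pow_right_strictMono (n := 4) (by norm_num)).injective ?_
    have hm : Measurable fun y : E => (‖fderiv ℝ u (x + y)‖ₑ ^ 2) ^ 2 :=
      ((hcd.comp (continuous_const.add continuous_id)).enorm.measurable.pow_const 2).pow_const 2
    have h3 := lintegral_map (μ := (volume : Measure E)) hm (measurable_const_smul s)
    rw [Measure.map_addHaar_smul _ hs.ne', lintegral_smul_measure, smul_eq_mul,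
      lintegral_add_left_eq_self (fun y => (‖fderiv ℝ u y‖ₑ ^ 2) ^ 2) x] at h3
    simp only [mul_pow]
    rw [eLpNorm_four_pow, eLpNorm_four_pow, ← h3]
    congr 1
    have h5 : (s ^ (-(1 / 2) : ℝ)) ^ 4 = |(s ^ 2)⁻¹| := by
      rw [abs_of_nonneg (by positivity), ← Real.rpow_natCast (s ^ _), ← Real.rpow_mul hs.le,
        ← Real.rpow_natCast s 2, ← Real.rpow_neg hs.le]
      norm_num
    rw [hE, ← ENNReal.ofReal_pow (by positivity), h5]
  have h4 : ‖u x‖ₑ * volume B ≤ ∫⁻ v in B, (‖u (x + v)‖ₑ +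
      ∫⁻ s in Ioc (0 : ℝ) 1, ‖fderiv ℝ u (x + s • v)‖ₑ) := by
    rw [← setLIntegral_const]
    refine setLIntegral_mono' measurableSet_ball fun v hv => ?_
    exact enorm_le_add_lintegral_fderiv hu x (mem_ball_zero_iff.1 hv).le
  have hmm : Measurable fun p : E × ℝ => ‖fderiv ℝ u (x + p.2 • p.1)‖ₑ :=
    (hcd.comp (continuous_const.add (continuous_snd.smul continuous_fst))).enorm.measurable
  have hmu : Measurable fun v : E => ‖u (x + v)‖ₑ :=
    (hc.comp (continuous_const.add continuous_id)).enorm.measurable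
  rw [lintegral_add_left hmu, lintegral_lintegral_swap hmm.aemeasurable] at h4
  have h5 : ∫⁻ s in Ioc (0 : ℝ) 1, ∫⁻ v in B, ‖fderiv ℝ u (x + s • v)‖ₑ ≤
      A * (eLpNorm (fderiv ℝ u) 4 volume * K₂) := by
    rw [hA, ← lintegral_mul_const'' _ (by fun_prop)]
    exact setLIntegral_mono' measurableSet_Ioc fun s hs => h2 s hs.1
  have h6 : ‖u x‖ₑ * volume B ≤
      (K₁ + A * K₂) * (eLpNorm u 2 volume + eLpNorm (fderiv ℝ u) 4 volume) := by
    refine (h4.trans (add_le_add h1 h5)).trans ?_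
    rw [add_mul, mul_add, mul_add]
    refine add_le_add ((mul_comm _ _).le.trans (le_add_right le_rfl)) ?_
    refine le_trans (le_of_eq ?_) (le_add_left le_rfl)
    ring
  calc ‖u x‖ₑ = (volume B)⁻¹ * (‖u x‖ₑ * volume B) := by
        rw [mul_comm ‖u x‖ₑ, ← mul_assoc, ENNReal.inv_mul_cancel hB0 hB1, one_mul]
    _ ≤ _ := by
        rw [mul_assoc]
        gcongr

end

section

/-! ### Pairing the force with free waves -/

instance holderTriple_four_two : ENNReal.HolderTriple 4 2 (4 / 3) where
  inv_add_inv_eq_inv := by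
    rw [ENNReal.inv_div (by simp) (by simp)]
    refine (ENNReal.toReal_eq_toReal_iff' (by simp) ?_).1 ?_
    · exact ENNReal.div_ne_top (by simp) (by simp)
    · rw [ENNReal.toReal_add (by simp) (by simp), ENNReal.toReal_div, ENNReal.toReal_inv,
        ENNReal.toReal_inv]
      norm_num

theorem four_thirds_ne_top : (4 / 3 : ℝ≥0∞) ≠ ∞ := ENNReal.div_ne_top (by simp) (by simp)

theorem one_le_four_thirds : (1 : ℝ≥0∞) ≤ 4 / 3 := by
  rw [ENNReal.le_div_iff_mul_le (by simp) (by simp)]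
  norm_num

theorem lintegral_four_thirds_pow (f : Plane → ℂ) :
    (∫⁻ x, ‖f x‖ₑ ^ (4 / 3 : ℝ)) ^ 3 = eLpNorm f (4 / 3) volume ^ 4 := by
  have h0 : (4 / 3 : ℝ≥0∞) ≠ 0 := (zero_lt_one.trans_le one_le_four_thirds).ne'
  have h1 : (4 / 3 : ℝ≥0∞).toReal = 4 / 3 := by
    rw [ENNReal.toReal_div]
    norm_num
  rw [eLpNorm_eq_lintegral_rpow_enorm_toReal h0 four_thirds_ne_top, h1, ← ENNReal.rpow_natCast,
    ← ENNReal.rpow_natCast, ← ENNReal.rpow_mul]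
  norm_num

theorem eLpNorm_freeS_four_le {t : ℝ} (ht : t ≠ 0) (ψ : 𝓢(Plane, ℂ)) :
    eLpNorm (freeS t ψ) 4 volume ≤
      ENNReal.ofReal (|t| ^ (-(1 / 2) : ℝ)) * eLpNorm ψ (4 / 3) volume := by
  have ht0 := abs_pos.2 ht
  refine (ENNReal.pow_le_pow_left_iff (n := 4) (by norm_num)).1 ?_
  rw [mul_pow, ← lintegral_four_thirds_pow, eLpNorm_four_pow]
  have h := lintegral_freeS_pow_four_le ht ψ
  have e : ∀ x, ‖freeS t ψ x‖ₑ ^ 4 = (‖freeS t ψ x‖ₑ ^ 2) ^ 2 := fun x => by rw [← pow_mul]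
  simp only [e] at h
  refine h.trans (mul_le_mul' ?_ le_rfl)
  rw [← ENNReal.ofReal_pow (by positivity)]
  refine ENNReal.ofReal_le_ofReal ?_
  have h1 : (|t| ^ (-(1 / 2) : ℝ)) ^ 4 = |t|⁻¹ ^ 2 := by
    rw [← Real.rpow_natCast (|t| ^ _), ← Real.rpow_mul ht0.le, inv_pow, ← Real.rpow_natCast |t| 2,
      ← Real.rpow_neg ht0.le]
    norm_num
  rw [h1]
  have h2 : 1 ≤ 4 * Real.pi := by have := Real.pi_gt_three; linarith
  gcongr
  exact le_mul_of_one_le_left ht0.le h2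

/-- The free group is moved to `F`, and `e^{-isΔ} F` is bounded in `L^∞` by Morrey's inequality and
the dispersive estimate for its gradient. -/
theorem exists_norm_inner_freeS_le : ∃ K : ℝ, 0 ≤ K ∧ ∀ (F ψ : 𝓢(Plane, ℂ)) (s A D : ℝ), s ≠ 0 →
    0 ≤ A → 0 ≤ D → ‖toL2 F‖ ≤ A →
    (∀ j, eLpNorm (∂_{e j} F : 𝓢(Plane, ℂ)) (4 / 3) volume ≤ ENNReal.ofReal D) →
    ‖inner ℂ (toL2 (freeS s ψ)) (toL2 F)‖ ≤
      K * (A + |s| ^ (-(1 / 2) : ℝ) * D) * ∫ x, ‖ψ x‖ := by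
  obtain ⟨K, hK, hM⟩ := exists_enorm_le_eLpNorm_fderiv (E := Plane) (by simp)
  refine ⟨2 * K.toReal, by positivity, fun F ψ s A D hs hA hD hFA hFD => ?_⟩
  set G := freeS (-s) F with hG
  have hs' : -s ≠ 0 := neg_ne_zero.2 hs
  have hd : ∀ j, eLpNorm (∂_{e j} G : 𝓢(Plane, ℂ)) 4 volume ≤
      ENNReal.ofReal (|s| ^ (-(1 / 2) : ℝ) * D) :=
    fun j => by
      rw [hG, lineDeriv_freeS, ENNReal.ofReal_mul (by positivity)]
      refine (eLpNorm_freeS_four_le hs' _).trans ?_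
      rw [abs_neg]
      exact mul_le_mul' le_rfl (hFD j)
  have hG2 : eLpNorm G 2 volume ≤ ENNReal.ofReal A := by
    have h1 : eLpNorm G 2 volume = eLpNorm (toL2 G) 2 volume :=
      (eLpNorm_congr_ae (G.coeFn_toLp 2 volume)).symm
    rw [h1, ENNReal.le_ofReal_iff_toReal_le (Lp.eLpNorm_ne_top _) hA, ← Lp.norm_def, hG,
      norm_toL2_freeS]
    exact hFA
  have hG4 : eLpNorm (fderiv ℝ G) 4 volume ≤
      ENNReal.ofReal (|s| ^ (-(1 / 2) : ℝ) * D + |s| ^ (-(1 / 2) : ℝ) * D) := by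
    rw [ENNReal.ofReal_add (by positivity) (by positivity)]
    have c : ∀ j, AEStronglyMeasurable (fun x => ‖(∂_{e j} G) x‖) (volume : Measure Plane) :=
      fun j => (∂_{e j} G).continuous.norm.aestronglyMeasurable
    have h1 : eLpNorm (fderiv ℝ G) 4 volume ≤
        eLpNorm ((fun x => ‖(∂_{e 0} G) x‖) + fun x => ‖(∂_{e 1} G) x‖) 4 volume := by
      refine eLpNorm_mono_real fun x => ?_
      exact norm_fderiv_le G x
    refine h1.trans ((eLpNorm_add_le (c 0) (c 1) (by norm_num)).trans (add_le_add ?_ ?_))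
    · rw [eLpNorm_norm]; exact hd 0
    · rw [eLpNorm_norm]; exact hd 1
  have hsup : ∀ x, ‖G x‖ ≤ 2 * K.toReal * (A + |s| ^ (-(1 / 2) : ℝ) * D) := fun x => by
    have h1 := hM G (G.smooth 1) x
    have h2 : ‖G x‖ₑ ≤ ENNReal.ofReal (2 * K.toReal * (A + |s| ^ (-(1 / 2) : ℝ) * D)) := by
      refine (h1.trans (mul_le_mul' le_rfl (add_le_add hG2 hG4))).trans ?_
      rw [← ENNReal.ofReal_toReal hK, ← ENNReal.ofReal_add hA (by positivity),
        ← ENNReal.ofReal_mul (by positivity), ENNReal.toReal_ofReal (by positivity)]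
      refine ENNReal.ofReal_le_ofReal ?_
      have := mul_nonneg (ENNReal.toReal_nonneg (a := K)) hA
      nlinarith
    rw [← ofReal_norm] at h2
    exact (ENNReal.ofReal_le_ofReal_iff (by positivity)).1 h2
  have hin : inner ℂ (toL2 (freeS s ψ)) (toL2 F) = inner ℂ (toL2 ψ) (toL2 G) := by
    rw [hG, inner_toL2_freeS_right, neg_neg]
  rw [hin, inner_toL2]
  have hae : (∫ x, (starRingEnd ℂ) (ψ x) * toL2 G x) = ∫ x, (starRingEnd ℂ) (ψ x) * G x := by
    refine integral_congr_ae ?_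
    filter_upwards [G.coeFn_toLp 2 volume] with x hx
    rw [hx]
  rw [hae, ← integral_const_mul]
  refine norm_integral_le_of_norm_le (ψ.integrable.norm.const_mul _)
    (Eventually.of_forall fun x => ?_)
  rw [norm_mul, RCLike.norm_conj, mul_comm]
  exact mul_le_mul_of_nonneg_right (hsup x) (norm_nonneg _)

variable {V : Plane → ℝ} {β : ℝ → ℝ} {C : ℝ} {n : ℕ}

/-- The force of a Schwartz function is a Schwartz function. -/
theorem ForceBounds.exists_schwartz_force (h : ForceBounds V β C n) (ψ : 𝓢(Plane, ℂ)) :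
    ∃ F : 𝓢(Plane, ℂ), ∀ x, F x = force V β x (ψ x) := by
  obtain ⟨W, hW⟩ := h.schwartz
  obtain ⟨M, hM⟩ := ψ.decay 0 0
  have hM' : ∀ x, ‖ψ x‖ ≤ M := fun x => by simpa using hM.2 x
  -- `β` may be changed outside the range of `|ψ|²`, to have compact support
  let χ : ContDiffBump (0 : ℝ) := ⟨M ^ 2 + 1, M ^ 2 + 2, by positivity, by linarith⟩
  have hβ : (fun s => χ s * β s).HasTemperateGrowth :=
    HasCompactSupport.hasTemperateGrowth (χ.hasCompactSupport.mul_right)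
      (χ.contDiff.mul h.smooth)
  have hψ : (fun x => ‖ψ x‖ ^ 2).HasTemperateGrowth := by
    have h1 : (fun z : ℂ => ‖z‖ ^ 2).HasTemperateGrowth := by fun_prop
    exact h1.comp ψ.hasTemperateGrowth
  have hg : (fun x => W x + χ (‖ψ x‖ ^ 2) * β (‖ψ x‖ ^ 2)).HasTemperateGrowth :=
    W.hasTemperateGrowth.add (hβ.comp hψ)
  refine ⟨SchwartzMap.smulLeftCLM ℂ (fun x => W x + χ (‖ψ x‖ ^ 2) * β (‖ψ x‖ ^ 2)) ψ, fun x => ?_⟩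
  have h1 : χ (‖ψ x‖ ^ 2) = 1 := by
    refine χ.one_of_mem_closedBall ?_
    rw [mem_closedBall_zero_iff, Real.norm_of_nonneg (sq_nonneg _)]
    change ‖ψ x‖ ^ 2 ≤ M ^ 2 + 1
    have := pow_le_pow_left₀ (norm_nonneg _) (hM' x) 2
    linarith
  rw [SchwartzMap.smulLeftCLM_apply_apply hg, h1, one_mul, force, ← hW, Complex.real_smul]

theorem tendsto_slope_lineDeriv {F : Type*} [NormedAddCommGroup F] [NormedSpace ℝ F]
    (ψ : 𝓢(Plane, F)) (m x : Plane) :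
    Tendsto (fun t : ℝ => t⁻¹ • (ψ (x + t • m) - ψ x)) (𝓝[≠] 0) (𝓝 ((∂_{m} ψ) x)) := by
  have h : HasLineDerivAt ℝ ψ ((∂_{m} ψ) x) x m := by
    rw [SchwartzMap.lineDerivOp_apply]
    exact (ψ.differentiable x).lineDifferentiableAt.hasLineDerivAt
  simpa using h.tendsto_slope_zero

/-- The pointwise chain rule bound for the force of a Schwartz function. -/
theorem ForceBounds.norm_lineDeriv_le (h : ForceBounds V β C n) {W : 𝓢(Plane, ℝ)} (hW : ⇑W = V)
    {ψ F : 𝓢(Plane, ℂ)} (hF : ∀ x, F x = force V β x (ψ x)) (m x : Plane) :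
    ‖(∂_{m} F) x‖ ≤ ‖(∂_{m} W) x‖ * ‖ψ x‖ + C * (‖(∂_{m} ψ) x‖ * weight V n ψ ψ x) := by
  have hline : Tendsto (fun t : ℝ => ψ (x + t • m)) (𝓝[≠] 0) (𝓝 (ψ x)) := by
    have hc : Continuous fun t : ℝ => ψ (x + t • m) := by
      have := ψ.continuous
      fun_prop
    have := hc.tendsto 0
    rw [zero_smul, add_zero] at this
    exact this.mono_left nhdsWithin_le_nhds
  have hlim : Tendsto (fun t : ℝ => ‖t⁻¹ • (W (x + t • m) - W x)‖ * ‖ψ (x + t • m)‖ +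
      C * (‖t⁻¹ • (ψ (x + t • m) - ψ x)‖ * (|V x| + growthWeight n (ψ (x + t • m)) (ψ x))))
      (𝓝[≠] 0) (𝓝 (‖(∂_{m} W) x‖ * ‖ψ x‖ + C * (‖(∂_{m} ψ) x‖ * weight V n ψ ψ x))) := by
    refine ((tendsto_slope_lineDeriv W m x).norm.mul hline.norm).add
      (tendsto_const_nhds.mul ((tendsto_slope_lineDeriv ψ m x).norm.mul
        (tendsto_const_nhds.add ?_)))
    unfold growthWeight
    exact ((hline.norm.add tendsto_const_nhds).add (hline.norm.pow n)).add tendsto_const_nhds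
  refine le_of_tendsto_of_tendsto (tendsto_slope_lineDeriv F m x).norm hlim
    (Eventually.of_forall fun t => ?_)
  have e : F (x + t • m) - F x = ((W (x + t • m) - W x : ℝ) : ℂ) * ψ (x + t • m) +
      (force V β x (ψ (x + t • m)) - force V β x (ψ x)) := by
    rw [hF, hF, hW]
    simp only [force]
    push_cast
    ring
  simp only
  rw [e, smul_add, norm_smul, norm_smul]
  refine (norm_add_le _ _).trans ?_
  rw [norm_smul, norm_smul, norm_mul, Complex.norm_real, ← mul_assoc]
  refine add_le_add le_rfl ?_
  calc ‖t⁻¹‖ * ‖force V β x (ψ (x + t • m)) - force V β x (ψ x)‖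
      ≤ ‖t⁻¹‖ * (C * (‖ψ (x + t • m) - ψ x‖ *
        (|V x| + growthWeight n (ψ (x + t • m)) (ψ x)))) := by
        gcongr
        exact h.lipschitz x _ _
    _ = _ := by ring

/-- The gradient of the force is bounded in `L^{4/3}` on bounded sets of `H¹`. -/
theorem ForceBounds.exists_eLpNorm_lineDeriv_le (h : ForceBounds V β C n) (R : ℝ) :
    ∃ D : ℝ, 0 ≤ D ∧ ∀ ψ F : 𝓢(Plane, ℂ), ‖H1.ofSchwartz ψ‖ ≤ R →
      (∀ x, F x = force V β x (ψ x)) → ∀ j,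
      eLpNorm (∂_{e j} F : 𝓢(Plane, ℂ)) (4 / 3) volume ≤ ENNReal.ofReal D := by
  obtain ⟨W, hW⟩ := h.schwartz
  obtain ⟨K, hK, hw⟩ := h.exists_eLpNorm_weight_le R
  have hC := h.nonneg
  set A := ∑ j, (eLpNorm (∂_{e j} W : 𝓢(Plane, ℝ)) 4 volume).toReal with hA
  have hA0 : 0 ≤ A := Finset.sum_nonneg fun _ _ => ENNReal.toReal_nonneg
  refine ⟨A * |R| + C * (K * |R|), by positivity, fun ψ F hψ hF j => ?_⟩
  have hR := hψ.trans (le_abs_self R)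
  have hWj : eLpNorm (fun x => ‖(∂_{e j} W) x‖) 4 volume ≤ ENNReal.ofReal A := by
    rw [eLpNorm_norm, ENNReal.le_ofReal_iff_toReal_le ((∂_{e j} W).memLp 4 volume).2.ne hA0]
    exact Finset.single_le_sum (f := fun j => (eLpNorm (∂_{e j} W : 𝓢(Plane, ℝ)) 4 volume).toReal)
      (fun _ _ => ENNReal.toReal_nonneg) (Finset.mem_univ j)
  have h2 : ∀ η : 𝓢(Plane, ℂ), ‖toL2 η‖ ≤ |R| →
      eLpNorm (fun x => ‖η x‖) 2 volume ≤ ENNReal.ofReal |R| := fun η hη => by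
    rw [eLpNorm_norm]
    have h1 : eLpNorm η 2 volume = eLpNorm (toL2 η) 2 volume :=
      (eLpNorm_congr_ae (η.coeFn_toLp 2 volume)).symm
    rw [h1, ENNReal.le_ofReal_iff_toReal_le (Lp.eLpNorm_ne_top _) (abs_nonneg R), ← Lp.norm_def]
    exact hη
  have hψ2 := h2 ψ (by
    rw [← H1.fn_ofSchwartz]
    exact (H1.norm_fn_le _).trans hR)
  have hψj := h2 (∂_{e j} ψ) (by
    rw [← H1.partialDeriv_ofSchwartz]
    exact (H1.norm_partialDeriv_le _ j).trans hR)
  have hwt : eLpNorm (weight V n ψ ψ) 4 volume ≤ ENNReal.ofReal K := by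
    refine le_of_eq_of_le (eLpNorm_congr_ae ?_) (hw _ _ hψ hψ)
    rw [H1.fn_ofSchwartz]
    filter_upwards [ψ.coeFn_toLp 2 volume] with x hx
    rw [weight, weight, hx]
  have mψ : ∀ η : 𝓢(Plane, ℂ), AEStronglyMeasurable (fun x => ‖η x‖) (volume : Measure Plane) :=
    fun η => η.continuous.norm.aestronglyMeasurable
  have mW : AEStronglyMeasurable (fun x => ‖(∂_{e j} W) x‖) (volume : Measure Plane) :=
    (∂_{e j} W).continuous.norm.aestronglyMeasurable
  have mwt : AEStronglyMeasurable (weight V n ψ ψ) volume :=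
    h.aestronglyMeasurable_weight ψ.continuous.aestronglyMeasurable
      ψ.continuous.aestronglyMeasurable
  have b1 : eLpNorm ((fun x => ‖(∂_{e j} W) x‖) • fun x => ‖ψ x‖) (4 / 3) volume ≤
      ENNReal.ofReal A * ENNReal.ofReal |R| :=
    (eLpNorm_smul_le_mul_eLpNorm (p := 4) (q := 2) (mψ ψ) mW).trans (mul_le_mul' hWj hψ2)
  have b2 : eLpNorm (weight V n ψ ψ • fun x => ‖(∂_{e j} ψ) x‖) (4 / 3) volume ≤
      ENNReal.ofReal K * ENNReal.ofReal |R| :=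
    (eLpNorm_smul_le_mul_eLpNorm (p := 4) (q := 2) (mψ _) mwt).trans (mul_le_mul' hwt hψj)
  have b3 : eLpNorm (∂_{e j} F : 𝓢(Plane, ℂ)) (4 / 3) volume ≤
      eLpNorm (((fun x => ‖(∂_{e j} W) x‖) • fun x => ‖ψ x‖) +
        C • (weight V n ψ ψ • fun x => ‖(∂_{e j} ψ) x‖)) (4 / 3) volume := by
    refine eLpNorm_mono_real fun x => ?_
    refine (h.norm_lineDeriv_le hW hF (e j) x).trans_eq ?_
    change _ = ‖(∂_{e j} W) x‖ * ‖ψ x‖ + C * (weight V n ψ ψ x * ‖(∂_{e j} ψ) x‖)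
    ring
  refine b3.trans ((eLpNorm_add_le (mW.smul (mψ ψ)) ((mwt.smul (mψ _)).const_smul C)
    one_le_four_thirds).trans ?_)
  rw [eLpNorm_const_smul, ENNReal.ofReal_add (by positivity) (by positivity),
    ENNReal.ofReal_mul hA0, ENNReal.ofReal_mul hC, ENNReal.ofReal_mul hK,
    Real.enorm_of_nonneg hC]
  gcongr

theorem ForceBounds.toL2_eq_nl (h : ForceBounds V β C n) {ψ F : 𝓢(Plane, ℂ)}
    (hF : ∀ x, F x = force V β x (ψ x)) : toL2 F = nl V β (H1.ofSchwartz ψ).fn := by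
  refine Lp.ext ?_
  filter_upwards [F.coeFn_toLp 2 volume, coeFn_nl (h.memLp_force (H1.ofSchwartz ψ)),
    ψ.coeFn_toLp 2 volume] with x h1 h2 h3
  rw [h1, h2, H1.fn_ofSchwartz, h3, hF]

/-- Pairing of the force of an `H¹` function with a free wave: the singularity at time `0` is
integrable. -/
theorem ForceBounds.exists_norm_inner_freeS_nl_le (h : ForceBounds V β C n) (R : ℝ) :
    ∃ K : ℝ, 0 ≤ K ∧ ∀ (v : H1) (ψ : 𝓢(Plane, ℂ)) (s : ℝ), ‖v‖ ≤ R → s ≠ 0 →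
      ‖inner ℂ (toL2 (freeS s ψ)) (nl V β v.fn)‖ ≤
        K * (1 + |s| ^ (-(1 / 2) : ℝ)) * ∫ x, ‖ψ x‖ := by
  obtain ⟨K, hK, hb⟩ := exists_norm_inner_freeS_le
  obtain ⟨D, hD, hd⟩ := h.exists_eLpNorm_lineDeriv_le (R + 1)
  obtain ⟨L, hL, hl⟩ := h.exists_norm_nl_sub_le (|R| + 1)
  have hnl0 : nl V β (0 : H1).fn = 0 := by
    refine Lp.ext ?_
    filter_upwards [coeFn_nl (h.memLp_force 0), Lp.coeFn_zero ℂ 2 (volume : Measure Plane)]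
      with x h1 h2
    have : (0 : H1).fn = 0 := rfl
    rw [this] at h1 ⊢
    rw [h1, h2, Pi.zero_apply, force_zero]
  refine ⟨K * (L * (|R| + 1) + D), by positivity, fun v ψ s hv hs => ?_⟩
  obtain ⟨u, hu⟩ := H1.exists_schwartz_seq v
  have hev : ∀ᶠ k in atTop, ‖v - H1.ofSchwartz (u k)‖ < 1 :=
    hu.eventually (gt_mem_nhds one_pos)
  have hun : ∀ᶠ k in atTop, ‖H1.ofSchwartz (u k)‖ ≤ R + 1 := by
    filter_upwards [hev] with k hk
    have h1 : H1.ofSchwartz (u k) = v - (v - H1.ofSchwartz (u k)) := by abel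
    rw [h1]
    exact (norm_sub_le _ _).trans (add_le_add hv hk.le)
  have hRR : R + 1 ≤ |R| + 1 := by linarith [le_abs_self R]
  choose F hF using fun k => h.exists_schwartz_force (u k)
  have hlim : Tendsto (fun k => toL2 (F k)) atTop (𝓝 (nl V β v.fn)) := by
    rw [tendsto_iff_norm_sub_tendsto_zero]
    refine squeeze_zero' (Eventually.of_forall fun _ => norm_nonneg _) ?_
      (by simpa using hu.const_mul L)
    filter_upwards [hun] with k hk
    rw [h.toL2_eq_nl (hF k), norm_sub_rev]
    exact hl _ _ (by linarith) (hk.trans hRR)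
  have hlim2 : Tendsto (fun k => ‖inner ℂ (toL2 (freeS s ψ)) (toL2 (F k))‖) atTop
      (𝓝 ‖inner ℂ (toL2 (freeS s ψ)) (nl V β v.fn)‖) :=
    (tendsto_const_nhds.inner hlim).norm
  refine le_of_tendsto hlim2 ?_
  filter_upwards [hun] with k hk
  have hFk : ‖toL2 (F k)‖ ≤ L * (|R| + 1) := by
    have h1 := hl (H1.ofSchwartz (u k)) 0 (hk.trans hRR) (by rw [norm_zero]; positivity)
    rw [hnl0, sub_zero, sub_zero, ← h.toL2_eq_nl (hF k)] at h1
    exact h1.trans (by gcongr; exact hk.trans hRR)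
  refine (hb (F k) ψ s (L * (|R| + 1)) D hs (by positivity) hD hFk
    (hd (u k) (F k) hk (hF k))).trans ?_
  have h1 : 0 ≤ ∫ x, ‖ψ x‖ := integral_nonneg fun _ => norm_nonneg _
  refine mul_le_mul_of_nonneg_right ?_ h1
  rw [mul_assoc]
  refine mul_le_mul_of_nonneg_left ?_ hK
  have h2 : 0 ≤ |s| ^ (-(1 / 2) : ℝ) := by positivity
  have h3 : 0 ≤ L * (|R| + 1) := by positivity
  nlinarith [mul_nonneg h2 h3]

end

section

/-! ### Bounds in `L^∞` by duality with `L¹` -/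

/-- A smooth bump function as a complex Schwartz function. -/
def bumpS {x : Plane} (χ : ContDiffBump x) : 𝓢(Plane, ℂ) :=
  HasCompactSupport.toSchwartzMap (f := fun y => (χ y : ℂ))
    (χ.hasCompactSupport.comp_left (g := fun r : ℝ => (r : ℂ)) Complex.ofReal_zero)
    (Complex.ofRealCLM.contDiff.comp χ.contDiff)

theorem bumpS_apply {x : Plane} (χ : ContDiffBump x) (y : Plane) : bumpS χ y = (χ y : ℂ) := rfl

/-- Bump functions that equal `1` on the closed ball of radius `r` and decrease to its indicator. -/
def ballBump (x : Plane) {r : ℝ} (hr : 0 < r) (k : ℕ) : ContDiffBump x :=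
  ⟨r, r + 1 / ((k : ℝ) + 1), hr, lt_add_of_pos_right r (by positivity)⟩

theorem tendsto_integral_ballBump {F : Type*} [NormedAddCommGroup F] [NormedSpace ℝ F]
    {g : Plane → F} (hg : LocallyIntegrable g volume) (x : Plane) {r : ℝ} (hr : 0 < r) :
    Tendsto (fun k => ∫ y, (ballBump x hr k y) • g y) atTop
      (𝓝 (∫ y in Metric.closedBall x r, g y)) := by
  rw [← integral_indicator Metric.isClosed_closedBall.measurableSet]
  have hint : Integrable ((Metric.closedBall x (r + 1)).indicator fun y => ‖g y‖) := by
    rw [integrable_indicator_iff Metric.isClosed_closedBall.measurableSet]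
    exact (hg.integrableOn_isCompact (isCompact_closedBall x (r + 1))).norm
  refine tendsto_integral_of_dominated_convergence _ (fun k => ?_) hint (fun k => ?_) ?_
  · exact (ballBump x hr k).continuous.aestronglyMeasurable.smul hg.aestronglyMeasurable
  · refine Eventually.of_forall fun y => ?_
    rw [norm_smul, Real.norm_of_nonneg (ballBump x hr k).nonneg]
    by_cases hy : y ∈ Metric.closedBall x (r + 1)
    · rw [indicator_of_mem hy]
      exact mul_le_of_le_one_left (norm_nonneg _) (ballBump x hr k).le_one
    · rw [indicator_of_notMem hy, (ballBump x hr k).zero_of_le_dist, zero_mul]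
      rw [Metric.mem_closedBall, not_le] at hy
      refine le_trans ?_ hy.le
      change r + 1 / ((k : ℝ) + 1) ≤ r + 1
      have : 1 / ((k : ℝ) + 1) ≤ 1 := by
        rw [div_le_one (by positivity)]
        have := k.cast_nonneg (α := ℝ)
        linarith
      linarith
  · refine Eventually.of_forall fun y => ?_
    by_cases hy : y ∈ Metric.closedBall x r
    · rw [indicator_of_mem hy]
      refine tendsto_const_nhds.congr fun k => ?_
      rw [(ballBump x hr k).one_of_mem_closedBall hy, one_smul]
    · rw [indicator_of_notMem hy]
      rw [Metric.mem_closedBall, not_le] at hy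
      refine tendsto_const_nhds.congr' ?_
      have h1 : ∀ᶠ k : ℕ in atTop, 1 / ((k : ℝ) + 1) < dist y x - r :=
        (tendsto_one_div_add_atTop_nhds_zero_nat (𝕜 := ℝ)).eventually
          (gt_mem_nhds (sub_pos.2 hy))
      filter_upwards [h1] with k hk
      rw [(ballBump x hr k).zero_of_le_dist, zero_smul]
      change r + 1 / ((k : ℝ) + 1) ≤ dist y x
      linarith

/-- A functional bound by the `L¹` norm is a pointwise bound. -/
theorem ae_norm_le_of_inner_le {f : L2} {M : ℝ}
    (h : ∀ ψ, ‖inner ℂ (toL2 ψ) f‖ ≤ M * ∫ x, ‖ψ x‖) : ∀ᵐ x, ‖f x‖ ≤ M := by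
  have hf : LocallyIntegrable f volume := (Lp.memLp f).locallyIntegrable one_le_two
  have hball : ∀ (x : Plane) (r : ℝ), 0 < r → ‖∫ y in Metric.closedBall x r, f y‖ ≤
      M * volume.real (Metric.closedBall x r) := by
    intro x r hr
    have h1 := tendsto_integral_ballBump hf x hr
    have h2 := tendsto_integral_ballBump (g := fun _ : Plane => (1 : ℝ))
      (locallyIntegrable_const 1) x hr
    rw [setIntegral_const, smul_eq_mul, mul_one] at h2
    refine le_of_tendsto_of_tendsto h1.norm (h2.const_mul M) (Eventually.of_forall fun k => ?_)
    have h3 := h (bumpS (ballBump x hr k))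
    rw [inner_toL2] at h3
    simp only [bumpS_apply, Complex.conj_ofReal, Complex.norm_real,
      Real.norm_of_nonneg (ballBump x hr k).nonneg] at h3
    simpa using h3
  filter_upwards [IsUnifLocDoublingMeasure.ae_tendsto_average volume hf 1] with x hx
  have hδ : Tendsto (fun k : ℕ => 1 / ((k : ℝ) + 1)) atTop (𝓝[>] 0) :=
    tendsto_nhdsWithin_iff.2 ⟨tendsto_one_div_add_atTop_nhds_zero_nat,
      Eventually.of_forall fun k => by
        have : (0 : ℝ) < 1 / ((k : ℝ) + 1) := by positivity
        exact this⟩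
  have hlim := hx (fun _ => x) (fun k : ℕ => 1 / ((k : ℝ) + 1)) hδ
    (Eventually.of_forall fun k => Metric.mem_closedBall_self (by positivity))
  refine le_of_tendsto hlim.norm (Eventually.of_forall fun k => ?_)
  have hk : (0 : ℝ) < 1 / ((k : ℝ) + 1) := by positivity
  have hv : 0 < volume.real (Metric.closedBall x (1 / ((k : ℝ) + 1))) :=
    ENNReal.toReal_pos (Metric.measure_closedBall_pos volume x hk).ne'
      measure_closedBall_lt_top.ne
  rw [setAverage_eq, norm_smul, norm_inv, Real.norm_of_nonneg hv.le, inv_mul_le_iff₀ hv, mul_comm]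
  exact hball x _ hk

/-! ### The equation tested against Schwartz functions and free waves -/

variable {V : Plane → ℝ} {β : ℝ → ℝ} {C : ℝ} {n : ℕ}

theorem integrable_mul_schwartz (f : L2) (η : 𝓢(Plane, ℂ)) :
    Integrable fun x => f x * η x :=
  (Lp.memLp f).integrable_mul (η.memLp 2 volume)

/-- The equation in terms of the inner product of `L²`. -/
theorem IsSolution.hasDerivWithinAt_inner (h : ForceBounds V β C n) {u : ℝ → H1}
    (hu : IsSolution V β u) (ψ : 𝓢(Plane, ℂ)) {t : ℝ} (ht : 0 ≤ t) :
    HasDerivWithinAt (fun s => inner ℂ (toL2 ψ) (u s).fn)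
      (-Complex.I * (-inner ℂ (toL2 (Δ ψ)) (u t).fn + inner ℂ (toL2 ψ) (nl V β (u t).fn)))
      (Ici 0) t := by
  have h1 := (hu.equation (conjS ψ) t ht).const_mul (-Complex.I)
  simp only [integral_mul_schwartz, conjS_conjS] at h1
  have e1 : ∀ s, -Complex.I * (Complex.I * inner ℂ (toL2 ψ) (u s).fn) =
      inner ℂ (toL2 ψ) (u s).fn := fun s => by
    rw [← mul_assoc, neg_mul, Complex.I_mul_I, neg_neg, one_mul]
  simp only [e1] at h1
  refine h1.congr_deriv ?_
  congr 1
  have e2 : ∀ j, ∫ x, (u t).partialDeriv j x * (∂_{e j} (conjS ψ)) x =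
      inner ℂ (toL2 (∂_{e j} ψ)) ((u t).partialDeriv j) := fun j => by
    rw [integral_mul_schwartz, lineDeriv_conjS, conjS_conjS]
  have e3 : (fun x => nl V β (u t).fn x * conjS ψ x) =ᵐ[volume] fun x =>
      ((V x + β (‖(u t).fn x‖ ^ 2) : ℝ) : ℂ) * (u t).fn x * conjS ψ x := by
    filter_upwards [coeFn_nl (h.memLp_force (u t))] with x hx
    rw [hx, force]
  have i3 := (integrable_mul_schwartz (nl V β (u t).fn) (conjS ψ)).congr e3
  rw [integral_add (integrable_finsetSum _ fun j _ => integrable_mul_schwartz _ _) i3,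
    integral_finsetSum _ fun j _ => integrable_mul_schwartz _ _, ← integral_congr_ae e3,
    integral_mul_schwartz, conjS_conjS]
  simp only [e2]
  rw [H1.sum_inner_partialDeriv]

/-- A product rule for an inner product one of whose factors is only weakly differentiable. -/
theorem hasDerivWithinAt_inner_of_weak {E : Type*} [NormedAddCommGroup E] [InnerProductSpace ℂ E]
    {a b : ℝ → E} {a' : E} {d : ℂ} {S : Set ℝ} {t : ℝ} (ha : HasDerivAt a a' t)
    (hb : ContinuousWithinAt b S t) (hd : HasDerivWithinAt (fun s => inner ℂ (a t) (b s)) d S t) :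
    HasDerivWithinAt (fun s => inner ℂ (a s) (b s)) (inner ℂ a' (b t) + d) S t := by
  rw [hasDerivWithinAt_iff_tendsto_slope] at hd ⊢
  have ha' : Tendsto (slope a t) (𝓝[S \ {t}] t) (𝓝 a') :=
    (hasDerivAt_iff_tendsto_slope.1 ha).mono_left
      (nhdsWithin_mono t fun x hx => hx.2)
  have hb' : Tendsto b (𝓝[S \ {t}] t) (𝓝 (b t)) := hb.mono_left (nhdsWithin_mono t sdiff_subset)
  refine ((ha'.inner hb').add hd).congr fun s => ?_
  simp only [slope_def_module]
  have : inner ℂ ((s - t)⁻¹ • (a s - a t)) (b s) =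
      (s - t)⁻¹ • (inner ℂ (a s) (b s) - inner ℂ (a t) (b s)) := by
    rw [← inner_sub_left]
    have e : (s - t)⁻¹ • (a s - a t) = (((s - t)⁻¹ : ℝ) : ℂ) • (a s - a t) := by
      rw [Complex.coe_smul]
    rw [e, inner_smul_left, Complex.conj_ofReal, Complex.real_smul]
  rw [this, ← smul_add]
  congr 1
  ring

theorem H1.continuousOn_fn {u : ℝ → H1} {S : Set ℝ} (hu : ContinuousOn u S) :
    ContinuousOn (fun s => (u s).fn) S := by
  intro t ht
  have h1 : Tendsto (fun s => ‖u s - u t‖) (𝓝[S] t) (𝓝 0) :=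
    tendsto_iff_norm_sub_tendsto_zero.1 (hu t ht)
  refine tendsto_iff_norm_sub_tendsto_zero.2 (squeeze_zero (fun _ => norm_nonneg _)
    (fun s => ?_) h1)
  rw [← H1.fn_sub]
  exact H1.norm_fn_le _

/-- Duhamel's formula in differential form: in the interaction picture only the force remains. -/
theorem IsSolution.hasDerivWithinAt_inner_freeS (h : ForceBounds V β C n) {u : ℝ → H1}
    (hu : IsSolution V β u) (ψ : 𝓢(Plane, ℂ)) (T : ℝ) {t : ℝ} (ht : 0 ≤ t) :
    HasDerivWithinAt (fun s => inner ℂ (toL2 (freeS (s - T) ψ)) (u s).fn)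
      (-Complex.I * inner ℂ (toL2 (freeS (t - T) ψ)) (nl V β (u t).fn)) (Ici 0) t := by
  have ha : HasDerivAt (fun s => toL2 (freeS (s - T) ψ))
      (Complex.I • toL2 (Δ (freeS (t - T) ψ))) t :=
    (hasDerivAt_toL2_freeS ψ (t - T)).comp_sub_const t T
  have hb : ContinuousWithinAt (fun s => (u s).fn) (Ici 0) t :=
    H1.continuousOn_fn hu.continuousOn t ht
  refine (hasDerivWithinAt_inner_of_weak ha hb
    (hu.hasDerivWithinAt_inner h (freeS (t - T) ψ) ht)).congr_deriv ?_
  rw [inner_smul_left, Complex.conj_I]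
  ring

theorem norm_freeS_le (t : ℝ) (ψ : 𝓢(Plane, ℂ)) (x : Plane) :
    ‖freeS t ψ x‖ ≤ ∫ ξ, ‖(𝓕 ψ) ξ‖ := by
  rw [freeS_apply]
  refine norm_integral_le_of_norm_le (𝓕 ψ).integrable.norm (Eventually.of_forall fun w => ?_)
  have e : Complex.exp (2 * Real.pi * Complex.I * inner ℝ x w) =
      Complex.exp (((2 * Real.pi * inner ℝ x w : ℝ) : ℂ) * Complex.I) := by
    congr 1
    push_cast
    ring
  rw [norm_mul, norm_mul, norm_freeSymbol, e, Complex.norm_exp_ofReal_mul_I, one_mul, one_mul]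

theorem norm_inner_toL2_le {ψ η : 𝓢(Plane, ℂ)} {M : ℝ} (hη : ∀ x, ‖η x‖ ≤ M) :
    ‖inner ℂ (toL2 ψ) (toL2 η)‖ ≤ M * ∫ x, ‖ψ x‖ := by
  rw [inner_toL2, ← integral_const_mul]
  refine norm_integral_le_of_norm_le (ψ.integrable.norm.const_mul M) ?_
  filter_upwards [η.coeFn_toLp 2 volume] with x hx
  rw [hx, norm_mul, RCLike.norm_conj, mul_comm]
  exact mul_le_mul_of_nonneg_right (hη x) (norm_nonneg _)

theorem IsSolution.exists_norm_le {u : ℝ → H1} (hu : IsSolution V β u) (T : ℝ) :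
    ∃ R, ∀ t, 0 ≤ t → t ≤ T → ‖u t‖ ≤ R := by
  have hc : ContinuousOn u (Icc 0 T) := hu.continuousOn.mono fun _ h => h.1
  obtain ⟨R, hR⟩ := isCompact_Icc.exists_bound_of_continuousOn hc
  exact ⟨R, fun t h0 hT => hR t ⟨h0, hT⟩⟩

/-- Solutions with Schwartz data are bounded, locally uniformly in time. By duality `|u(T)|` is
estimated through `(ψ, u(T))` with `ψ ∈ L¹`, and the function `s ↦ (e^{i(s-T)Δ} ψ, u(s))` connects
this number with the initial value. -/
theorem IsSolution.exists_ae_norm_le (h : ForceBounds V β C n) {u : ℝ → H1}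
    (hu : IsSolution V β u) {η : 𝓢(Plane, ℂ)} (h0 : u 0 = H1.ofSchwartz η) (T₀ : ℝ) :
    ∃ M, ∀ t, 0 ≤ t → t ≤ T₀ → ∀ᵐ x, ‖(u t).fn x‖ ≤ M := by
  obtain ⟨R, hR⟩ := hu.exists_norm_le T₀
  obtain ⟨K, hK, hb⟩ := h.exists_norm_inner_freeS_nl_le R
  refine ⟨(∫ ξ, ‖(𝓕 η) ξ‖) + K * (|T₀| + 2 * √|T₀|), fun T hT0 hT => ?_⟩
  refine ae_norm_le_of_inner_le fun ψ => ?_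
  set I := ∫ x, ‖ψ x‖ with hI
  have hI0 : 0 ≤ I := integral_nonneg fun _ => norm_nonneg _
  set A := ∫ ξ, ‖(𝓕 η) ξ‖ with hA
  -- a primitive of the bound `K (1 + |s - T|^{-1/2})` for the derivative
  set B : ℝ → ℝ := fun s => A * I + K * I * (s + 2 * √T - 2 * √(T - s)) with hB
  have hf : ∀ s ∈ Icc 0 T, HasDerivWithinAt (fun s => inner ℂ (toL2 (freeS (s - T) ψ)) (u s).fn)
      (-Complex.I * inner ℂ (toL2 (freeS (s - T) ψ)) (nl V β (u s).fn)) (Ici 0) s :=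
    fun s hs => hu.hasDerivWithinAt_inner_freeS h ψ T hs.1
  have key := image_norm_le_of_norm_deriv_right_le_deriv_boundary' (a := 0) (b := T)
    (f := fun s => inner ℂ (toL2 (freeS (s - T) ψ)) (u s).fn)
    (f' := fun s => -Complex.I * inner ℂ (toL2 (freeS (s - T) ψ)) (nl V β (u s).fn))
    (fun s hs => (hf s hs).continuousWithinAt.mono Icc_subset_Ici_self)
    (fun s hs => (hf s ⟨hs.1, hs.2.le⟩).mono (Ici_subset_Ici.2 hs.1))
    (B := B) (B' := fun s => K * I * (1 + |s - T| ^ (-(1 / 2) : ℝ)))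
    ?_ ?_ ?_ ?_
  · have h1 := key (right_mem_Icc.2 hT0)
    simp only [sub_self, freeS_zero, hB, Real.sqrt_zero, mul_zero, sub_zero] at h1
    refine h1.trans ?_
    have h2 : T ≤ |T₀| := hT.trans (le_abs_self _)
    have h3 : √T ≤ √|T₀| := Real.sqrt_le_sqrt h2
    have h4 : K * I * (T + 2 * √T) ≤ K * I * (|T₀| + 2 * √|T₀|) := by gcongr
    linarith
  · simp only [hB, sub_zero, zero_add, sub_self, mul_zero, add_zero, zero_sub]
    rw [h0, H1.fn_ofSchwartz]
    have h1 : inner ℂ (toL2 (freeS (-T) ψ)) (toL2 η) = inner ℂ (toL2 ψ) (toL2 (freeS T η)) :=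
      (inner_toL2_freeS_right T ψ η).symm
    rw [h1]
    exact norm_inner_toL2_le (norm_freeS_le T η)
  · simp only [hB]
    fun_prop
  · intro s hs
    have hs' : 0 < T - s := sub_pos.2 hs.2
    have h1 : HasDerivAt (fun s => √(T - s)) (-1 / (2 * √(T - s))) s :=
      ((hasDerivAt_id s).const_sub T).sqrt hs'.ne'
    have h2 : HasDerivAt B (K * I * (1 - 2 * (-1 / (2 * √(T - s))))) s :=
      (((((hasDerivAt_id s).add_const (2 * √T)).sub (h1.const_mul 2))).const_mul
        (K * I)).const_add (A * I)
    refine h2.hasDerivWithinAt.congr_deriv ?_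
    congr 1
    rw [abs_sub_comm, abs_of_pos hs', Real.rpow_neg hs'.le, ← Real.sqrt_eq_rpow]
    have := (Real.sqrt_pos.2 hs').ne'
    field_simp
    ring
  · intro s hs
    rw [norm_mul, norm_neg, Complex.norm_I, one_mul]
    refine (hb (u s) ψ (s - T) (hR s hs.1 (hs.2.le.trans hT)) (sub_ne_zero.2 hs.2.ne)).trans_eq ?_
    ring

end

section

/-! ### Lipschitz continuity in time -/

variable {V : Plane → ℝ} {β : ℝ → ℝ} {C : ℝ} {n : ℕ}

theorem L2.norm_le_of_inner_le {f : L2} {c : ℝ} (hc : 0 ≤ c)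
    (h : ∀ ψ, ‖inner ℂ (toL2 ψ) f‖ ≤ c * ‖toL2 ψ‖) : ‖f‖ ≤ c := by
  have h1 : ∀ g : L2, ‖inner ℂ g f‖ ≤ c * ‖g‖ := by
    intro g
    refine denseRange_toL2.induction_on (p := fun g => ‖inner ℂ g f‖ ≤ c * ‖g‖) g ?_ h
    exact isClosed_le (continuous_id.inner continuous_const).norm
      (continuous_const.mul continuous_norm)
  rcases (norm_nonneg f).eq_or_lt with h0 | h0
  · rwa [← h0]
  · have h2 := h1 f
    rw [inner_self_eq_norm_sq_to_K, norm_pow, RCLike.norm_ofReal, abs_norm, pow_two] at h2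
    exact le_of_mul_le_mul_right h2 h0

/-- The integral form of Duhamel's principle for a weak solution `w` of `i w_t = -Δ w + f`. -/
theorem norm_le_of_duhamel {w f : ℝ → L2} {T : ℝ} (hT : 0 ≤ T)
    (hd : ∀ ψ, ∀ s ∈ Icc 0 T, HasDerivWithinAt (fun s => inner ℂ (toL2 (freeS (s - T) ψ)) (w s))
      (-Complex.I * inner ℂ (toL2 (freeS (s - T) ψ)) (f s)) (Ici 0) s)
    {B B' : ℝ → ℝ} (hB : ∀ s, HasDerivAt B (B' s) s) (hBT : B 0 ≤ B T)
    (hf : ∀ s ∈ Ico 0 T, ‖f s‖ ≤ B' s) :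
    ‖w T‖ ≤ ‖w 0‖ + (B T - B 0) := by
  refine L2.norm_le_of_inner_le (add_nonneg (norm_nonneg _) (sub_nonneg.2 hBT)) fun ψ => ?_
  have key := image_norm_le_of_norm_deriv_right_le_deriv_boundary (a := 0) (b := T)
    (f := fun s => inner ℂ (toL2 (freeS (s - T) ψ)) (w s))
    (f' := fun s => -Complex.I * inner ℂ (toL2 (freeS (s - T) ψ)) (f s))
    (fun s hs => (hd ψ s hs).continuousWithinAt.mono fun _ h => h.1)
    (fun s hs => (hd ψ s ⟨hs.1, hs.2.le⟩).mono (Ici_subset_Ici.2 hs.1))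
    (B := fun s => (‖w 0‖ + (B s - B 0)) * ‖toL2 ψ‖) (B' := fun s => B' s * ‖toL2 ψ‖)
    ?_ (fun s => (((hB s).sub_const _).const_add _).mul_const _) fun s hs => ?_
  · have h1 := key (right_mem_Icc.2 hT)
    simpa only [sub_self, freeS_zero] using h1
  · rw [sub_self, add_zero, mul_comm, ← norm_toL2_freeS (0 - T) ψ]
    exact norm_inner_le_norm _ _
  · rw [norm_mul, norm_neg, Complex.norm_I, one_mul, mul_comm, ← norm_toL2_freeS (s - T) ψ]
    exact (norm_inner_le_norm _ _).trans (mul_le_mul_of_nonneg_left (hf s hs) (norm_nonneg _))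

/-- A Gronwall estimate: if the force is bounded by `L ‖w‖`, then `‖w‖` grows at most
exponentially. -/
theorem norm_le_of_duhamel_of_le {w f : ℝ → L2} {T L : ℝ} (hL : 0 < L)
    (hc : ContinuousOn w (Icc 0 T))
    (hd : ∀ ψ, ∀ T', ∀ s ∈ Icc 0 T,
      HasDerivWithinAt (fun s => inner ℂ (toL2 (freeS (s - T') ψ)) (w s))
      (-Complex.I * inner ℂ (toL2 (freeS (s - T') ψ)) (f s)) (Ici 0) s)
    (hf : ∀ s ∈ Icc 0 T, ‖f s‖ ≤ L * ‖w s‖) {t : ℝ} (ht : t ∈ Icc 0 T) :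
    ‖w t‖ ≤ 2 * Real.exp (2 * L * T) * ‖w 0‖ := by
  have hT : 0 ≤ T := ht.1.trans ht.2
  have hc' : ContinuousOn (fun s => Real.exp (-(2 * L * s)) * ‖w s‖) (Icc 0 T) :=
    (by fun_prop : Continuous fun s => Real.exp (-(2 * L * s))).continuousOn.mul hc.norm
  -- at the maximum point of the weighted norm the Duhamel integral can be absorbed
  obtain ⟨τ, hτ, hmax⟩ := isCompact_Icc.exists_isMaxOn (nonempty_Icc.2 hT) hc'
  set S := Real.exp (-(2 * L * τ)) * ‖w τ‖ with hS
  have hS0 : 0 ≤ S := by positivity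
  have hw : ∀ s ∈ Icc 0 T, ‖w s‖ ≤ S * Real.exp (2 * L * s) := fun s hs => by
    have h1 : Real.exp (-(2 * L * s)) * ‖w s‖ ≤ S := hmax hs
    calc ‖w s‖ = Real.exp (-(2 * L * s)) * ‖w s‖ * Real.exp (2 * L * s) := by
          rw [mul_right_comm, ← Real.exp_add, neg_add_cancel, Real.exp_zero, one_mul]
      _ ≤ _ := by gcongr
  have hB : ∀ s, HasDerivAt (fun s => S / 2 * Real.exp (2 * L * s))
      (L * (S * Real.exp (2 * L * s))) s := fun s => by
    have h1 := (((hasDerivAt_id s).const_mul (2 * L)).exp).const_mul (S / 2)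
    refine h1.congr_deriv ?_
    simp only [id_eq, mul_one]
    ring
  have h2 := norm_le_of_duhamel hτ.1 (fun ψ s hs => hd ψ τ s ⟨hs.1, hs.2.trans hτ.2⟩) hB
    (mul_le_mul_of_nonneg_left (Real.exp_le_exp.2 (by have := hτ.1; gcongr)) (by positivity))
    fun s hs => (hf s ⟨hs.1, hs.2.le.trans hτ.2⟩).trans
      (mul_le_mul_of_nonneg_left (hw s ⟨hs.1, hs.2.le.trans hτ.2⟩) hL.le)
  have h3 : ‖w τ‖ = S * Real.exp (2 * L * τ) := by
    rw [hS, mul_right_comm, ← Real.exp_add, neg_add_cancel, Real.exp_zero, one_mul]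
  rw [h3, mul_zero, Real.exp_zero] at h2
  have h4 : 1 ≤ Real.exp (2 * L * τ) := Real.one_le_exp (by have := hτ.1; positivity)
  have h5 : S ≤ 2 * ‖w 0‖ := by nlinarith
  have h6 : Real.exp (2 * L * t) ≤ Real.exp (2 * L * T) :=
    Real.exp_le_exp.2 (by have := ht.2; gcongr)
  calc ‖w t‖ ≤ S * Real.exp (2 * L * t) := hw t ht
    _ ≤ 2 * ‖w 0‖ * Real.exp (2 * L * T) := by gcongr
    _ = _ := by ring

theorem ForceBounds.exists_norm_nl_le (h : ForceBounds V β C n) (R : ℝ) :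
    ∃ K : ℝ, 0 ≤ K ∧ ∀ u : H1, ‖u‖ ≤ R → ‖nl V β u.fn‖ ≤ K := by
  obtain ⟨L, hL, hl⟩ := h.exists_norm_nl_sub_le |R|
  refine ⟨L * |R| + ‖nl V β (0 : H1).fn‖, by positivity, fun u hu => ?_⟩
  have hu' := hu.trans (le_abs_self R)
  have h1 := hl u 0 hu' (by simp)
  rw [sub_zero] at h1
  calc ‖nl V β u.fn‖ ≤ ‖nl V β u.fn - nl V β (0 : H1).fn‖ + ‖nl V β (0 : H1).fn‖ := by
        simpa using norm_add_le (nl V β u.fn - nl V β (0 : H1).fn) (nl V β (0 : H1).fn)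
    _ ≤ _ := by gcongr; exact h1.trans (by gcongr)

theorem norm_toL2_freeS_sub_le_of_le (ψ : 𝓢(Plane, ℂ)) {h T : ℝ} (h0 : 0 ≤ h) (hT : h ≤ T) :
    ‖toL2 (freeS h ψ) - toL2 ψ‖ ≤ (‖toL2 (Δ ψ)‖ + 3 * T * ‖toL2 (Δ (Δ ψ))‖) * h := by
  have h1 := norm_toL2_freeS_sub_le h ψ
  have h2 : ‖h • (Complex.I • toL2 (Δ ψ))‖ = h * ‖toL2 (Δ ψ)‖ := by
    rw [norm_smul, norm_smul, Complex.norm_I, one_mul, Real.norm_of_nonneg h0]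
  have h3 := norm_add_le (toL2 (freeS h ψ) - toL2 ψ - h • (Complex.I • toL2 (Δ ψ)))
    (h • (Complex.I • toL2 (Δ ψ)))
  rw [sub_add_cancel, h2] at h3
  have h4 : 3 * h ^ 2 * ‖toL2 (Δ (Δ ψ))‖ ≤ 3 * T * ‖toL2 (Δ (Δ ψ))‖ * h := by
    have : h ^ 2 ≤ T * h := by nlinarith
    nlinarith [norm_nonneg (toL2 (Δ (Δ ψ)))]
  linarith

/-- A solution with Schwartz data is Lipschitz at time `0` with values in `L²`. -/
theorem IsSolution.exists_norm_sub_zero_le (h : ForceBounds V β C n) {u : ℝ → H1}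
    (hu : IsSolution V β u) {η : 𝓢(Plane, ℂ)} (h0 : u 0 = H1.ofSchwartz η) (T : ℝ) :
    ∃ K, 0 ≤ K ∧ ∀ t, 0 ≤ t → t ≤ T → ‖(u t).fn - (u 0).fn‖ ≤ K * t := by
  obtain ⟨R, hR⟩ := hu.exists_norm_le T
  obtain ⟨K, hK, hb⟩ := h.exists_norm_nl_le R
  refine ⟨K + (‖toL2 (Δ η)‖ + 3 * |T| * ‖toL2 (Δ (Δ η))‖), by positivity, fun t ht0 htT => ?_⟩
  -- the difference `u s - e^{isΔ} η` solves the equation with zero initial value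
  have hd : ∀ ψ, ∀ s ∈ Icc 0 t, HasDerivWithinAt
      (fun s => inner ℂ (toL2 (freeS (s - t) ψ)) ((u s).fn - toL2 (freeS s η)))
      (-Complex.I * inner ℂ (toL2 (freeS (s - t) ψ)) (nl V β (u s).fn)) (Ici 0) s := by
    intro ψ s hs
    have h1 := hu.hasDerivWithinAt_inner_freeS h ψ t hs.1
    have h2 : ∀ s, inner ℂ (toL2 (freeS (s - t) ψ)) (toL2 (freeS s η)) =
        inner ℂ (toL2 (freeS (-t) ψ)) (toL2 η) := fun s => by
      rw [inner_toL2_freeS_right, freeS_freeS]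
      congr 3
      ring
    simp only [inner_sub_right, h2]
    exact h1.sub_const _
  have h1 := norm_le_of_duhamel ht0 hd (B := fun s => K * s) (B' := fun _ => K)
    (fun s => by simpa using (hasDerivAt_id s).const_mul K) (by gcongr)
    fun s hs => hb _ (hR s hs.1 (hs.2.le.trans htT))
  rw [h0, H1.fn_ofSchwartz, freeS_zero, sub_self, norm_zero, zero_add, mul_zero, sub_zero] at h1
  rw [h0, H1.fn_ofSchwartz]
  have h2 := norm_toL2_freeS_sub_le_of_le η ht0 (htT.trans (le_abs_self T))
  have h3 := norm_add_le ((u t).fn - toL2 (freeS t η)) (toL2 (freeS t η) - toL2 η)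
  rw [sub_add_sub_cancel] at h3
  linarith

/-- A solution with Schwartz data is Lipschitz with values in `L²`: the time translates
solve the same equation, the force is Lipschitz in `L²` on bounded functions, and Gronwall's
inequality propagates the estimate at time `0`. -/
theorem IsSolution.exists_norm_sub_le (h : ForceBounds V β C n) {u : ℝ → H1}
    (hu : IsSolution V β u) {η : 𝓢(Plane, ℂ)} (h0 : u 0 = H1.ofSchwartz η) (T : ℝ) :
    ∃ K, 0 ≤ K ∧ ∀ s t, 0 ≤ s → s ≤ T → 0 ≤ t → t ≤ T →
      ‖(u s).fn - (u t).fn‖ ≤ K * |s - t| := by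
  obtain ⟨M, hM⟩ := hu.exists_ae_norm_le h h0 T
  obtain ⟨L, hL, hl⟩ := h.exists_norm_nl_sub_le_of_bounded M
  obtain ⟨K, hK, hk⟩ := hu.exists_norm_sub_zero_le h h0 T
  have key : ∀ t k, 0 ≤ t → 0 ≤ k → t + k ≤ T →
      ‖(u (t + k)).fn - (u t).fn‖ ≤ 2 * Real.exp (2 * (L + 1) * |T|) * K * k := by
    intro t k ht hk0 hT
    have hsub : ∀ s ∈ Icc 0 t, 0 ≤ s + k ∧ s + k ≤ T ∧ 0 ≤ s ∧ s ≤ T := fun s hs => by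
      refine ⟨?_, ?_, hs.1, ?_⟩ <;> linarith [hs.1, hs.2]
    have h1 := norm_le_of_duhamel_of_le (w := fun s => (u (s + k)).fn - (u s).fn)
      (f := fun s => nl V β (u (s + k)).fn - nl V β (u s).fn) (T := t) (L := L + 1)
      (by linarith) ?_ ?_ ?_ (right_mem_Icc.2 ht)
    · refine h1.trans ?_
      rw [zero_add]
      have h2 := hk k hk0 (by linarith)
      have h3 : Real.exp (2 * (L + 1) * t) ≤ Real.exp (2 * (L + 1) * |T|) := by
        refine Real.exp_le_exp.2 (mul_le_mul_of_nonneg_left ?_ (by positivity))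
        linarith [le_abs_self T]
      rw [mul_assoc _ K k]
      gcongr
    · have hc := H1.continuousOn_fn hu.continuousOn
      refine ContinuousOn.sub (hc.comp (by fun_prop) fun s hs => (hsub s hs).1)
        (hc.mono fun s hs => hs.1)
    · intro ψ T' s hs
      have h2 := hu.hasDerivWithinAt_inner_freeS h ψ T' hs.1
      have h3 := hu.hasDerivWithinAt_inner_freeS h ψ (T' + k) (hsub s hs).1
      have h4 := HasDerivWithinAt.scomp (h := fun r => r + k) s h3
        (((hasDerivAt_id s).add_const k).hasDerivWithinAt (s := Ici 0))
        (fun r hr => by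
          have hr : 0 ≤ r := hr
          exact add_nonneg hr hk0)
      have e : ∀ r, r + k - (T' + k) = r - T' := fun r => by ring
      simp only [Function.comp_def, e, one_smul] at h4
      simp only [inner_sub_right, mul_sub]
      exact h4.sub h2
    · intro s hs
      obtain ⟨a, b, c, d⟩ := hsub s hs
      refine (hl _ _ (hM _ a b) (hM _ c d)).trans ?_
      have := norm_nonneg ((u (s + k)).fn - (u s).fn)
      linarith
  refine ⟨2 * Real.exp (2 * (L + 1) * |T|) * K, by positivity, fun s t hs hsT ht htT => ?_⟩
  rcases le_total t s with hst | hst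
  · have := key t (s - t) ht (sub_nonneg.2 hst) (by linarith)
    rwa [add_sub_cancel, ← abs_of_nonneg (sub_nonneg.2 hst)] at this
  · have := key s (t - s) hs (sub_nonneg.2 hst) (by linarith)
    rwa [add_sub_cancel, ← abs_of_nonneg (sub_nonneg.2 hst), norm_sub_rev, abs_sub_comm] at this

end

section

/-! ### Conservation of mass and the energy inequality -/

variable {V : Plane → ℝ} {β : ℝ → ℝ} {C : ℝ} {n : ℕ}

theorem laplacian_add (ψ η : 𝓢(Plane, ℂ)) : Δ (ψ + η) = Δ ψ + Δ η := by
  simp only [laplacian_eq, LineDeriv.lineDerivOp_add, Finset.sum_add_distrib]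

theorem laplacian_smul (c : ℂ) (ψ : 𝓢(Plane, ℂ)) : Δ (c • ψ) = c • Δ ψ := by
  simp only [laplacian_eq, LineDeriv.lineDerivOp_smul, Finset.smul_sum]

/-- If the functional `ψ ↦ (b, ψ) - (a, Δ ψ)` is bounded for the `L²` norm, then `b - Δ a ∈ L²`. -/
theorem exists_inner_eq_of_bound {a b : L2} {K : ℝ}
    (h : ∀ ψ, ‖-inner ℂ (toL2 (Δ ψ)) a + inner ℂ (toL2 ψ) b‖ ≤ K * ‖toL2 ψ‖) :
    ∃ g : L2, ∀ ψ, inner ℂ (toL2 ψ) g = -inner ℂ (toL2 (Δ ψ)) a + inner ℂ (toL2 ψ) b := by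
  let Λ : 𝓢(Plane, ℂ) →ₗ[ℂ] ℂ :=
    { toFun := fun ψ => -inner ℂ a (toL2 (Δ ψ)) + inner ℂ b (toL2 ψ)
      map_add' := fun ψ η => by
        rw [laplacian_add, toL2_add, toL2_add, inner_add_right, inner_add_right]
        ring
      map_smul' := fun c ψ => by
        rw [laplacian_smul, toL2_smul, toL2_smul, inner_smul_right, inner_smul_right,
          RingHom.id_apply, smul_eq_mul]
        ring }
  have hΛ : ∀ ψ, Λ ψ = (starRingEnd ℂ)
      (-inner ℂ (toL2 (Δ ψ)) a + inner ℂ (toL2 ψ) b) := fun ψ => by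
    rw [map_add, map_neg, inner_conj_symm, inner_conj_symm]
    rfl
  let ι : 𝓢(Plane, ℂ) →ₗ[ℂ] L2 :=
    { toFun := toL2
      map_add' := toL2_add
      map_smul' := toL2_smul }
  have hext : ∀ ψ, Λ.extendOfNorm ι (toL2 ψ) = Λ ψ :=
    LinearMap.extendOfNorm_eq (e := ι) denseRange_toL2 ⟨K, fun ψ => by
      rw [hΛ, RCLike.norm_conj]
      exact h ψ⟩
  refine ⟨(InnerProductSpace.toDual ℂ L2).symm (Λ.extendOfNorm ι), fun ψ => ?_⟩
  rw [← inner_conj_symm, InnerProductSpace.toDual_symm_apply, hext, hΛ, Complex.conj_conj]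

theorem norm_le_of_hasDerivWithinAt {f : ℝ → ℂ} {d : ℂ} {K t : ℝ}
    (hd : HasDerivWithinAt f d (Ici 0) t) (ht : 0 ≤ t)
    (hK : ∀ s, t ≤ s → s ≤ t + 1 → ‖f s - f t‖ ≤ K * |s - t|) : ‖d‖ ≤ K := by
  have h1 := (hd.mono (Ici_subset_Ici.2 ht)).Ioi_of_Ici
  rw [hasDerivWithinAt_iff_tendsto_slope' (by simp)] at h1
  refine le_of_tendsto h1.norm ?_
  filter_upwards [Ioo_mem_nhdsGT (lt_add_one t)] with s hs
  have h2 : 0 < s - t := sub_pos.2 hs.1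
  rw [slope_def_module, norm_smul, norm_inv, Real.norm_of_nonneg h2.le, inv_mul_le_iff₀ h2, mul_comm]
  have := hK s hs.1.le hs.2.le
  rwa [abs_of_pos h2] at this

/-- For Schwartz data `-Δ u + f(u)` is an `L²` function at all times, and it gives the derivative
of `u` in the weak topology of `L²`. -/
theorem IsSolution.exists_generator (h : ForceBounds V β C n) {u : ℝ → H1}
    (hu : IsSolution V β u) {η : 𝓢(Plane, ℂ)} (h0 : u 0 = H1.ofSchwartz η) {t : ℝ} (ht : 0 ≤ t) :
    ∃ g : L2, (∀ v : H1, inner ℂ v.fn g = ∑ j, inner ℂ (v.partialDeriv j) ((u t).partialDeriv j) +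
        inner ℂ v.fn (nl V β (u t).fn)) ∧
      ∀ f : L2, HasDerivWithinAt (fun s => inner ℂ f (u s).fn) (-Complex.I * inner ℂ f g)
        (Ici 0) t := by
  obtain ⟨K, hK, hL⟩ := hu.exists_norm_sub_le h h0 (t + 1)
  obtain ⟨g, hg⟩ := exists_inner_eq_of_bound (a := (u t).fn) (b := nl V β (u t).fn) (K := K)
    fun ψ => by
      have h1 := norm_le_of_hasDerivWithinAt (K := K * ‖toL2 ψ‖)
        (hu.hasDerivWithinAt_inner h ψ ht) ht fun s hts hs => by
          rw [← inner_sub_right]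
          refine (norm_inner_le_norm _ _).trans ?_
          have := hL s t (ht.trans hts) hs ht (by linarith)
          calc ‖toL2 ψ‖ * ‖(u s).fn - (u t).fn‖ ≤ ‖toL2 ψ‖ * (K * |s - t|) := by gcongr
            _ = _ := by ring
      rwa [norm_mul, norm_neg, Complex.norm_I, one_mul] at h1
  refine ⟨g, fun v => ?_, fun f => ?_⟩
  · obtain ⟨ψ, hψ⟩ := v.exists_schwartz_seq
    have hlim : ∀ (L : H1 → L2) (_ : ∀ a b, L (a - b) = L a - L b) (_ : ∀ a, ‖L a‖ ≤ ‖a‖) (f : L2),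
        Tendsto (fun k => inner ℂ (L (H1.ofSchwartz (ψ k))) f) atTop (𝓝 (inner ℂ (L v) f)) := by
      intro L hsub hle f
      refine Tendsto.inner (tendsto_iff_norm_sub_tendsto_zero.2
        (squeeze_zero (fun _ => norm_nonneg _) (fun k => ?_) hψ)) tendsto_const_nhds
      rw [norm_sub_rev, ← hsub]
      exact hle _
    refine tendsto_nhds_unique (hlim H1.fn (fun a b => H1.fn_sub a b) H1.norm_fn_le g) ?_
    refine ((tendsto_finsetSum _ fun j _ => hlim (fun a => a.partialDeriv j)
      (fun a b => H1.partialDeriv_sub a b j) (fun a => a.norm_partialDeriv_le j) _).add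
      (hlim H1.fn (fun a b => H1.fn_sub a b) H1.norm_fn_le _)).congr fun k => ?_
    simp only [H1.fn_ofSchwartz, H1.partialDeriv_ofSchwartz]
    rw [hg, H1.sum_inner_partialDeriv]
  · rw [hasDerivWithinAt_iff_isLittleO, Asymptotics.isLittleO_iff]
    intro ε hε
    -- approximation of `f` by Schwartz functions
    obtain ⟨ψ, hψ⟩ : ∃ ψ, (K + ‖g‖) * ‖f - toL2 ψ‖ ≤ ε / 2 := by
      have hpos : 0 < ε / 2 / (K + ‖g‖ + 1) := by positivity
      obtain ⟨ψ, hψ⟩ := denseRange_toL2.exists_dist_lt f hpos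
      rw [dist_eq_norm, lt_div_iff₀ (by positivity)] at hψ
      refine ⟨ψ, ?_⟩
      nlinarith [norm_nonneg (f - toL2 ψ)]
    have h1 := hu.hasDerivWithinAt_inner h ψ ht
    rw [← hg ψ, hasDerivWithinAt_iff_isLittleO, Asymptotics.isLittleO_iff] at h1
    have hnear : ∀ᶠ s in 𝓝[Ici 0] t, 0 ≤ s ∧ s ≤ t + 1 := by
      filter_upwards [self_mem_nhdsWithin, nhdsWithin_le_nhds (Iic_mem_nhds (lt_add_one t))]
        with s hs hs1 using ⟨hs, hs1⟩
    filter_upwards [h1 (half_pos hε), hnear] with s hs hs1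
    have hLs := hL s t hs1.1 hs1.2 ht (by linarith)
    have e : inner ℂ f (u s).fn - inner ℂ f (u t).fn - (s - t) • (-Complex.I * inner ℂ f g) =
        (inner ℂ (toL2 ψ) (u s).fn - inner ℂ (toL2 ψ) (u t).fn -
          (s - t) • (-Complex.I * inner ℂ (toL2 ψ) g)) +
        (inner ℂ (f - toL2 ψ) ((u s).fn - (u t).fn) -
          (s - t) • (-Complex.I * inner ℂ (f - toL2 ψ) g)) := by
      simp only [inner_sub_left, inner_sub_right, Complex.real_smul]
      ring
    rw [e]
    refine (norm_add_le _ _).trans ?_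
    have h2 : ‖inner ℂ (f - toL2 ψ) ((u s).fn - (u t).fn) -
        (s - t) • (-Complex.I * inner ℂ (f - toL2 ψ) g)‖ ≤ ε / 2 * ‖s - t‖ := by
      refine (norm_sub_le _ _).trans ?_
      rw [norm_smul, norm_mul, norm_neg, Complex.norm_I, one_mul]
      have h3 : ‖inner ℂ (f - toL2 ψ) ((u s).fn - (u t).fn)‖ ≤ ‖f - toL2 ψ‖ * (K * ‖s - t‖) :=
        (norm_inner_le_norm _ _).trans (mul_le_mul_of_nonneg_left hLs (norm_nonneg _))
      have h4 : ‖inner ℂ (f - toL2 ψ) g‖ ≤ ‖f - toL2 ψ‖ * ‖g‖ := norm_inner_le_norm _ _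
      calc _ ≤ ‖f - toL2 ψ‖ * (K * ‖s - t‖) + ‖s - t‖ * (‖f - toL2 ψ‖ * ‖g‖) := by gcongr
        _ = (K + ‖g‖) * ‖f - toL2 ψ‖ * ‖s - t‖ := by ring
        _ ≤ _ := by gcongr
    linarith

theorem ForceBounds.inner_nl_self_im (h : ForceBounds V β C n) (u : H1) :
    (inner ℂ u.fn (nl V β u.fn)).im = 0 := by
  have e : ∀ x, (starRingEnd ℂ) (u.fn x) * force V β x (u.fn x) =
      (((V x + β (‖u.fn x‖ ^ 2)) * ‖u.fn x‖ ^ 2 : ℝ) : ℂ) := fun x => by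
    rw [force, mul_left_comm, mul_comm ((starRingEnd ℂ) _), Complex.mul_conj,
      Complex.normSq_eq_norm_sq]
    push_cast
    ring
  rw [(h.inner_nl u.fn u).2]
  simp only [e]
  rw [integral_complex_ofReal, Complex.ofReal_im]

theorem norm_add_sq_L2 (a b : L2) :
    ‖a + b‖ ^ 2 = ‖a‖ ^ 2 + 2 * (inner ℂ a b).re + ‖b‖ ^ 2 := by
  have := norm_add_sq (𝕜 := ℂ) a b
  simpa using this

theorem isLittleO_sub_of_sq_bound {f : ℝ → ℝ} {S : Set ℝ} {t K : ℝ}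
    (h : ∀ᶠ s in 𝓝[S] t, |f s| ≤ K * |s - t| ^ 2) :
    Asymptotics.IsLittleO (𝓝[S] t) f fun s => s - t := by
  have h1 : Asymptotics.IsBigO (𝓝[S] t) f fun s => (s - t) ^ 2 :=
    Asymptotics.IsBigO.of_bound K (h.mono fun s hs => by
      rwa [Real.norm_eq_abs, norm_pow, Real.norm_eq_abs])
  refine h1.trans_isLittleO ?_
  have h2 : Tendsto (fun s => s - t) (𝓝[S] t) (𝓝 0) := by
    have : Tendsto (fun s => s - t) (𝓝 t) (𝓝 (t - t)) := tendsto_id.sub_const t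
    rw [sub_self] at this
    exact this.mono_left nhdsWithin_le_nhds
  exact (Asymptotics.isLittleO_pow_id one_lt_two).comp_tendsto h2

/-- Conservation of mass: `‖u(s)‖² = ‖u(s) - u(t)‖² + 2 Re (u(t), u(s)) - ‖u(t)‖²`, where the first
term is of second order in `s - t` and the second one is weakly differentiable in time. -/
theorem IsSolution.norm_fn_eq (h : ForceBounds V β C n) {u : ℝ → H1}
    (hu : IsSolution V β u) {η : 𝓢(Plane, ℂ)} (h0 : u 0 = H1.ofSchwartz η) {T : ℝ} (hT : 0 ≤ T) :
    ‖(u T).fn‖ = ‖(u 0).fn‖ := by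
  obtain ⟨K, hK, hL⟩ := hu.exists_norm_sub_le h h0 (T + 1)
  have hd : ∀ t ∈ Icc 0 T, HasDerivWithinAt (fun s => ‖(u s).fn‖ ^ 2) 0 (Ici 0) t := by
    intro t ht
    obtain ⟨g, hg, hgd⟩ := hu.exists_generator h h0 ht.1
    have him : (inner ℂ (u t).fn g).im = 0 := by
      have e : ∀ j, (inner ℂ ((u t).partialDeriv j) ((u t).partialDeriv j)).im = 0 := fun j => by
        have := inner_self_im (𝕜 := ℂ) ((u t).partialDeriv j)
        simpa using this
      rw [hg (u t), Complex.add_im, Complex.im_sum, h.inner_nl_self_im,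
        Finset.sum_eq_zero fun j _ => e j, add_zero]
    have h1 : HasDerivWithinAt (fun s => 2 * (inner ℂ (u t).fn (u s).fn).re) 0 (Ici 0) t := by
      have h2 := Complex.reCLM.hasFDerivAt.comp_hasDerivWithinAt t (hgd (u t).fn)
      have h3 := h2.const_mul 2
      refine h3.congr_deriv ?_
      simp [him]
    have h2 : ∀ s, ‖(u s).fn‖ ^ 2 = ‖(u s).fn - (u t).fn‖ ^ 2 +
        2 * (inner ℂ (u t).fn (u s).fn).re - ‖(u t).fn‖ ^ 2 := fun s => by
      have h3 := norm_add_sq_L2 ((u s).fn - (u t).fn) (u t).fn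
      have h4 : inner ℂ (u t).fn (u t).fn = ((‖(u t).fn‖ ^ 2 : ℝ) : ℂ) := by
        rw [inner_self_eq_norm_sq_to_K]
        simp
      rw [sub_add_cancel, inner_sub_left, Complex.sub_re, h4, Complex.ofReal_re,
        ← inner_conj_symm (u s).fn, Complex.conj_re] at h3
      linarith
    have h3 : HasDerivWithinAt (fun s => ‖(u s).fn - (u t).fn‖ ^ 2) 0 (Ici 0) t := by
      rw [hasDerivWithinAt_iff_isLittleO]
      simp only [sub_self, norm_zero, zero_pow two_ne_zero, sub_zero, smul_zero]
      refine isLittleO_sub_of_sq_bound (K := K ^ 2) ?_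
      filter_upwards [self_mem_nhdsWithin, nhdsWithin_le_nhds (Iic_mem_nhds (lt_add_one t))]
        with s hs hs1
      have hs1 : s ≤ t + 1 := hs1
      rw [abs_of_nonneg (sq_nonneg _), ← mul_pow]
      exact pow_le_pow_left₀ (norm_nonneg _)
        (hL s t hs (hs1.trans (by linarith [ht.2])) ht.1 (by linarith [ht.2])) 2
    exact (((h3.add h1).sub_const (‖(u t).fn‖ ^ 2)).congr (fun s _ => h2 s) (h2 t)).congr_deriv
      (add_zero 0)
  have h1 := constant_of_has_deriv_right_zero (a := 0) (b := T) (f := fun s => ‖(u s).fn‖ ^ 2)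
    (fun s hs => (hd s hs).continuousWithinAt.mono fun _ h => h.1)
    (fun s hs => (hd s ⟨hs.1, hs.2.le⟩).mono (Ici_subset_Ici.2 hs.1)) T (right_mem_Icc.2 hT)
  exact (sq_eq_sq₀ (norm_nonneg _) (norm_nonneg _)).1 h1

/-- The energy does not increase. Its left difference quotients are at most the quotients of a
linear functional of `u`, whose derivative vanishes; the term `‖∇ w‖²` of the second order
expansion is dropped, as no bound for it in terms of the time step is available. -/
theorem IsSolution.energy_le (h : ForceBounds V β C n) {u : ℝ → H1}
    (hu : IsSolution V β u) {η : 𝓢(Plane, ℂ)} (h0 : u 0 = H1.ofSchwartz η) {T : ℝ} (hT : 0 ≤ T) :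
    energy V β (u T) ≤ energy V β (u 0) := by
  obtain ⟨K, hK, hL⟩ := hu.exists_norm_sub_le h h0 (T + 1)
  obtain ⟨M, hM⟩ := hu.exists_ae_norm_le h h0 (T + 1)
  obtain ⟨A, hA, htay⟩ := h.exists_abs_taylor_le_of_bounded M
  obtain ⟨R, hR⟩ := hu.exists_norm_le T
  set E : ℝ → ℝ := fun t => ∑ j, ‖(u t).partialDeriv j‖ ^ 2 + potEnergy V β (u t).fn with hE
  have hEc : ContinuousOn E (Icc 0 T) := by
    obtain ⟨K₁, hK₁, hp⟩ := h.exists_abs_potEnergy_sub_le R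
    obtain ⟨K₂, hK₂, h4⟩ := H1.exists_eLpNorm_four_le
    have hsub : ∀ t ∈ Icc 0 T, Tendsto (fun s => ‖u s - u t‖) (𝓝[Icc 0 T] t) (𝓝 0) := fun t ht =>
      tendsto_iff_norm_sub_tendsto_zero.1 ((hu.continuousOn.mono fun _ h => h.1) t ht)
    refine ContinuousOn.add (continuousOn_finsetSum _ fun j _ => ContinuousOn.pow (ContinuousOn.norm
      fun t ht => ?_) 2) fun t ht => ?_
    · refine tendsto_iff_norm_sub_tendsto_zero.2
        (squeeze_zero (fun _ => norm_nonneg _) (fun s => ?_) (hsub t ht))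
      rw [← H1.partialDeriv_sub]
      exact H1.norm_partialDeriv_le _ j
    · refine tendsto_iff_norm_sub_tendsto_zero.2 (squeeze_zero' (Eventually.of_forall fun _ =>
        norm_nonneg _) ?_ (by simpa using (hsub t ht).const_mul (K₁ * K₂)))
      filter_upwards [self_mem_nhdsWithin] with s hs
      refine (hp _ _ (hR s hs.1 hs.2) (hR t ht.1 ht.2)).trans ?_
      rw [mul_assoc]
      exact mul_le_mul_of_nonneg_left
        (ENNReal.toReal_le_of_le_ofReal (by positivity) (h4 _)) hK₁
  have key : ∀ t ∈ Ioc 0 T, ∀ r > 0, ∀ᶠ s in 𝓝[Ici 0] t, E t - E s ≤ r * |s - t| := by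
    intro t ht r hr
    obtain ⟨g, hg, hgd⟩ := hu.exists_generator h h0 ht.1.le
    have hre : (-Complex.I * inner ℂ g g).re = 0 := by
      have := inner_self_im (𝕜 := ℂ) g
      simpa using this
    have h1 := Complex.reCLM.hasFDerivAt.comp_hasDerivWithinAt t (hgd g)
    have h2 : HasDerivWithinAt (fun s => (inner ℂ g (u s).fn).re) 0 (Ici 0) t :=
      h1.congr_deriv hre
    rw [hasDerivWithinAt_iff_isLittleO] at h2
    simp only [smul_zero, sub_zero] at h2
    have h3 : Asymptotics.IsLittleO (𝓝[Ici 0] t)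
        (fun s => A * ‖(u s).fn - (u t).fn‖ ^ 2) fun s => s - t := by
      refine isLittleO_sub_of_sq_bound (K := A * K ^ 2) ?_
      filter_upwards [self_mem_nhdsWithin, nhdsWithin_le_nhds (Iic_mem_nhds (lt_add_one t))]
        with s hs hs1
      have hs1 : s ≤ t + 1 := hs1
      rw [abs_of_nonneg (by positivity), mul_assoc, ← mul_pow]
      exact mul_le_mul_of_nonneg_left (pow_le_pow_left₀ (norm_nonneg _)
        (hL s t hs (hs1.trans (by linarith [ht.2])) ht.1.le (by linarith [ht.2])) 2) hA
    rw [Asymptotics.isLittleO_iff] at h2 h3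
    filter_upwards [h2 (by positivity : 0 < r / 4), h3 (half_pos hr), self_mem_nhdsWithin,
      nhdsWithin_le_nhds (Iic_mem_nhds (lt_add_one t))] with s hs2 hs3 hs hs1
    have hs1 : s ≤ t + 1 := hs1
    have hs : 0 ≤ s := hs
    rw [Real.norm_eq_abs, Real.norm_eq_abs] at hs2 hs3
    have hw : u t + (u s - u t) = u s := by abel
    have htay' := htay (u t) (u s - u t) (hM t ht.1.le (by linarith [ht.2]))
      (by rw [hw]; exact hM s hs (hs1.trans (by linarith [ht.2])))
    rw [hw, H1.fn_sub] at htay'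
    have hgw := hg (u s - u t)
    have hgr : (inner ℂ ((u s).fn - (u t).fn) g).re =
        (inner ℂ g (u s).fn).re - (inner ℂ g (u t).fn).re := by
      rw [← Complex.sub_re, ← inner_sub_right, ← inner_conj_symm, Complex.conj_re]
    have hgrad : ∀ j, ‖(u s).partialDeriv j‖ ^ 2 ≥ ‖(u t).partialDeriv j‖ ^ 2 +
        2 * (inner ℂ ((u s - u t).partialDeriv j) ((u t).partialDeriv j)).re := fun j => by
      have h5 := norm_add_sq_L2 ((u s - u t).partialDeriv j) ((u t).partialDeriv j)
      rw [H1.partialDeriv_sub, sub_add_cancel] at h5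
      rw [H1.partialDeriv_sub, h5]
      nlinarith [sq_nonneg ‖(u s).partialDeriv j - (u t).partialDeriv j‖]
    have hsum : ∑ j, ‖(u t).partialDeriv j‖ ^ 2 +
        2 * (∑ j, inner ℂ ((u s - u t).partialDeriv j) ((u t).partialDeriv j)).re ≤
        ∑ j, ‖(u s).partialDeriv j‖ ^ 2 := by
      rw [Complex.re_sum, Finset.mul_sum, ← Finset.sum_add_distrib]
      exact Finset.sum_le_sum fun j _ => hgrad j
    have hgw' := congrArg Complex.re hgw
    rw [Complex.add_re, H1.fn_sub, hgr] at hgw'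
    have a1 := (abs_le.1 htay').1
    have a2 := (abs_le.1 hs2).1
    have a3 := (le_abs_self _).trans hs3
    simp only [hE]
    linarith
  -- the fencing inequality for the time-reversed energy
  have hfence := image_le_of_liminf_slope_right_le_deriv_boundary (a := 0) (b := T)
    (f := fun τ => E T - E (T - τ)) (B := fun _ => 0) (B' := fun _ => 0)
    (continuousOn_const.sub (hEc.comp (by fun_prop) fun τ hτ => ⟨by linarith [hτ.2], by
      linarith [hτ.1]⟩)) (by simp) continuousOn_const (fun x _ => hasDerivWithinAt_const _ _ _)
    fun τ hτ r hr => ?_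
  · have h1 := hfence (right_mem_Icc.2 hT)
    simp only [sub_self] at h1
    rw [h.energy_eq, h.energy_eq]
    have h2 : E T ≤ E 0 := by linarith
    simp only [hE] at h2
    linarith
  · have h1 := key (T - τ) ⟨by linarith [hτ.2], by linarith [hτ.1]⟩ (r / 2) (half_pos hr)
    have h2 : Tendsto (fun z => T - z) (𝓝[>] τ) (𝓝[Ici 0] (T - τ)) := by
      refine tendsto_nhdsWithin_iff.2 ⟨?_, ?_⟩
      · exact (tendsto_const_nhds.sub tendsto_id).mono_left nhdsWithin_le_nhds
      · filter_upwards [Ioo_mem_nhdsGT hτ.2] with z hz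
        exact sub_nonneg.2 hz.2.le
    refine Eventually.frequently ?_
    filter_upwards [h2.eventually h1, self_mem_nhdsWithin] with z hz (hzτ : τ < z)
    have h3 : |T - z - (T - τ)| = z - τ := by
      rw [abs_of_nonpos (by linarith)]
      ring
    rw [h3] at hz
    rw [slope_def_field, div_lt_iff₀ (sub_pos.2 hzτ)]
    have h4 := mul_pos hr (sub_pos.2 hzτ)
    linarith

end

section

/-! ### Decoupling of a free wave from a bound state -/

instance holderTriple_four_thirds_four : ENNReal.HolderTriple (4 / 3) 4 1 where
  inv_add_inv_eq_inv := by
    rw [ENNReal.inv_div (by simp) (by simp)]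
    refine (ENNReal.toReal_eq_toReal_iff' ?_ (by simp)).1 ?_
    · exact ENNReal.add_ne_top.2 ⟨ENNReal.div_ne_top (by simp) (by simp), by simp⟩
    · rw [ENNReal.toReal_add (ENNReal.div_ne_top (by simp) (by simp)) (by simp),
        ENNReal.toReal_div, ENNReal.toReal_inv]
      norm_num

theorem tendsto_eLpNorm_freeS_four (η : 𝓢(Plane, ℂ)) :
    Tendsto (fun t => eLpNorm (freeS t η) 4 volume) atTop (𝓝 0) := by
  have h1 : Tendsto (fun t : ℝ => ENNReal.ofReal (|t| ^ (-(1 / 2) : ℝ)) *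
      eLpNorm η (4 / 3) volume) atTop (𝓝 0) := by
    have h2 : Tendsto (fun t : ℝ => ENNReal.ofReal (|t| ^ (-(1 / 2) : ℝ))) atTop (𝓝 0) := by
      rw [← ENNReal.ofReal_zero]
      exact ENNReal.tendsto_ofReal
        ((tendsto_rpow_neg_atTop (by norm_num)).comp tendsto_abs_atTop_atTop)
    have h3 := ENNReal.Tendsto.mul_const (b := eLpNorm η (4 / 3) volume) h2
      (Or.inr (η.memLp (4 / 3) volume).eLpNorm_ne_top)
    rwa [zero_mul] at h3
  refine tendsto_of_tendsto_of_tendsto_of_le_of_le' tendsto_const_nhds h1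
    (Eventually.of_forall fun _ => zero_le) ?_
  filter_upwards [eventually_ne_atTop 0] with t ht
  exact eLpNorm_freeS_four_le ht η

theorem enorm_inner_toL2_toL2_le (ψ η : 𝓢(Plane, ℂ)) :
    ‖inner ℂ (toL2 ψ) (toL2 η)‖ₑ ≤ eLpNorm ψ (4 / 3) volume * eLpNorm η 4 volume := by
  have h1 : inner ℂ (toL2 ψ) (toL2 η) = ∫ x, ((⇑(conjS ψ)) • (⇑η)) x := by
    rw [inner_toL2]
    refine integral_congr_ae ?_
    filter_upwards [η.coeFn_toLp 2 volume] with x hx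
    rw [hx]
    rfl
  have h2 : eLpNorm (conjS ψ) (4 / 3) volume = eLpNorm ψ (4 / 3) volume :=
    eLpNorm_congr_norm_ae (Eventually.of_forall fun x => by
      rw [conjS_apply, RCLike.norm_conj])
  rw [h1, ← h2]
  refine (enorm_integral_le_lintegral_enorm _).trans ?_
  rw [← eLpNorm_one_eq_lintegral_enorm]
  exact eLpNorm_smul_le_mul_eLpNorm η.continuous.aestronglyMeasurable
    (conjS ψ).continuous.aestronglyMeasurable

theorem freeEvolutionL2_sub (t : ℝ) (f g : L2) :
    freeEvolutionL2 t (f - g) = freeEvolutionL2 t f - freeEvolutionL2 t g :=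
  map_sub (freeIsometry t) f g

/-- Free waves converge weakly to zero. -/
theorem tendsto_inner_freeEvolutionL2 (f g : L2) :
    Tendsto (fun t => inner ℂ f (freeEvolutionL2 t g)) atTop (𝓝 0) := by
  rw [tendsto_zero_iff_norm_tendsto_zero, Metric.tendsto_atTop']
  intro ε hε
  obtain ⟨ψ, hψ⟩ := denseRange_toL2.exists_dist_lt f (by positivity : 0 < ε / 3 / (‖g‖ + 1))
  obtain ⟨η, hη⟩ := denseRange_toL2.exists_dist_lt g
    (by positivity : 0 < ε / 3 / (‖toL2 ψ‖ + 1))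
  have h1 : Tendsto (fun t => eLpNorm ψ (4 / 3) volume * eLpNorm (freeS t η) 4 volume) atTop
      (𝓝 0) := by
    have := ENNReal.Tendsto.const_mul (a := eLpNorm ψ (4 / 3) volume)
      (tendsto_eLpNorm_freeS_four η) (Or.inr (ψ.memLp (4 / 3) volume).eLpNorm_ne_top)
    rwa [mul_zero] at this
  have h2 := h1.eventually_lt_const (by positivity : (0 : ℝ≥0∞) < ENNReal.ofReal (ε / 3))
  obtain ⟨T, hT⟩ := eventually_atTop.1 h2
  refine ⟨T, fun t ht => ?_⟩
  have h3 := (enorm_inner_toL2_toL2_le ψ (freeS t η)).trans_lt (hT t ht.le)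
  rw [← ofReal_norm, ENNReal.ofReal_lt_ofReal_iff (by positivity)] at h3
  rw [dist_eq_norm, lt_div_iff₀ (by positivity)] at hψ hη
  have e : inner ℂ f (freeEvolutionL2 t g) = inner ℂ (f - toL2 ψ) (freeEvolutionL2 t g) +
      inner ℂ (toL2 ψ) (freeEvolutionL2 t (g - toL2 η)) +
      inner ℂ (toL2 ψ) (toL2 (freeS t η)) := by
    rw [freeEvolutionL2_sub, freeEvolutionL2_toL2, inner_sub_left, inner_sub_right]
    ring
  have h4 := norm_inner_le_norm (𝕜 := ℂ) (f - toL2 ψ) (freeEvolutionL2 t g)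
  have h5 := norm_inner_le_norm (𝕜 := ℂ) (toL2 ψ) (freeEvolutionL2 t (g - toL2 η))
  rw [norm_freeEvolutionL2] at h4 h5
  rw [dist_zero_right, norm_norm, e]
  refine (norm_add₃_le).trans_lt ?_
  nlinarith [norm_nonneg (f - toL2 ψ), norm_nonneg (g - toL2 η)]

theorem norm_freeEvolution (t : ℝ) (h : H1) : ‖freeEvolution t h‖ = ‖h‖ := by
  refine (sq_eq_sq₀ (norm_nonneg _) (norm_nonneg _)).1 ?_
  rw [H1.norm_sq_eq, H1.norm_sq_eq]
  change ‖freeEvolutionL2 t h.fn‖ ^ 2 + ∑ j, ‖freeEvolutionL2 t (h.partialDeriv j)‖ ^ 2 = _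
  simp only [norm_freeEvolutionL2]

theorem freeEvolution_sub (t : ℝ) (h k : H1) :
    freeEvolution t (h - k) = freeEvolution t h - freeEvolution t k := by
  refine H1.ext' ?_ fun j => ?_
  · rw [H1.fn_sub]
    exact (congrArg _ (H1.fn_sub h k)).trans (freeEvolutionL2_sub t _ _)
  · rw [H1.partialDeriv_sub]
    exact (congrArg _ (H1.partialDeriv_sub h k j)).trans (freeEvolutionL2_sub t _ _)

theorem tendsto_eLpNorm_freeEvolution_four (h : H1) :
    Tendsto (fun t => (eLpNorm (freeEvolution t h).fn 4 volume).toReal) atTop (𝓝 0) := by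
  obtain ⟨K, hK, h4⟩ := H1.exists_eLpNorm_four_le
  rw [Metric.tendsto_atTop']
  intro ε hε
  obtain ⟨η, hη⟩ := h.exists_schwartz_norm_sub_lt (by positivity : 0 < ε / 2 / (K + 1))
  rw [lt_div_iff₀ (by positivity)] at hη
  have h2 := (tendsto_eLpNorm_freeS_four η).eventually_lt_const
    (by positivity : (0 : ℝ≥0∞) < ENNReal.ofReal (ε / 2))
  obtain ⟨T, hT⟩ := eventually_atTop.1 h2
  refine ⟨T, fun t ht => ?_⟩
  have e1 : (freeEvolution t h).fn = (freeEvolution t (h - H1.ofSchwartz η)).fn +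
      toL2 (freeS t η) := by
    rw [freeEvolution_sub, H1.fn_sub, ← freeEvolutionL2_toL2]
    exact (sub_add_cancel _ _).symm
  have e2 : eLpNorm (toL2 (freeS t η)) 4 volume = eLpNorm (freeS t η) 4 volume :=
    eLpNorm_congr_ae ((freeS t η).coeFn_toLp 2 volume)
  have h5 : eLpNorm (freeEvolution t h).fn 4 volume < ENNReal.ofReal ε := by
    rw [e1, eLpNorm_congr_ae (Lp.coeFn_add _ _)]
    refine (eLpNorm_add_le (Lp.aestronglyMeasurable _) (Lp.aestronglyMeasurable _)
      (by norm_num)).trans_lt ?_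
    rw [← add_halves ε, ENNReal.ofReal_add (by positivity) (by positivity), e2]
    refine ENNReal.add_lt_add_of_le_of_lt ?_ ?_ (hT t ht.le)
    · exact ((h4 _).trans_lt ENNReal.ofReal_lt_top).ne
    · refine (h4 _).trans (ENNReal.ofReal_le_ofReal ?_)
      rw [norm_freeEvolution]
      nlinarith [norm_nonneg (h - H1.ofSchwartz η)]
  rw [dist_zero_right, Real.norm_eq_abs, abs_of_nonneg ENNReal.toReal_nonneg]
  exact (ENNReal.lt_ofReal_iff_toReal_lt h5.ne_top).1 h5

/-- If `g` converges weakly to zero and has constant norm `m`, then `‖f + g + o(1)‖²` converges to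
`‖f‖² + m²`. -/
theorem tendsto_norm_sq_of_weak {f : L2} {g k : ℝ → L2} {m : ℝ} (hg : ∀ t, ‖g t‖ = m)
    (hw : Tendsto (fun t => inner ℂ f (g t)) atTop (𝓝 0))
    (hk : Tendsto (fun t => ‖k t - f - g t‖) atTop (𝓝 0)) :
    Tendsto (fun t => ‖k t‖ ^ 2) atTop (𝓝 (‖f‖ ^ 2 + m ^ 2)) := by
  have h1 : Tendsto (fun t => ‖f + g t‖ ^ 2) atTop (𝓝 (‖f‖ ^ 2 + m ^ 2)) := by
    simp only [norm_add_sq_L2, hg]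
    have h2 := (Complex.continuous_re.tendsto 0).comp hw
    simpa using ((h2.const_mul 2).const_add (‖f‖ ^ 2)).add_const (m ^ 2)
  have h2 : Tendsto (fun t => ‖f + g t‖) atTop (𝓝 √(‖f‖ ^ 2 + m ^ 2)) := by
    refine ((Real.continuous_sqrt.tendsto _).comp h1).congr fun t => ?_
    rw [Function.comp_apply, Real.sqrt_sq (norm_nonneg _)]
  have h3 : Tendsto (fun t => ‖k t‖ - ‖f + g t‖) atTop (𝓝 0) := by
    refine squeeze_zero_norm (fun t => ?_) hk
    rw [Real.norm_eq_abs, sub_sub]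
    exact abs_norm_sub_norm_le _ _
  have h4 := (h3.add h2).pow 2
  simp only [sub_add_cancel, zero_add] at h4
  rwa [Real.sq_sqrt (by positivity)] at h4

variable {V : Plane → ℝ} {β : ℝ → ℝ} {C : ℝ} {n : ℕ}

/-- The potential part of the energy does not see a free wave, which tends to zero in `L⁴`. -/
theorem ForceBounds.tendsto_potEnergy (h : ForceBounds V β C n) {ι : Type*} {l : Filter ι}
    {p : H1} {r k : ι → H1} {m : ℝ} (hm : 0 ≤ m)
    (hr : ∀ t, ‖r t‖ ≤ m)
    (hr4 : Tendsto (fun t => (eLpNorm (r t).fn 4 volume).toReal) l (𝓝 0))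
    (hk : Tendsto (fun t => ‖k t - p - r t‖) l (𝓝 0)) :
    Tendsto (fun t => potEnergy V β (k t).fn) l (𝓝 (potEnergy V β p.fn)) := by
  obtain ⟨K₁, hK₁, hP⟩ := h.exists_abs_potEnergy_sub_le (1 + ‖p‖ + m)
  obtain ⟨K, hK, h4⟩ := H1.exists_eLpNorm_four_le
  have hlim : Tendsto (fun t => K₁ * (K * ‖k t - p - r t‖ +
      (eLpNorm (r t).fn 4 volume).toReal)) l (𝓝 0) := by
    simpa using ((hk.const_mul K).add hr4).const_mul K₁
  rw [tendsto_iff_norm_sub_tendsto_zero]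
  refine squeeze_zero' (Eventually.of_forall fun _ => norm_nonneg _) ?_ hlim
  filter_upwards [hk.eventually_le_const (zero_lt_one)] with t ht
  have e1 : k t = (k t - p - r t) + p + r t := by abel
  have hkt : ‖k t‖ ≤ 1 + ‖p‖ + m := by
    rw [e1]
    exact (norm_add₃_le).trans (add_le_add (add_le_add ht le_rfl) (hr t))
  refine (hP _ _ hkt (by linarith)).trans (mul_le_mul_of_nonneg_left ?_ hK₁)
  have e2 : (k t - p).fn = (k t - p - r t).fn + (r t).fn := by
    rw [← H1.fn_add, sub_add_cancel]
  have hr_top : eLpNorm (r t).fn 4 volume ≠ ∞ := ((h4 _).trans_lt ENNReal.ofReal_lt_top).ne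
  have h5 : eLpNorm (k t - p).fn 4 volume ≤
      ENNReal.ofReal (K * ‖k t - p - r t‖) + eLpNorm (r t).fn 4 volume := by
    rw [e2, eLpNorm_congr_ae (Lp.coeFn_add _ _)]
    exact (eLpNorm_add_le (Lp.aestronglyMeasurable _) (Lp.aestronglyMeasurable _)
      (by norm_num)).trans (add_le_add (h4 _) le_rfl)
  have h6 := ENNReal.toReal_mono (ENNReal.add_ne_top.2 ⟨ENNReal.ofReal_ne_top, hr_top⟩) h5
  rwa [ENNReal.toReal_add ENNReal.ofReal_ne_top hr_top,
    ENNReal.toReal_ofReal (by positivity)] at h6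

/-! ### Phase invariance -/

theorem norm_exp_I_mul (θ : ℝ) : ‖Complex.exp (Complex.I * θ)‖ = 1 := by
  rw [mul_comm]
  exact Complex.norm_exp_ofReal_mul_I θ

theorem norm_sq_coeFn_smul {c : ℂ} (hc : ‖c‖ = 1) (f : L2) :
    ∀ᵐ x, ‖(c • f : L2) x‖ = ‖f x‖ := by
  filter_upwards [Lp.coeFn_smul c f] with x hx
  rw [hx, Pi.smul_apply, norm_smul, hc, one_mul]

theorem potEnergy_smul {c : ℂ} (hc : ‖c‖ = 1) (f : L2) :
    potEnergy V β (c • f) = potEnergy V β f := by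
  refine integral_congr_ae ?_
  filter_upwards [norm_sq_coeFn_smul hc f] with x hx
  simp only [potDensity, hx]

theorem ForceBounds.energy_smul (h : ForceBounds V β C n) {c : ℂ} (hc : ‖c‖ = 1) (u : H1) :
    energy V β (c • u) = energy V β u := by
  rw [h.energy_eq, h.energy_eq, H1.fn_smul, potEnergy_smul hc]
  simp only [H1.partialDeriv_smul, norm_smul, hc, one_mul]

/-- Mass and energy of a solution that scatters to a bound state: in the limit the free wave
contributes its mass and its kinetic energy. -/
theorem ForceBounds.tendsto_mass_energy (h : ForceBounds V β C n) {u : ℝ → H1} {p q : H1}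
    {θ : ℝ → ℝ} (hlim : Tendsto (fun t : ℝ =>
      ‖u t - Complex.exp (Complex.I * θ t) • p - freeEvolution t q‖) atTop (𝓝 0)) :
    Tendsto (fun t => mass (u t)) atTop (𝓝 (mass p + mass q)) ∧
      Tendsto (fun t => energy V β (u t)) atTop
        (𝓝 (energy V β p + 2⁻¹ * ∑ j, ‖q.partialDeriv j‖ ^ 2)) := by
  -- passing to a rotating frame makes the bound state stationary
  set c : ℝ → ℂ := fun t => Complex.exp (Complex.I * ((-θ t : ℝ) : ℂ)) with hc
  have hc1 : ∀ t, ‖c t‖ = 1 := fun t => norm_exp_I_mul _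
  have hcc : ∀ t, c t * Complex.exp (Complex.I * θ t) = 1 := fun t => by
    rw [hc, ← Complex.exp_add]
    simp
  set k : ℝ → H1 := fun t => c t • u t with hkdef
  set r : ℝ → H1 := fun t => c t • freeEvolution t q with hrdef
  have hk : Tendsto (fun t => ‖k t - p - r t‖) atTop (𝓝 0) := by
    refine hlim.congr fun t => ?_
    have e : k t - p - r t =
        c t • (u t - Complex.exp (Complex.I * θ t) • p - freeEvolution t q) := by
      rw [smul_sub, smul_sub, smul_smul, hcc, one_smul]
    rw [e, norm_smul, hc1, one_mul]
  have hr4 : Tendsto (fun t => (eLpNorm (r t).fn 4 volume).toReal) atTop (𝓝 0) := by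
    refine (tendsto_eLpNorm_freeEvolution_four q).congr fun t => ?_
    congr 1
    refine eLpNorm_congr_norm_ae ?_
    filter_upwards [norm_sq_coeFn_smul (hc1 t) (freeEvolution t q).fn] with x hx
    rw [hrdef, H1.fn_smul, hx]
  have hweak : ∀ f g : L2, Tendsto (fun t => inner ℂ f (c t • freeEvolutionL2 t g)) atTop
      (𝓝 0) := fun f g => by
    rw [tendsto_zero_iff_norm_tendsto_zero]
    refine (tendsto_zero_iff_norm_tendsto_zero.1 (tendsto_inner_freeEvolutionL2 f g)).congr
      fun t => ?_
    rw [inner_smul_right, norm_mul, hc1, one_mul]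
  have hn : ∀ (g : L2) t, ‖c t • freeEvolutionL2 t g‖ = ‖g‖ := fun g t => by
    rw [norm_smul, hc1, one_mul, norm_freeEvolutionL2]
  have hP := h.tendsto_potEnergy (norm_nonneg q)
    (fun t => by rw [hrdef, norm_smul, hc1, one_mul, norm_freeEvolution]) hr4 hk
  have hfn : Tendsto (fun t => ‖(k t).fn‖ ^ 2) atTop (𝓝 (‖p.fn‖ ^ 2 + ‖q.fn‖ ^ 2)) := by
    refine tendsto_norm_sq_of_weak (hn q.fn) (hweak p.fn q.fn)
      (squeeze_zero (fun _ => norm_nonneg _) (fun t => ?_) hk)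
    have e : (k t).fn - p.fn - c t • freeEvolutionL2 t q.fn = (k t - p - r t).fn := by
      rw [H1.fn_sub, H1.fn_sub, hrdef, H1.fn_smul]
      rfl
    rw [e]
    exact H1.norm_fn_le _
  have hpd : ∀ j, Tendsto (fun t => ‖(k t).partialDeriv j‖ ^ 2) atTop
      (𝓝 (‖p.partialDeriv j‖ ^ 2 + ‖q.partialDeriv j‖ ^ 2)) := fun j => by
    refine tendsto_norm_sq_of_weak (hn (q.partialDeriv j)) (hweak _ (q.partialDeriv j))
      (squeeze_zero (fun _ => norm_nonneg _) (fun t => ?_) hk)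
    have e : (k t).partialDeriv j - p.partialDeriv j - c t • freeEvolutionL2 t (q.partialDeriv j) =
        (k t - p - r t).partialDeriv j := by
      rw [H1.partialDeriv_sub, H1.partialDeriv_sub, hrdef, H1.partialDeriv_smul]
      rfl
    rw [e]
    exact H1.norm_partialDeriv_le _ j
  constructor
  · rw [mass_eq, mass_eq, ← mul_add]
    refine (hfn.const_mul 2⁻¹).congr fun t => ?_
    rw [mass_eq, hkdef, H1.fn_smul, norm_smul, hc1, one_mul]
  · rw [h.energy_eq, ← mul_add, add_right_comm, ← Finset.sum_add_distrib]
    refine (((tendsto_finsetSum _ fun j _ => hpd j).add hP).const_mul 2⁻¹).congr fun t => ?_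
    rw [← h.energy_eq, hkdef, h.energy_smul (hc1 t)]

end

section

variable {V : Plane → ℝ} {β : ℝ → ℝ} {C : ℝ} {n : ℕ}

/-! ### Bound states as critical points of the action -/

theorem H1.norm_le_add (u : H1) : ‖u‖ ≤ ‖u.fn‖ + ∑ j, ‖u.partialDeriv j‖ := by
  refine abs_le_of_sq_le_sq' ?_ (by positivity) |>.2
  rw [H1.norm_sq_eq, Fin.sum_univ_two, Fin.sum_univ_two]
  have h0 := norm_nonneg u.fn
  have h1 := norm_nonneg (u.partialDeriv 0)
  have h2 := norm_nonneg (u.partialDeriv 1)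
  nlinarith [mul_nonneg h0 h1, mul_nonneg h0 h2, mul_nonneg h1 h2]

/-- A bound state is a critical point of the action `E + ω Q`, with a quadratic remainder. -/
theorem ForceBounds.exists_abs_action_sub_le (h : ForceBounds V β C n) {ψ : 𝓢(Plane, ℂ)} {ω : ℝ}
    (hω : 0 ≤ ω) (hψ : ∀ x, (Δ ψ) x - (V x : ℂ) * ψ x - (ω : ℂ) * ψ x -
      ((β (‖ψ x‖ ^ 2) : ℝ) : ℂ) * ψ x = 0) (R : ℝ) :
    ∃ A : ℝ, 0 ≤ A ∧ ∀ v : H1, ‖v‖ ≤ R →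
      |energy V β v + ω * mass v -
        (energy V β (H1.ofSchwartz ψ) + ω * mass (H1.ofSchwartz ψ))| ≤
        A * ‖v - H1.ofSchwartz ψ‖ ^ 2 := by
  set φ := H1.ofSchwartz ψ with hφ
  obtain ⟨K, hK, htay⟩ := h.exists_abs_taylor_le (max R ‖φ‖)
  obtain ⟨F, hF⟩ := h.exists_schwartz_force ψ
  refine ⟨1 + K + ω, by positivity, fun v hv => ?_⟩
  set w := v - φ with hw
  have hvw : φ + w = v := by rw [hw]; abel
  have ht := htay φ w (le_max_right _ _) (by rw [hvw]; exact hv.trans (le_max_left _ _))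
  have hΔ : Δ ψ = F + (ω : ℂ) • ψ := by
    ext x
    have := hψ x
    rw [add_apply, smul_apply, smul_eq_mul, hF, force]
    push_cast
    linear_combination this
  have hfn : v.fn = φ.fn + w.fn := by rw [← H1.fn_add, hvw]
  have hpd : ∀ j, v.partialDeriv j = φ.partialDeriv j + w.partialDeriv j := fun j => by
    rw [← H1.partialDeriv_add, hvw]
  have hin : ∑ j, (inner ℂ (φ.partialDeriv j) (w.partialDeriv j)).re +
      (inner ℂ w.fn (nl V β φ.fn)).re + ω * (inner ℂ φ.fn w.fn).re = 0 := by
    have h1 := congrArg Complex.re (H1.sum_inner_partialDeriv ψ w)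
    rw [hΔ, toL2_add, toL2_smul, inner_add_left, inner_smul_left, Complex.conj_ofReal,
      Complex.neg_re, Complex.add_re, Complex.re_ofReal_mul, Complex.re_sum,
      h.toL2_eq_nl hF] at h1
    rw [← inner_conj_symm, Complex.conj_re]
    simp only [hφ, H1.partialDeriv_ofSchwartz]
    rw [h1, H1.fn_ofSchwartz]
    ring
  have hn := H1.norm_sq_eq w
  have hs : ∑ j, ‖v.partialDeriv j‖ ^ 2 = ∑ j, ‖φ.partialDeriv j‖ ^ 2 +
      2 * ∑ j, (inner ℂ (φ.partialDeriv j) (w.partialDeriv j)).re +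
      ∑ j, ‖w.partialDeriv j‖ ^ 2 := by
    rw [Finset.mul_sum, ← Finset.sum_add_distrib, ← Finset.sum_add_distrib]
    exact Finset.sum_congr rfl fun j _ => by rw [hpd, norm_add_sq_L2]
  have hm := norm_add_sq_L2 φ.fn w.fn
  have hs0 : 0 ≤ ∑ j, ‖w.partialDeriv j‖ ^ 2 := Finset.sum_nonneg fun _ _ => sq_nonneg _
  have hf0 : 0 ≤ ‖w.fn‖ ^ 2 := sq_nonneg _
  rw [hvw] at ht
  have e : energy V β v + ω * mass v - (energy V β φ + ω * mass φ) =
      2⁻¹ * (∑ j, ‖w.partialDeriv j‖ ^ 2 + ω * ‖w.fn‖ ^ 2 + (potEnergy V β v.fn -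
        potEnergy V β φ.fn - 2 * (inner ℂ w.fn (nl V β φ.fn)).re)) := by
    rw [h.energy_eq, h.energy_eq, mass_eq, mass_eq, hs, hfn, hm]
    linear_combination hin
  rw [e]
  have h1 := abs_le.1 ht
  have h2 : ω * ‖w.fn‖ ^ 2 ≤ ω * ‖w‖ ^ 2 := mul_le_mul_of_nonneg_left (by linarith) hω
  have h3 : 0 ≤ ω * ‖w.fn‖ ^ 2 := by positivity
  have h4 : 0 ≤ K * ‖w‖ ^ 2 := by positivity
  have h5 : 0 ≤ ω * ‖w‖ ^ 2 := by positivity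
  have h6 := sq_nonneg ‖w‖
  rw [abs_le]
  constructor <;> linarith [h1.1, h1.2]

/-! ### Mass and energy along the family of bound states -/

/-- The family of bound states is locally Lipschitz with values in `H¹`. -/
theorem IsVortexFamily.isBigO_sub {O : Set ℝ} {φ : ℝ → 𝓢(Plane, ℂ)}
    (hφ : IsVortexFamily V β O φ) {ω : ℝ} (hω : ω ∈ O) :
    (fun w => ‖H1.ofSchwartz (φ w) - H1.ofSchwartz (φ ω)‖) =O[𝓝 ω] fun w => w - ω := by
  have hb : ∀ α, (fun w => ‖(multiDeriv α (φ w)).toLp 2 volume -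
      (multiDeriv α (φ ω)).toLp 2 volume‖) =O[𝓝 ω] fun w => w - ω := fun α =>
    (((hφ.contDiffOn_multiDeriv α).contDiffAt (hφ.isOpen.mem_nhds hω)).differentiableAt
      (by norm_num)).isBigO_sub.norm_left
  have h0 := hb ![0, 0]
  have h1 := hb ![1, 0]
  have h2 := hb ![0, 1]
  refine Asymptotics.IsBigO.trans (Asymptotics.isBigO_of_le _ fun w => ?_) (h0.add (h1.add h2))
  rw [norm_norm]
  refine (H1.norm_le_add _).trans ((le_of_eq ?_).trans (le_abs_self _))
  rw [Fin.sum_univ_two, H1.fn_sub, H1.partialDeriv_sub, H1.partialDeriv_sub]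
  rfl

/-- Near `ω`, a bound state of smaller mass has larger energy: to first order
`dE = -ω dQ` along the family. -/
theorem IsVortexFamily.eventually_energy_le {O : Set ℝ} {φ : ℝ → 𝓢(Plane, ℂ)}
    (h : ForceBounds V β C n) (hφ : IsVortexFamily V β O φ) {ω : ℝ} (hω : ω ∈ O)
    (hq : deriv (fun w => mass (H1.ofSchwartz (φ w))) ω ≠ 0) :
    ∀ᶠ w in 𝓝 ω, mass (H1.ofSchwartz (φ w)) ≤ mass (H1.ofSchwartz (φ ω)) →
      energy V β (H1.ofSchwartz (φ ω)) ≤ energy V β (H1.ofSchwartz (φ w)) := by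
  have hω0 := hφ.pos ω hω
  obtain ⟨A, hA, hact⟩ := h.exists_abs_action_sub_le hω0.le (hφ.equation ω hω)
    (‖H1.ofSchwartz (φ ω)‖ + 1)
  obtain ⟨K, hK, hlip⟩ := (hφ.isBigO_sub hω).exists_pos
  obtain ⟨K', hK', hmass⟩ := ((differentiableAt_of_deriv_ne_zero hq).hasDerivAt.isTheta_sub
    hq).2.exists_pos
  rw [Asymptotics.isBigOWith_iff] at hlip hmass
  rw [prod_pure, eventually_map] at hmass
  -- the first bound keeps `φ_w` in the unit ball about `φ_ω`, the second one absorbs the remainder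
  have hsmall : ∀ᶠ w in 𝓝 ω, |w - ω| < min (1 / K) (ω / (A * K ^ 2 * K' + 1)) :=
    eventually_abs_sub_lt ω (by positivity)
  filter_upwards [hlip, hmass, hsmall] with w h1 h2 h3 hle
  rw [norm_norm, Real.norm_eq_abs] at h1
  rw [Real.norm_eq_abs, Real.norm_eq_abs, abs_of_nonpos (sub_nonpos.2 hle)] at h2
  have h4 := (lt_div_iff₀ hK).1 (h3.trans_le (min_le_left _ _))
  have h5 := (lt_div_iff₀ (by positivity)).1 (h3.trans_le (min_le_right _ _))
  set d := ‖H1.ofSchwartz (φ w) - H1.ofSchwartz (φ ω)‖ with hd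
  have h6 : ‖H1.ofSchwartz (φ w)‖ ≤ ‖H1.ofSchwartz (φ ω)‖ + 1 := by
    have := norm_sub_norm_le (H1.ofSchwartz (φ w)) (H1.ofSchwartz (φ ω))
    linarith
  have h7 := (abs_le.1 (hact _ h6)).1
  have h8 : A * d ^ 2 ≤ A * (K * |w - ω|) ^ 2 := by gcongr
  set m := mass (H1.ofSchwartz (φ ω)) - mass (H1.ofSchwartz (φ w)) with hm
  have hm0 : 0 ≤ m := sub_nonneg.2 hle
  have h9 : A * (K * |w - ω|) ^ 2 ≤ ω * m := by
    have h2' : |w - ω| ≤ K' * m := by rw [hm]; linarith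
    have a0 := abs_nonneg (w - ω)
    calc A * (K * |w - ω|) ^ 2 = (A * K ^ 2 * |w - ω|) * |w - ω| := by ring
      _ ≤ (A * K ^ 2 * |w - ω|) * (K' * m) := by gcongr
      _ = |w - ω| * (A * K ^ 2 * K') * m := by ring
      _ ≤ ω * m := mul_le_mul_of_nonneg_right (by linarith) hm0
  have h10 : ω * m = ω * mass (H1.ofSchwartz (φ ω)) - ω * mass (H1.ofSchwartz (φ w)) := by
    rw [hm, mul_sub]
  linarith

/-! ### Smooth data of equal mass and smaller energy -/

/-- An element of `H¹` is determined by its function. -/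
theorem H1.ext_fn {u v : H1} (h : u.fn = v.fn) : u = v := by
  refine H1.ext' h fun j => L2.ext_inner fun ψ => ?_
  have h1 := (isWeakPartial_iff_inner j _ _).1 (u.isWeakPartial j) ψ
  have h2 := (isWeakPartial_iff_inner j _ _).1 (v.isWeakPartial j) ψ
  rw [h, h2] at h1
  exact (neg_injective h1).symm

theorem ForceBounds.tendsto_energy (h : ForceBounds V β C n) {ι : Type*} {l : Filter ι} {u : H1}
    {v : ι → H1} (hv : Tendsto (fun k => ‖v k - u‖) l (𝓝 0)) :
    Tendsto (fun k => energy V β (v k)) l (𝓝 (energy V β u)) := by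
  have hP := h.tendsto_potEnergy (p := u) (r := fun _ => 0) (k := v) (l := l) le_rfl
    (fun _ => norm_zero.le) ?_ (by simpa using hv)
  · rw [h.energy_eq]
    refine (((tendsto_finsetSum _ fun j _ => ((tendsto_iff_norm_sub_tendsto_zero.2
      (squeeze_zero (fun _ => norm_nonneg _) (fun k => ?_) hv)).norm.pow 2)).add
      hP).const_mul 2⁻¹).congr fun k => (h.energy_eq (v k)).symm
    rw [← H1.partialDeriv_sub]
    exact H1.norm_partialDeriv_le _ j
  · have e : eLpNorm (H1.fn 0) 4 volume = 0 := by
      have : (H1.fn 0 : L2) = 0 := rfl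
      rw [this, eLpNorm_congr_ae (Lp.coeFn_zero _ _ _)]
      exact eLpNorm_zero
    simpa only [e, ENNReal.toReal_zero] using tendsto_const_nhds

/-- The nearby states of smaller energy can be taken to be Schwartz functions: approximation in `H¹`
is followed by a dilation of the values that restores the mass. -/
theorem NotTrappedByEnergy.exists_schwartz (h : ForceBounds V β C n) {φ : H1}
    (htrap : NotTrappedByEnergy V β φ) {δ : ℝ} (hδ : 0 < δ) :
    ∃ η : 𝓢(Plane, ℂ), ‖φ - H1.ofSchwartz η‖ < δ ∧ mass (H1.ofSchwartz η) = mass φ ∧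
      energy V β (H1.ofSchwartz η) < energy V β φ := by
  obtain ⟨u, hu, hum, huE⟩ := htrap (δ / 2) (half_pos hδ)
  -- a state without mass is zero, and there is only one state of that mass
  have hpos : 0 < ‖u.fn‖ := by
    refine norm_pos_iff.2 fun h0 => huE.ne ?_
    have h1 : φ.fn = 0 := by rw [← norm_eq_zero, ← hum, h0, norm_zero]
    rw [H1.ext_fn (h0.trans h1.symm)]
  obtain ⟨η, hη⟩ := u.exists_schwartz_seq
  have hfn : Tendsto (fun k => ‖toL2 (η k)‖) atTop (𝓝 ‖u.fn‖) := by
    refine (tendsto_iff_norm_sub_tendsto_zero.2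
      (squeeze_zero (fun _ => norm_nonneg _) (fun k => ?_) hη)).norm
    rw [norm_sub_rev, ← H1.fn_ofSchwartz, ← H1.fn_sub]
    exact H1.norm_fn_le _
  have hnorm : Tendsto (fun k => ‖H1.ofSchwartz (η k)‖) atTop (𝓝 ‖u‖) :=
    (tendsto_iff_norm_sub_tendsto_zero.2 (hη.congr fun k => norm_sub_rev _ _)).norm
  set c : ℕ → ℝ := fun k => ‖u.fn‖ / ‖toL2 (η k)‖ with hcdef
  have hc : Tendsto (fun k => |c k - 1|) atTop (𝓝 0) := by
    have := (((tendsto_const_nhds (x := ‖u.fn‖)).div hfn hpos.ne').sub_const 1).abs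
    rwa [div_self hpos.ne', sub_self, abs_zero] at this
  have hlim : Tendsto (fun k => ‖H1.ofSchwartz ((c k : ℂ) • η k) - u‖) atTop (𝓝 0) := by
    have hbound := (hc.mul hnorm).add hη
    rw [zero_mul, add_zero] at hbound
    refine squeeze_zero (fun _ => norm_nonneg _) (fun k => ?_) hbound
    have e : H1.ofSchwartz ((c k : ℂ) • η k) - u =
        ((c k - 1 : ℝ) : ℂ) • H1.ofSchwartz (η k) - (u - H1.ofSchwartz (η k)) := by
      rw [H1.ofSchwartz_smul, Complex.ofReal_sub, sub_smul, Complex.ofReal_one, one_smul]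
      abel
    rw [e]
    refine (norm_sub_le _ _).trans_eq ?_
    rw [norm_smul, Complex.norm_real, Real.norm_eq_abs]
  obtain ⟨k, h1, h2, h3⟩ := ((hfn.eventually_const_lt hpos).and
    ((hlim.eventually_lt_const (half_pos hδ)).and
      ((h.tendsto_energy hlim).eventually_lt_const huE))).exists
  refine ⟨(c k : ℂ) • η k, ?_, ?_, h3⟩
  · have e : φ - H1.ofSchwartz ((c k : ℂ) • η k) =
        (φ - u) - (H1.ofSchwartz ((c k : ℂ) • η k) - u) := by abel
    rw [e]
    exact (norm_sub_le _ _).trans_lt (by linarith)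
  · rw [mass_eq, mass_eq, H1.fn_ofSchwartz, toL2_smul, norm_smul, Complex.norm_real,
      Real.norm_eq_abs, abs_of_nonneg (by positivity), hcdef, div_mul_cancel₀ _ h1.ne', hum]

theorem orbitDist_le (φ u : H1) : orbitDist φ u ≤ ‖u - φ‖ₑ := by
  refine (iInf_le _ 0).trans_eq ?_
  simp

end

end NLS

end

theorem theorem1p1 (V : NLS.Plane → ℝ) (β : ℝ → ℝ) (O : Set ℝ)
    (φ : ℝ → SchwartzMap NLS.Plane ℂ)
    (hβ : NLS.IsAdmissibleNonlinearity β)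
    (hV : NLS.IsAdmissiblePotential V)
    (hφ : NLS.IsVortexFamily V β O φ)
    (hq : ∀ ω ∈ O, deriv (fun w => NLS.mass (NLS.H1.ofSchwartz (φ w))) ω ≠ 0)
    (ω : ℝ) (hω : ω ∈ O)
    (htrap : NLS.NotTrappedByEnergy V β (NLS.H1.ofSchwartz (φ ω)))
    (hstab : NLS.ConditionallyAsymptoticallyStable V β O
      (fun w => NLS.H1.ofSchwartz (φ w)) ω) :
    NLS.OrbitallyUnstable V β (NLS.H1.ofSchwartz (φ ω)) := by
  obtain ⟨C, n, h⟩ := NLS.exists_forceBounds hβ hV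
  intro hst
  obtain ⟨ε₀, hε₀, C₀, hC₀, hcas⟩ := hstab
  obtain ⟨ρ, hρ, hnear⟩ := Metric.eventually_nhds_iff.1 (hφ.eventually_energy_le h hω (hq ω hω))
  -- `ε₀` makes scattering applicable, and `ρ` keeps `ω₊` in the range where energy and mass compare
  set ε := min (ε₀ / 2) (ρ / (2 * C₀)) with hε
  have hε_pos : 0 < ε := by positivity
  have hε_lt : ε < ε₀ := (min_le_left _ _).trans_lt (half_lt_self hε₀)
  have hε_ρ : C₀ * ε < ρ := by
    have h1 : C₀ * ε ≤ C₀ * (ρ / (2 * C₀)) :=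
      mul_le_mul_of_nonneg_left (min_le_right _ _) hC₀.le
    have h2 : C₀ * (ρ / (2 * C₀)) = ρ / 2 := by field_simp
    linarith
  obtain ⟨δ, hδ, hsol⟩ := hst (ε / 2) (half_pos hε_pos)
  obtain ⟨η, hη, hηm, hηE⟩ := htrap.exists_schwartz h (lt_min hδ (half_pos hε_pos))
  obtain ⟨u, hu, hu0, hsup⟩ := hsol _ (hη.trans_le (min_le_left _ _))
  -- stability controls positive times only; at time `0` the choice of the datum does
  have hclose : (⨆ t : ℝ, ⨆ _ : 0 ≤ t, NLS.orbitDist (NLS.H1.ofSchwartz (φ ω)) (u t)) <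
      ENNReal.ofReal ε := by
    refine lt_of_le_of_lt (iSup₂_le fun t ht => ?_)
      ((ENNReal.ofReal_lt_ofReal_iff hε_pos).2 (half_lt_self hε_pos))
    rcases ht.eq_or_lt with rfl | ht
    · refine (NLS.orbitDist_le _ _).trans ?_
      rw [hu0, ← ofReal_norm, norm_sub_rev]
      exact ENNReal.ofReal_le_ofReal (hη.le.trans (min_le_right _ _))
    · exact (le_iSup₂ (f := fun (t : ℝ) (_ : 0 < t) =>
        NLS.orbitDist (NLS.H1.ofSchwartz (φ ω)) (u t)) t ht).trans hsup.le
  obtain ⟨ωp, hωp, θ, -, hp, hbound, hlim⟩ := hcas ε u hε_lt hu hclose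
  obtain ⟨hmass, henergy⟩ := h.tendsto_mass_energy hlim
  -- conservation of mass: the radiation takes its mass from the bound state
  have hm : NLS.mass (NLS.H1.ofSchwartz (φ ωp)) + NLS.mass hp =
      NLS.mass (NLS.H1.ofSchwartz (φ ω)) := by
    refine tendsto_nhds_unique hmass (tendsto_const_nhds.congr' ?_)
    filter_upwards [Filter.eventually_ge_atTop 0] with t ht
    rw [← hηm, ← hu0, NLS.mass_eq, NLS.mass_eq, hu.norm_fn_eq h hu0 ht]
  have hE : NLS.energy V β (NLS.H1.ofSchwartz (φ ωp)) +
      2⁻¹ * ∑ j, ‖hp.partialDeriv j‖ ^ 2 ≤ NLS.energy V β (NLS.H1.ofSchwartz η) := by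
    refine le_of_tendsto henergy ?_
    filter_upwards [Filter.eventually_ge_atTop 0] with t ht
    rw [← hu0]
    exact hu.energy_le h hu0 ht
  have hmp : 0 ≤ NLS.mass hp := by
    rw [NLS.mass_eq]
    positivity
  have hkin : 0 ≤ 2⁻¹ * ∑ j, ‖hp.partialDeriv j‖ ^ 2 := by positivity
  have hdist : dist ωp ω < ρ := by
    rw [Real.dist_eq]
    linarith [norm_nonneg hp]
  have := hnear hdist (by linarith)
  linarith
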